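/- Let $\mathbb K$ be a field of characteristic zero and $X$ a smooth separated scheme of finite type over $\mathbb K$, with tangent sheaf $\Theta_X$ and cotangent sheaf $\Omega^1_X$. Degrees of homogeneous elements are denoted $\overline{x}$. **DG-Lie algebroids.** A DG-Lie algebroid over $X$ is a complex $\mathcal A$ of sheaves of $\mathcal O_X$-modules with a $\mathbb K$-bilinear bracket making the sections into DG-Lie algebras over $\mathbb K$, and a morphism of complexes of $\mathcal O_X$-modules $\rho\colon\mathcal A\to\Theta_X$ (the anchor, $\Theta_X$ in degree $0$) which is a homomorphism of DG-Lie algebras on sections and satisfies $[a_1,fa_2]=f[a_1,a_2]+\rho(a_1)(f)a_2$. It is transitive if $\rho$ is surjective. Let $(\mathcal A,\rho)$ be a transitive DG-Lie algebroid over $X$ such that $\mathcal L=\operatorname{Ker}\rho$ is a finite complex of locally free sheaves. **Totalisation.** Let $\mathcal U=\{U_i\}$ be an affine open cover of $X$. Let $A_n=\mathbb K[t_0,\dots,t_n,dt_0,\dots,dt_n]/(1-\sum t_i,\sum dt_i)$ be the DG-algebra of polynomial differential forms on the $n$-simplex, with face maps $\delta_k^*$. For a complex $\mathcal E$ of sheaves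 of $\mathbb K$-vector spaces on $X$ let $\operatorname{Tot}(\mathcal U,\mathcal E)$ be the complex of sequences $(x_n)_{n\ge0}$, $x_n\in A_n\otimes\prod_{i_0,\dots,i_n}\mathcal E(U_{i_0\cdots i_n})$, such that $(\delta_k^*\otimes\operatorname{Id})x_n=(\operatorname{Id}\otimes\delta_k)x_{n-1}$ for $0\le k\le n$, where $\delta_k$ are the Čech coface maps, graded by total degree, with differential $d_{\operatorname{Tot}}(\eta\otimes s)=d\eta\otimes s+(-1)^{\overline\eta}\eta\otimes ds$. A bilinear map of complexes of sheaves induces one on totalisations by $(\eta\otimes s,\phi\otimes t)\mapsto(-1)^{\overline\phi\,\overline s}\eta\phi\otimes(s,t)$. In this way $\operatorname{Tot}(\mathcal U,\mathcal L)$ is a DG-Lie algebra. Let $\Omega^1_X[-1]$ be $\Omega_X^1$ in degree $1$; on $\Omega^1_X[-1]\otimes\mathcal A$ and $\Omega^1_X[-1]\otimes\mathcal L$ put $d(\eta\otimes x)=-\eta\otimes dx$. Finally let $\Omega_X^{\le1}=(\mathcal O_X\xrightarrow{d_{dR}}\Omega^1_X)$; then $\operatorname{Tot}(\mathcal U,\Omega_X^{\le1}[2])$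 is a DG-Lie algebra with zero bracket. **Cyclic forms.** A cyclic form on $\mathcal A$ is a graded symmetric $\mathcal O_X$-bilinear product $\langle-,-\rangle\colon\mathcal L\times\mathcal L\to\mathcal O_X$ of degree zero with $$\langle[a,x],y\rangle+(-1)^{\overline a\,\overline x}\langle x,[a,y]\rangle=\rho(a)(\langle x,y\rangle)$$ for all sections $a$ of $\mathcal A$ and $x,y$ of $\mathcal L$. It extends to $(\Omega^1_X[-1]\otimes\mathcal L)\times\mathcal L\to\Omega^1_X[-1]$ by $\langle\omega\otimes x,y\rangle=\langle x,y\rangle\,\omega$, and both forms induce forms, still denoted $\langle-,-\rangle$, on the totalisations. The form is $d_{\operatorname{Tot}}$-closed if $$\langle d_{\operatorname{Tot}}z,w\rangle+(-1)^{\overline z}\langle z,d_{\operatorname{Tot}}w\rangle=d_{\operatorname{Tot}}\langle z,w\rangle$$ for all homogeneous $w\in\operatorname{Tot}(\mathcal U,\mathcal L)$ and $z$ in $\operatorname{Tot}(\mathcal U,\mathcal L)$ or in $\operatorname{Tot}(\mathcal U,\Omega^1_X[-1]\otimes\mathcal L)$, where $\mathcal O_X$ and $\Omega^1_X[-1]$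 have zero differential. Let $\langle-,-\rangle$ be a $d_{\operatorname{Tot}}$-closed cyclic form. **Simplicial liftings.** A simplicial lifting of the identity is an element $D$ of degree one of $\operatorname{Tot}(\mathcal U,\Omega^1_X[-1]\otimes\mathcal A)$ such that $(\operatorname{Id}\otimes\rho)(D)=(1\otimes\operatorname{Id}_{\Omega^1})_n$, the element given by the global section $\operatorname{Id}_{\Omega^1}$ of $\Omega_X^1\otimes\Theta_X\cong\mathcal Hom(\Omega^1_X,\Omega^1_X)$. Let $D$ be one, and let $\nabla=[D,-]\colon\operatorname{Tot}(\mathcal U,\mathcal L)\to\operatorname{Tot}(\mathcal U,\Omega^1_X[-1]\otimes\mathcal L)$ be its connection, where the bracket is induced by $[\eta\otimes a,x]=\eta\otimes[a,x]$. **$L_\infty$ morphisms.** An $L_\infty$ morphism $g\colon V\rightsquigarrow M$ from a DG-Lie algebra $(V,\delta,[-,-])$ to a DG-Lie algebra $(M,d)$ with zero bracket is a sequence of graded skew-symmetric $n$-linear maps $g_n\colon V^{\times n}\to M$, $n\ge1$, of degree $1-n$, such that $dg_1(v)=g_1(\delta v)$ and, for $n\ge2$ and homogeneous $v_1,\dots,v_n$,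 $$dg_n(v_1,\dots,v_n)=(-1)^{1-n}\!\!\sum_{\sigma\in S(1,n-1)}\!\!\chi(\sigma)g_n(\delta v_{\sigma(1)},v_{\sigma(2)},\dots,v_{\sigma(n)})+(-1)^{2-n}\!\!\sum_{\sigma\in S(2,n-2)}\!\!\chi(\sigma)g_{n-1}([v_{\sigma(1)},v_{\sigma(2)}],v_{\sigma(3)},\dots,v_{\sigma(n)}),$$ with $S(p,q)$ the set of $(p,q)$-shuffles and $\chi(\sigma)$ the antisymmetric Koszul sign. **Theorem.** The element $u=d_{\operatorname{Tot}}D$ lies in $\operatorname{Tot}(\mathcal U,\Omega^1_X[-1]\otimes\mathcal L)$, in degree two, and there is an $L_\infty$ morphism between DG-Lie algebras over $\mathbb K$ $$f\colon\operatorname{Tot}(\mathcal U,\mathcal L)\rightsquigarrow\operatorname{Tot}(\mathcal U,\Omega_X^{\le1}[2])$$ whose components on homogeneous elements are $$f_1(x)=\langle u,x\rangle,\qquad f_2(x,y)=\tfrac12\bigl(\langle\nabla(x),y\rangle-(-1)^{\overline x\,\overline y}\langle\nabla(y),x\rangle\bigr),\qquad f_3(x,y,z)=-\tfrac12\langle x,[y,z]\rangle,$$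 and $f_n=0$ for all $n\ge4$. -/

import Mathlib

open CategoryTheory AlgebraicGeometry TensorProduct DirectSum

universe u v w

noncomputable section

namespace TWForms

variable (K : Type u) [Field K]

/-- Polynomial differential forms on the affine `n`-simplex,
`K[t₀, …, tₙ, dt₀, …, dtₙ] / (1 - ∑ tᵢ, ∑ dtᵢ)`, presented with `t₀` and `dt₀` eliminated:
`K[t₁, …, tₙ] ⊗ Λ(dt₁, …, dtₙ)`. -/
abbrev PolyForm (n : ℕ) : Type u :=
  MvPolynomial (Fin n) K ⊗[K] ExteriorAlgebra K (Fin n → K)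

/-- The barycentric coordinates `t₀, …, tₙ`, with `t₀ = 1 - t₁ - … - tₙ`. -/
def tPoly (n : ℕ) : Fin (n + 1) → MvPolynomial (Fin n) K :=
  Fin.cons (1 - ∑ i, MvPolynomial.X i) MvPolynomial.X

/-- The forms `dt₀, …, dtₙ`, with `dt₀ = - dt₁ - … - dtₙ`. -/
def dtVec (n : ℕ) : Fin (n + 1) → (Fin n → K) :=
  Fin.cons (-∑ i, Pi.single i 1) (fun i => Pi.single i 1)

/-- The grading involution `η ↦ (-1)^{deg η} η`. -/
def inv (n : ℕ) : PolyForm K n →ₐ[K] PolyForm K n :=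
  Algebra.TensorProduct.map (AlgHom.id K _) CliffordAlgebra.involute

/-- The sign operator `η ↦ (-1)^{p deg η} η`. -/
def koszul (n : ℕ) (p : ℤ) : PolyForm K n →ₗ[K] PolyForm K n :=
  if Even p then LinearMap.id else (inv K n).toLinearMap

/-- The differential `d(f w) = ∑ ∂ᵢf dtᵢ ∧ w`. -/
def dForm (n : ℕ) : PolyForm K n →ₗ[K] PolyForm K n :=
  ∑ i, TensorProduct.map (MvPolynomial.pderiv i).toLinearMap
    (LinearMap.mulLeft K (ExteriorAlgebra.ι K (Pi.single i 1)))

/-- Forms of degree `a`. -/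
def degForm (n a : ℕ) : Submodule K (PolyForm K n) :=
  Submodule.span K {x | ∃ f : MvPolynomial (Fin n) K, ∃ w ∈ ⋀[K]^a (Fin n → K), x = f ⊗ₜ w}

/-- The face map on functions: `tᵢ ↦ tᵢ` for `i < k`, `t_k ↦ 0`, `tᵢ ↦ tᵢ₋₁` for `i > k`
(see `facePoly_tPoly`, which includes `i = 0`). -/
def facePoly (n : ℕ) (k : Fin (n + 2)) :
    MvPolynomial (Fin (n + 1)) K →ₐ[K] MvPolynomial (Fin n) K :=
  MvPolynomial.aeval fun i => k.insertNth (α := fun _ => MvPolynomial (Fin n) K) 0 (tPoly K n) i.succ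

/-- The face map on the `dtᵢ` (see `faceVec_dtVec`). -/
def faceVec (n : ℕ) (k : Fin (n + 2)) : (Fin (n + 1) → K) →ₗ[K] (Fin n → K) :=
  Fintype.linearCombination K
    fun i => k.insertNth (α := fun _ => (Fin n → K)) 0 (dtVec K n) i.succ

/-- The face map `δ_k^* : A_{n+1} → A_n`, a morphism of algebras. -/
def face (n : ℕ) (k : Fin (n + 2)) : PolyForm K (n + 1) →ₐ[K] PolyForm K n :=
  Algebra.TensorProduct.map (facePoly K n k) (ExteriorAlgebra.map (faceVec K n k))

variable {K}

theorem sum_tPoly (n : ℕ) : ∑ i, tPoly K n i = 1 := by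
  simp [tPoly, Fin.sum_univ_succ]

theorem sum_dtVec (n : ℕ) : ∑ i, dtVec K n i = 0 := by
  simp [dtVec, Fin.sum_univ_succ]

theorem facePoly_tPoly (n : ℕ) (k i : Fin (n + 2)) :
    facePoly K n k (tPoly K (n + 1) i) =
      k.insertNth (α := fun _ => MvPolynomial (Fin n) K) 0 (tPoly K n) i := by
  have hs : ∑ i, k.insertNth (α := fun _ => MvPolynomial (Fin n) K) 0 (tPoly K n) i = 1 := by
    rw [Fin.sum_univ_succAbove _ k]
    simp [sum_tPoly]
  refine Fin.cases ?_ (fun i => ?_) i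
  · rw [Fin.sum_univ_succ] at hs
    rw [eq_sub_of_add_eq hs]
    simp [tPoly, facePoly]
  · simp [tPoly, facePoly]

theorem faceVec_dtVec (n : ℕ) (k i : Fin (n + 2)) :
    faceVec K n k (dtVec K (n + 1) i) =
      k.insertNth (α := fun _ => (Fin n → K)) 0 (dtVec K n) i := by
  have hs : ∑ i, k.insertNth (α := fun _ => (Fin n → K)) 0 (dtVec K n) i = 0 := by
    rw [Fin.sum_univ_succAbove _ k]
    simp [sum_dtVec]
  refine Fin.cases ?_ (fun i => ?_) i
  · rw [Fin.sum_univ_succ] at hs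
    rw [eq_neg_of_add_eq_zero_left hs]
    simp only [dtVec, faceVec, Fin.cons_zero, map_neg, map_sum,
      Fintype.linearCombination_apply_single, one_smul]
  · simp [dtVec, faceVec]

theorem dForm_tmul (n : ℕ) (f : MvPolynomial (Fin n) K) (w : ExteriorAlgebra K (Fin n → K)) :
    dForm K n (f ⊗ₜ w) =
      ∑ i, MvPolynomial.pderiv i f ⊗ₜ (ExteriorAlgebra.ι K (Pi.single i 1) * w) := by
  simp [dForm, LinearMap.sum_apply]

theorem inv_tmul (n : ℕ) (f : MvPolynomial (Fin n) K) (w : ExteriorAlgebra K (Fin n → K)) :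
    inv K n (f ⊗ₜ w) = f ⊗ₜ CliffordAlgebra.involute w := by
  simp [inv]

theorem face_tmul (n : ℕ) (k) (f : MvPolynomial (Fin (n+1)) K)
    (w : ExteriorAlgebra K (Fin (n+1) → K)) :
    face K n k (f ⊗ₜ w) = facePoly K n k f ⊗ₜ ExteriorAlgebra.map (faceVec K n k) w := by
  simp [face]

theorem face_inv (n : ℕ) (k : Fin (n + 2)) (x : PolyForm K (n + 1)) :
    face K n k (inv K (n + 1) x) = inv K n (face K n k x) := by
  have : (ExteriorAlgebra.map (faceVec K n k)).comp CliffordAlgebra.involute =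
      (CliffordAlgebra.involute).comp (ExteriorAlgebra.map (faceVec K n k)) := by
    ext v
    simp [ExteriorAlgebra.ι]
  induction x using TensorProduct.induction_on with
  | zero => simp
  | add x y hx hy => simp [hx, hy]
  | tmul f w =>
    rw [inv_tmul, face_tmul, face_tmul, inv_tmul]
    exact congrArg _ (DFunLike.congr_fun this w)

theorem face_koszul (n : ℕ) (k : Fin (n + 2)) (p : ℤ) (x : PolyForm K (n + 1)) :
    face K n k (koszul K (n + 1) p x) = koszul K n p (face K n k x) := by
  unfold koszul
  split_ifs
  · rfl
  · exact face_inv n k x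

theorem pderiv_aeval {m n : ℕ} (g : Fin m → MvPolynomial (Fin n) K) (j : Fin n)
    (f : MvPolynomial (Fin m) K) :
    MvPolynomial.pderiv j (MvPolynomial.aeval g f) =
      ∑ i, MvPolynomial.aeval g (MvPolynomial.pderiv i f) * MvPolynomial.pderiv j (g i) := by
  classical
  induction f using MvPolynomial.induction_on with
  | C a => simp [← MvPolynomial.algebraMap_eq]
  | add p q hp hq => simp only [map_add, hp, hq, add_mul, Finset.sum_add_distrib]
  | mul_X p i hp =>
    have h : ∀ x, MvPolynomial.aeval g (MvPolynomial.pderiv x (p * MvPolynomial.X i)) *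
        MvPolynomial.pderiv j (g x) =
        (if x = i then MvPolynomial.aeval g p * MvPolynomial.pderiv j (g i) else 0) +
          g i * (MvPolynomial.aeval g (MvPolynomial.pderiv x p) * MvPolynomial.pderiv j (g x)) := by
      intro x
      rw [Derivation.leibniz, MvPolynomial.pderiv_X, smul_eq_mul, smul_eq_mul, map_add, map_mul,
        map_mul, MvPolynomial.aeval_X, add_mul, mul_assoc]
      rcases eq_or_ne x i with rfl | hx
      · simp [mul_assoc]
      · simp [hx, mul_assoc]
    rw [Finset.sum_congr rfl fun x _ => h x, Finset.sum_add_distrib, ← Finset.mul_sum, ← hp,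
      Finset.sum_ite_eq' Finset.univ i, map_mul, MvPolynomial.aeval_X, Derivation.leibniz,
      smul_eq_mul, smul_eq_mul]
    simp

theorem pderiv_tPoly (n : ℕ) (i : Fin (n + 1)) (j : Fin n) :
    MvPolynomial.pderiv j (tPoly K n i) = MvPolynomial.C (dtVec K n i j) := by
  classical
  refine Fin.cases ?_ (fun i => ?_) i
  · simp [tPoly, dtVec, MvPolynomial.pderiv_X, Finset.sum_apply, Pi.single_apply]
  · rcases eq_or_ne i j with rfl | h
    · simp [tPoly, dtVec]
    · simp [tPoly, dtVec, MvPolynomial.pderiv_X, Pi.single_apply, h, h.symm]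

theorem pderiv_insertNth (n : ℕ) (k i : Fin (n + 2)) (j : Fin n) :
    MvPolynomial.pderiv j (k.insertNth (α := fun _ => MvPolynomial (Fin n) K) 0 (tPoly K n) i) =
      MvPolynomial.C (k.insertNth (α := fun _ => (Fin n → K)) 0 (dtVec K n) i j) := by
  refine Fin.succAboveCases k ?_ (fun i => ?_) i
  · simp
  · simp [pderiv_tPoly]

theorem face_d_aux (n : ℕ) (k : Fin (n + 2)) (f : MvPolynomial (Fin (n + 1)) K) :
    ∑ i, facePoly K n k (MvPolynomial.pderiv i f) ⊗ₜ[K] faceVec K n k (Pi.single i 1) =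
      ∑ j, MvPolynomial.pderiv j (facePoly K n k f) ⊗ₜ[K] (Pi.single j (1 : K) : Fin n → K) := by
  classical
  have h : ∀ v : Fin n → K, v = ∑ j, v j • (Pi.single j (1 : K) : Fin n → K) := fun v => by
    ext l
    simp [Finset.sum_apply, Pi.single_apply]
  calc _ = ∑ i, ∑ j, ((faceVec K n k (Pi.single i 1)) j •
        facePoly K n k (MvPolynomial.pderiv i f)) ⊗ₜ[K] (Pi.single j (1 : K) : Fin n → K) := by
        refine Finset.sum_congr rfl fun i _ => ?_
        conv_lhs => rw [h (faceVec K n k (Pi.single i 1))]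
        rw [TensorProduct.tmul_sum]
        simp [TensorProduct.tmul_smul, TensorProduct.smul_tmul']
    _ = _ := by
        rw [Finset.sum_comm]
        refine Finset.sum_congr rfl fun j _ => ?_
        rw [← TensorProduct.sum_tmul, facePoly, pderiv_aeval]
        congr 1
        refine Finset.sum_congr rfl fun i _ => ?_
        rw [pderiv_insertNth, mul_comm, MvPolynomial.C_mul']
        simp [faceVec]

theorem face_d (n : ℕ) (k : Fin (n + 2)) (x : PolyForm K (n + 1)) :
    face K n k (dForm K (n + 1) x) = dForm K n (face K n k x) := by
  induction x using TensorProduct.induction_on with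
  | zero => simp
  | add x y hx hy => simp [hx, hy]
  | tmul f w =>
    rw [dForm_tmul, face_tmul, dForm_tmul, map_sum]
    simp_rw [face_tmul, map_mul, ExteriorAlgebra.map_apply_ι]
    have := congrArg (LinearMap.lTensor (MvPolynomial (Fin n) K)
      ((LinearMap.mulRight K (ExteriorAlgebra.map (faceVec K n k) w)).comp
        (ExteriorAlgebra.ι K))) (face_d_aux n k f)
    simpa using this

theorem inv_deg {n a : ℕ} {x : PolyForm K n} (hx : x ∈ degForm K n a) :
    inv K n x ∈ degForm K n a := by
  have hev : ∀ w ∈ ⋀[K]^a (Fin n → K),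
      CliffordAlgebra.involute (Q := (0 : QuadraticForm K (Fin n → K))) w ∈ ⋀[K]^a (Fin n → K) := by
    have h1 : (LinearMap.range (ExteriorAlgebra.ι K : (Fin n → K) →ₗ[K] _)).map
        (CliffordAlgebra.involute (Q := (0 : QuadraticForm K (Fin n → K)))).toLinearMap ≤
        LinearMap.range (ExteriorAlgebra.ι K : (Fin n → K) →ₗ[K] _) := by
      rintro _ ⟨_, ⟨v, rfl⟩, rfl⟩
      exact ⟨-v, by simp [ExteriorAlgebra.ι]⟩
    intro w hw
    have := Submodule.mem_map_of_mem (f := (CliffordAlgebra.involute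
      (Q := (0 : QuadraticForm K (Fin n → K)))).toLinearMap) hw
    rw [ExteriorAlgebra.exteriorPower, Submodule.map_pow] at this
    exact pow_le_pow_left' h1 a this
  induction hx using Submodule.span_induction with
  | zero => simp
  | add x y _ _ hx hy => rw [map_add]; exact add_mem hx hy
  | smul c x _ hx => rw [map_smul]; exact Submodule.smul_mem _ _ hx
  | mem x h =>
    obtain ⟨f, w, hw, rfl⟩ := h
    rw [inv_tmul]
    exact Submodule.subset_span ⟨_, _, hev w hw, rfl⟩

theorem koszul_deg {n a : ℕ} (p : ℤ) {x : PolyForm K n} (hx : x ∈ degForm K n a) :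
    koszul K n p x ∈ degForm K n a := by
  unfold koszul
  split_ifs
  · exact hx
  · exact inv_deg hx

theorem d_deg {n a : ℕ} {x : PolyForm K n} (hx : x ∈ degForm K n a) :
    dForm K n x ∈ degForm K n (a + 1) := by
  induction hx using Submodule.span_induction with
  | zero => simp
  | add x y _ _ hx hy => rw [map_add]; exact add_mem hx hy
  | smul c x _ hx => rw [map_smul]; exact Submodule.smul_mem _ _ hx
  | mem x h =>
    obtain ⟨f, w, hw, rfl⟩ := h
    rw [dForm_tmul]
    refine sum_mem fun i _ => Submodule.subset_span ⟨_, _, ?_, rfl⟩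
    rw [add_comm, ExteriorAlgebra.exteriorPower, pow_add, pow_one]
    exact Submodule.mul_mem_mul ⟨_, rfl⟩ hw

theorem mul_deg {n a b : ℕ} {x y : PolyForm K n} (hx : x ∈ degForm K n a)
    (hy : y ∈ degForm K n b) : x * y ∈ degForm K n (a + b) := by
  have : degForm K n a * degForm K n b ≤ degForm K n (a + b) := by
    unfold degForm
    rw [Submodule.span_mul_span, Submodule.span_le]
    rintro _ ⟨_, ⟨f, w, hw, rfl⟩, _, ⟨g, v, hv, rfl⟩, rfl⟩
    refine Submodule.subset_span ⟨f * g, w * v, ?_, by simp⟩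
    rw [ExteriorAlgebra.exteriorPower, pow_add]
    exact Submodule.mul_mem_mul hw hv
  exact this (Submodule.mul_mem_mul hx hy)

theorem one_deg (n : ℕ) : (1 : PolyForm K n) ∈ degForm K n 0 :=
  Submodule.subset_span ⟨1, 1, by simp [ExteriorAlgebra.exteriorPower], rfl⟩

end TWForms
end

noncomputable section

/-- The data of a DG-Lie algebra over `K`, given by its homogeneous components; the axioms are
in `DGLieData.IsDGLieAlgebra`. -/
structure DGLieData (K : Type u) [Field K] where
  obj : ℤ → Type v
  [acg : ∀ p, AddCommGroup (obj p)]
  [mod : ∀ p, Module K (obj p)]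
  d : ∀ p, obj p →ₗ[K] obj (p + 1)
  bracket : ∀ p q, obj p →ₗ[K] obj q →ₗ[K] obj (p + q)

namespace DGLieData

attribute [instance] DGLieData.acg DGLieData.mod

variable {K : Type u} [Field K] (V : DGLieData.{u, v} K)

/-- The underlying vector space `⨁ p, V^p`. -/
abbrev Total : Type v := ⨁ p, V.obj p

/-- The inclusion of a homogeneous component. Equalities between homogeneous elements whose degrees
agree only up to arithmetic are stated after `inj`. -/
def inj (p : ℤ) : V.obj p →ₗ[K] V.Total := DirectSum.lof K ℤ V.obj p

def totalD : V.Total →ₗ[K] V.Total :=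
  DirectSum.toModule K ℤ V.Total fun p => V.inj (p + 1) ∘ₗ V.d p

def totalBracket : V.Total →ₗ[K] V.Total →ₗ[K] V.Total :=
  DirectSum.toModule K ℤ (V.Total →ₗ[K] V.Total) fun p =>
    (DirectSum.toModule K ℤ (V.obj p →ₗ[K] V.Total) fun q =>
      ((V.bracket p q).compr₂ (V.inj (p + q))).flip).flip

/-- The axioms of a DG-Lie algebra: `d² = 0`, graded skew-symmetry, graded Leibniz rule, graded
Jacobi identity. -/
structure IsDGLieAlgebra : Prop where
  d_d : ∀ p (x : V.obj p), V.d (p + 1) (V.d p x) = 0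
  bracket_symm : ∀ p q (x : V.obj p) (y : V.obj q),
    V.inj (p + q) (V.bracket p q x y) = -((p * q).negOnePow • V.inj (q + p) (V.bracket q p y x))
  d_bracket : ∀ p q (x : V.obj p) (y : V.obj q),
    V.inj (p + q + 1) (V.d (p + q) (V.bracket p q x y)) =
      V.inj (p + 1 + q) (V.bracket (p + 1) q (V.d p x) y) +
        p.negOnePow • V.inj (p + (q + 1)) (V.bracket p (q + 1) x (V.d q y))
  jacobi : ∀ p q r (x : V.obj p) (y : V.obj q) (z : V.obj r),
    V.inj (p + (q + r)) (V.bracket p (q + r) x (V.bracket q r y z)) =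
      V.inj (p + q + r) (V.bracket (p + q) r (V.bracket p q x y) z) +
        (p * q).negOnePow • V.inj (q + (p + r)) (V.bracket q (p + r) y (V.bracket p r x z))

def IsAbelian : Prop := ∀ p q, V.bracket p q = 0

end DGLieData

/-- The antisymmetric Koszul sign of the permutation `σ` on homogeneous vectors of degrees `p`. -/
def koszulSign {n : ℕ} (σ : Equiv.Perm (Fin n)) (p : Fin n → ℤ) : ℤˣ :=
  ∏ i, ∏ j, if i < j ∧ σ j < σ i then -(p (σ i) * p (σ j)).negOnePow else 1

/-- The `(a, n - a)`-shuffles. -/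
def shuffles (a n : ℕ) : Finset (Equiv.Perm (Fin n)) :=
  Finset.univ.filter fun σ =>
    (∀ i j : Fin n, i < j → j.val < a → σ i < σ j) ∧
      ∀ i j : Fin n, a ≤ i.val → i < j → σ i < σ j

open DGLieData in
/-- An `L∞` morphism from a DG-Lie algebra `V` to an abelian DG-Lie algebra `M`: graded
skew-symmetric multilinear maps `map n` of degree `1 - n` for `n ≥ 1` satisfying
`d g₁(v) = g₁(d v)` and, for every `n ≥ 2`,
`d gₙ(v₁, …, vₙ) = (-1)^{1-n} ∑_{S(1,n-1)} χ(σ) gₙ(d v_{σ1}, v_{σ2}, …)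
  + (-1)^{2-n} ∑_{S(2,n-2)} χ(σ) gₙ₋₁([v_{σ1}, v_{σ2}], v_{σ3}, …)`
(here `n` is written `n + 2`). The value of `map 0` plays no role. -/
structure LInftyMorphism {K : Type u} [Field K] (V : DGLieData.{u, v} K)
    (M : DGLieData.{u, w} K) where
  map : ∀ n : ℕ, MultilinearMap K (fun _ : Fin n => V.Total) M.Total
  map_mem : ∀ (n : ℕ), 1 ≤ n → ∀ (p : Fin n → ℤ) (v : ∀ i, V.obj (p i)),
    map n (fun i => V.inj (p i) (v i)) ∈ LinearMap.range (M.inj (∑ i, p i + 1 - n))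
  map_perm : ∀ (n : ℕ), 1 ≤ n →
    ∀ (σ : Equiv.Perm (Fin n)) (p : Fin n → ℤ) (v : ∀ i, V.obj (p i)),
    map n (fun i => V.inj (p (σ i)) (v (σ i))) =
      koszulSign σ p • map n (fun i => V.inj (p i) (v i))
  condition_one : ∀ x : V.Total, M.totalD (map 1 ![x]) = map 1 ![V.totalD x]
  condition : ∀ (n : ℕ) (p : Fin (n + 2) → ℤ) (v : ∀ i, V.obj (p i)),
    M.totalD (map (n + 2) fun i => V.inj (p i) (v i)) =
      ((1 : ℤ) - (n + 2)).negOnePow • ∑ σ ∈ shuffles 1 (n + 2),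
        koszulSign σ p • map (n + 2) (Fin.cons (V.totalD (V.inj _ (v (σ 0))))
          fun i : Fin (n + 1) => V.inj _ (v (σ i.succ))) +
      ((2 : ℤ) - (n + 2)).negOnePow • ∑ σ ∈ shuffles 2 (n + 2),
        koszulSign σ p • map (n + 1) (Fin.cons
          (V.totalBracket (V.inj _ (v (σ 0))) (V.inj _ (v (σ 1))))
          fun i : Fin n => V.inj _ (v (σ i.succ.succ)))
end

noncomputable section

variable {K : Type u} [Field K] {X : Scheme.{u}}

/-- Sections of a `K`-scheme form a `K`-algebra. -/
instance sectionsAlgebra [X.Over (Spec (.of K))] (U : X.Opens) : Algebra K Γ(X, U) :=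
  ((Scheme.ΓSpecIso (.of K)).inv ≫ (X ↘ Spec (.of K)).appTop ≫
    X.presheaf.map (homOfLE (le_top : U ≤ ⊤)).op).hom.toAlgebra

/-- Restriction of functions. -/
def resRing {U V : X.Opens} (h : V ≤ U) : Γ(X, U) →+* Γ(X, V) :=
  (X.presheaf.map (homOfLE h).op).hom

theorem resRing_self {U : X.Opens} (f : Γ(X, U)) : resRing le_rfl f = f := by
  simp [resRing]

theorem resRing_res {U V W : X.Opens} (h : V ≤ U) (h' : W ≤ V) (f : Γ(X, U)) :
    resRing h' (resRing h f) = resRing (h'.trans h) f := by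
  have := congrArg (fun g => g.hom f) (X.presheaf.map_comp (homOfLE h).op (homOfLE h').op)
  exact this.symm

variable (K) in
/-- Restriction of functions, as a morphism of `K`-algebras. -/
def resAlg [X.Over (Spec (.of K))] {U V : X.Opens} (h : V ≤ U) : Γ(X, U) →ₐ[K] Γ(X, V) where
  __ := resRing h
  commutes' c := by
    change resRing h (resRing le_top _) = resRing le_top _
    exact resRing_res _ _ _

theorem resAlg_self [X.Over (Spec (.of K))] (U : X.Opens) :
    resAlg K (le_refl U) = AlgHom.id K Γ(X, U) :=
  AlgHom.ext resRing_self

theorem resAlg_comp [X.Over (Spec (.of K))] {U V W : X.Opens} (h : V ≤ U) (h' : W ≤ V) :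
    (resAlg K h').comp (resAlg K h) = resAlg K (h'.trans h) :=
  AlgHom.ext (resRing_res h h')

section Kaehler

variable {S T : Type u} [CommRing S] [CommRing T] [Algebra K S] [Algebra K T]

/-- The map `Ω[S/K] → Ω[T/K]`, `a db ↦ φ(a) dφ(b)`. -/
def kaehlerMap (φ : S →ₐ[K] T) : Ω[S⁄K] →ₗ[K] Ω[T⁄K] :=
  letI := φ.toRingHom.toAlgebra
  haveI : IsScalarTower K S T := IsScalarTower.of_algebraMap_eq fun c => (φ.commutes c).symm
  (KaehlerDifferential.map K K S T).restrictScalars K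

theorem kaehlerMap_D (φ : S →ₐ[K] T) (s : S) :
    kaehlerMap φ (KaehlerDifferential.D K S s) = KaehlerDifferential.D K T (φ s) := by
  let _ := φ.toRingHom.toAlgebra
  have : IsScalarTower K S T := IsScalarTower.of_algebraMap_eq fun c => (φ.commutes c).symm
  exact KaehlerDifferential.map_D K K S T s

theorem kaehlerMap_smul (φ : S →ₐ[K] T) (s : S) (ω : Ω[S⁄K]) :
    kaehlerMap φ (s • ω) = φ s • kaehlerMap φ ω := by
  let _ := φ.toRingHom.toAlgebra
  have : IsScalarTower K S T := IsScalarTower.of_algebraMap_eq fun c => (φ.commutes c).symm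
  exact (KaehlerDifferential.map K K S T).map_smul s ω

theorem kaehler_ext {N : Type u} [AddCommGroup N] {f g : Ω[S⁄K] →+ N}
    (hD : ∀ a b : S, f (a • KaehlerDifferential.D K S b) = g (a • KaehlerDifferential.D K S b)) :
    f = g := by
  ext ω
  have h : ω ∈ Submodule.span S (Set.range (KaehlerDifferential.D K S)) := by
    rw [KaehlerDifferential.span_range_derivation]
    trivial
  suffices ∀ a : S, f (a • ω) = g (a • ω) by simpa using this 1
  induction h using Submodule.span_induction with
  | zero => simp
  | add x y _ _ hx hy => intro a; simp [hx, hy]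
  | smul c x _ hx => intro a; rw [smul_smul]; exact hx _
  | mem x h => obtain ⟨b, rfl⟩ := h; exact fun a => hD a b

theorem kaehlerMap_id (ω : Ω[S⁄K]) : kaehlerMap (AlgHom.id K S) ω = ω :=
  DFunLike.congr_fun (kaehler_ext (f := (kaehlerMap (AlgHom.id K S)).toAddMonoidHom)
    (g := AddMonoidHom.id _) fun a b => by
      simp [kaehlerMap_smul, kaehlerMap_D]) ω

theorem kaehlerMap_comp {R : Type u} [CommRing R] [Algebra K R] (φ : S →ₐ[K] T) (ψ : T →ₐ[K] R)
    (ω : Ω[S⁄K]) : kaehlerMap ψ (kaehlerMap φ ω) = kaehlerMap (ψ.comp φ) ω :=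
  DFunLike.congr_fun (kaehler_ext
    (f := (kaehlerMap ψ).toAddMonoidHom.comp (kaehlerMap φ).toAddMonoidHom)
    (g := (kaehlerMap (ψ.comp φ)).toAddMonoidHom) fun a b => by
      simp [kaehlerMap_smul, kaehlerMap_D]) ω

end Kaehler

/-- A complex of presheaves of `𝒪_X`-modules, through its sections on open subsets. -/
structure DGModPresheaf (X : Scheme.{u}) where
  obj : X.Opens → ℤ → Type u
  [acg : ∀ U p, AddCommGroup (obj U p)]
  [mod : ∀ U p, Module Γ(X, U) (obj U p)]
  res : ∀ {U V : X.Opens}, V ≤ U → ∀ p, obj U p →+ obj V p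
  res_smul : ∀ {U V : X.Opens} (h : V ≤ U) p (f : Γ(X, U)) (s : obj U p),
    res h p (f • s) = resRing h f • res h p s
  res_self : ∀ {U : X.Opens} p (s : obj U p), res le_rfl p s = s
  res_res : ∀ {U V W : X.Opens} (h : V ≤ U) (h' : W ≤ V) p (s : obj U p),
    res h' p (res h p s) = res (h'.trans h) p s
  d : ∀ U p, obj U p →ₗ[Γ(X, U)] obj U (p + 1)
  d_d : ∀ U p (s : obj U p), d U (p + 1) (d U p s) = 0
  res_d : ∀ {U V : X.Opens} (h : V ≤ U) p (s : obj U p), res h (p + 1) (d U p s) = d V p (res h p s)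

namespace DGModPresheaf

attribute [instance] DGModPresheaf.acg DGModPresheaf.mod

instance [X.Over (Spec (.of K))] (E : DGModPresheaf X) (U : X.Opens) (p : ℤ) :
    Module K (E.obj U p) :=
  Module.compHom _ (algebraMap K Γ(X, U))

instance [X.Over (Spec (.of K))] (E : DGModPresheaf X) (U : X.Opens) (p : ℤ) :
    IsScalarTower K Γ(X, U) (E.obj U p) :=
  ⟨fun c f s => by
    rw [Algebra.smul_def, mul_smul]; rfl⟩

/-- The sections of a complex of sheaves of `𝒪_X`-modules. -/
def ofComplex (C : CochainComplex X.Modules ℤ) : DGModPresheaf X where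
  obj U p := Γ(C.X p, U)
  res h p := ((C.X p).presheaf.map (homOfLE h).op).hom
  res_smul h p f s := (C.X p).map_smul (homOfLE h) f s
  res_self p s := by
    have := congrArg (fun g => g.hom s) ((C.X p).presheaf.map_id _)
    exact this
  res_res h h' p s := by
    have := congrArg (fun g => g.hom s) ((C.X p).presheaf.map_comp (homOfLE h).op (homOfLE h').op)
    exact this.symm
  d U p :=
    { toFun := fun s => (C.d p (p + 1)).app U s
      map_add' := fun s t => map_add _ s t
      map_smul' := fun f s => Scheme.Modules.Hom.app_smul _ f s }
  d_d U p s := by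
    have h := congrArg (fun g => g.app U s) (C.d_comp_d p (p + 1) (p + 1 + 1))
    exact h
  res_d h p s := by
    have := (C.d p (p + 1)).mapPresheaf.naturality (homOfLE h).op
    exact (congrArg (fun g => g.hom s) this).symm

end DGModPresheaf

/-- A complex of presheaves of `K`-vector spaces, with components indexed by `J`, the component
`j` sitting in degree `deg j`; all components that are not listed are zero. The differential maps
the component `j` to the component `next j`, of degree `deg j + 1`, or is zero. -/
structure DGPresheaf (K : Type u) [Field K] (X : Scheme.{u}) where
  J : Type
  [dec : DecidableEq J]
  deg : J → ℤ
  obj : X.Opens → J → Type u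
  [acg : ∀ U j, AddCommGroup (obj U j)]
  [mod : ∀ U j, Module K (obj U j)]
  res : ∀ {U V : X.Opens}, V ≤ U → ∀ j, obj U j →ₗ[K] obj V j
  res_self : ∀ {U : X.Opens} j (s : obj U j), res le_rfl j s = s
  res_res : ∀ {U V W : X.Opens} (h : V ≤ U) (h' : W ≤ V) j (s : obj U j),
    res h' j (res h j s) = res (h'.trans h) j s
  next : J → J
  d : ∀ U j, obj U j →ₗ[K] obj U (next j)
  deg_next : ∀ j, deg (next j) = deg j + 1 ∨ ∀ U, d U j = 0
  d_d : ∀ U j (s : obj U j), d U (next j) (d U j s) = 0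
  res_d : ∀ {U V : X.Opens} (h : V ≤ U) j (s : obj U j),
    res h (next j) (d U j s) = d V j (res h j s)

namespace DGPresheaf

attribute [instance] DGPresheaf.dec DGPresheaf.acg DGPresheaf.mod

variable [X.Over (Spec (.of K))]

/-- A complex of modules seen as a complex of `K`-vector spaces. -/
def ofModules (E : DGModPresheaf X) : DGPresheaf K X where
  J := ℤ
  deg p := p
  obj := E.obj
  res h p :=
    { E.res h p with
      map_smul' := fun c s => by
        have := E.res_smul h p (algebraMap K Γ(X, _) c) s
        rw [show resRing h (algebraMap K Γ(X, _) c) = _ from (resAlg K h).commutes c] at this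
        exact this }
  res_self := E.res_self
  res_res := E.res_res
  next p := p + 1
  d U p := (E.d U p).restrictScalars K
  deg_next _ := .inl rfl
  d_d := E.d_d
  res_d := E.res_d

/-- `𝒪_X` in degree `0`. -/
def structureSheaf : DGPresheaf K X where
  J := Unit
  deg _ := 0
  obj U _ := Γ(X, U)
  res h _ := (resAlg K h).toLinearMap
  res_self _ := resRing_self
  res_res h h' _ := resRing_res h h'
  next := id
  d _ _ := 0
  deg_next _ := .inr fun _ => rfl
  d_d _ _ _ := rfl
  res_d _ _ _ := map_zero _

/-- `Ω¹_X[-1]`, that is `Ω¹_X` in degree `1` with zero differential. On an affine open `U` the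
sections of the sheaf `Ω¹_X` are `Ω[Γ(X, U)/K]`; only such opens are used for the totalisations. -/
def omegaOne : DGPresheaf K X where
  J := Unit
  deg _ := 1
  obj U _ := Ω[Γ(X, U)⁄K]
  res h _ := kaehlerMap (resAlg K h)
  res_self _ ω := by rw [resAlg_self]; exact kaehlerMap_id ω
  res_res h h' _ ω := by rw [kaehlerMap_comp, resAlg_comp]
  next := id
  d _ _ := 0
  deg_next _ := .inr fun _ => rfl
  d_d _ _ _ := rfl
  res_d _ _ _ := map_zero _

/-- The two components of `𝒪_X → Ω¹_X`. -/
def truncObj (K : Type u) [Field K] {X : Scheme.{u}} [X.Over (Spec (.of K))] (U : X.Opens) :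
    Fin 2 → Type u
  | 0 => Γ(X, U)
  | 1 => Ω[Γ(X, U)⁄K]

instance (U : X.Opens) : ∀ j, AddCommGroup (truncObj K U j)
  | 0 => inferInstanceAs (AddCommGroup Γ(X, U))
  | 1 => inferInstanceAs (AddCommGroup Ω[Γ(X, U)⁄K])

instance (U : X.Opens) : ∀ j, Module K (truncObj K U j)
  | 0 => inferInstanceAs (Module K Γ(X, U))
  | 1 => inferInstanceAs (Module K Ω[Γ(X, U)⁄K])

/-- `Ω_X^{≤1}[2]`, the complex `𝒪_X → Ω¹_X` with the de Rham differential, placed in degrees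
`-2` and `-1`. -/
def truncDeRham : DGPresheaf K X where
  J := Fin 2
  deg j := (j.val : ℤ) - 2
  obj U j := truncObj K U j
  res h
    | 0 => (resAlg K h).toLinearMap
    | 1 => kaehlerMap (resAlg K h)
  res_self
    | 0 => resRing_self
    | 1 => (omegaOne (K := K)).res_self ()
  res_res h h'
    | 0 => resRing_res h h'
    | 1 => (omegaOne (K := K)).res_res h h' ()
  next _ := 1
  d U
    | 0 => (KaehlerDifferential.D K Γ(X, U)).toLinearMap
    | 1 => 0
  deg_next
    | 0 => .inl (by norm_num)
    | 1 => .inr fun _ => rfl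
  d_d U
    | 0 => fun _ => rfl
    | 1 => fun _ => rfl
  res_d h
    | 0 => fun s => kaehlerMap_D (resAlg K h) s
    | 1 => fun _ => map_zero _

section tensor

/-- `Ω¹_X ⊗ E^p` on `U`. For affine `U` and smooth `X` (so that `Ω¹` is finite projective on `U`)
this is the module of sections of the tensor product sheaf. -/
abbrev OmegaTensor (K : Type u) [Field K] {X : Scheme.{u}} [X.Over (Spec (.of K))]
    (E : DGModPresheaf X) (U : X.Opens) (p : ℤ) : Type u :=
  Ω[Γ(X, U)⁄K] ⊗[(X.presheaf.obj (.op U) : Type u)] E.obj U p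

def tensorRes (E : DGModPresheaf X) {U V : X.Opens} (h : V ≤ U) (p : ℤ) :
    OmegaTensor K E U p →ₗ[K] OmegaTensor K E V p :=
  let f : OmegaTensor K E U p →+ OmegaTensor K E V p := TensorProduct.liftAddHom
    { toFun := fun ω => (TensorProduct.mk Γ(X, V) Ω[Γ(X, V)⁄K] (E.obj V p)
        (kaehlerMap (resAlg K h) ω)).toAddMonoidHom.comp (E.res h p)
      map_zero' := by ext; simp
      map_add' := fun _ _ => by ext; simp [TensorProduct.add_tmul] }
    fun f ω s => by
      change kaehlerMap (resAlg K h) (f • ω) ⊗ₜ E.res h p s =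
        kaehlerMap (resAlg K h) ω ⊗ₜ E.res h p (f • s)
      rw [kaehlerMap_smul, E.res_smul, TensorProduct.smul_tmul]
      rfl
  { f with
    map_smul' := fun c x => by
      change f (c • x) = c • f x
      induction x using TensorProduct.induction_on with
      | zero => simp
      | add x y hx hy => rw [smul_add, map_add, hx, hy, map_add, smul_add]
      | tmul ω s =>
        rw [TensorProduct.smul_tmul']
        change kaehlerMap (resAlg K h) (c • ω) ⊗ₜ E.res h p s =
          c • (kaehlerMap (resAlg K h) ω ⊗ₜ E.res h p s)
        rw [map_smul, TensorProduct.smul_tmul'] }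

theorem tensorRes_tmul (E : DGModPresheaf X) {U V : X.Opens} (h : V ≤ U) (p : ℤ)
    (ω : Ω[Γ(X, U)⁄K]) (s : E.obj U p) :
    tensorRes E h p (ω ⊗ₜ s) = kaehlerMap (resAlg K h) ω ⊗ₜ E.res h p s :=
  rfl

/-- `Ω¹_X[-1] ⊗ E`, with `Ω¹ ⊗ E^p` in degree `p + 1` and `d(η ⊗ x) = -η ⊗ dx`. -/
def omegaTensor (E : DGModPresheaf X) : DGPresheaf K X where
  J := ℤ
  deg p := p + 1
  obj U p := OmegaTensor K E U p
  res h p := tensorRes E h p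
  res_self p x := by
    induction x using TensorProduct.induction_on with
    | zero => simp
    | add x y hx hy => rw [map_add, hx, hy]
    | tmul ω s => rw [tensorRes_tmul, E.res_self, resAlg_self, kaehlerMap_id]
  res_res h h' p x := by
    induction x using TensorProduct.induction_on with
    | zero => simp
    | add x y hx hy => rw [map_add, map_add, hx, hy, map_add]
    | tmul ω s =>
      rw [tensorRes_tmul, tensorRes_tmul, E.res_res, kaehlerMap_comp, resAlg_comp, tensorRes_tmul]
  next p := p + 1
  d U p := -((E.d U p).lTensor Ω[Γ(X, U)⁄K]).restrictScalars K
  deg_next _ := .inl rfl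
  d_d U p x := by
    induction x using TensorProduct.induction_on with
    | zero => simp
    | add x y hx hy => rw [map_add, map_add, hx, hy, add_zero]
    | tmul ω s => simp [E.d_d]
  res_d h p x := by
    induction x using TensorProduct.induction_on with
    | zero => simp
    | add x y hx hy => rw [map_add, map_add, hx, hy, map_add, map_add]
    | tmul ω s => simp [tensorRes_tmul, E.res_d]

end tensor
end DGPresheaf
end

noncomputable section

namespace DGPresheaf

open TWForms

/-- A family of linear maps, homogeneous of degree `s` and compatible with restrictions. -/
structure Hom {K : Type u} [Field K] {X : Scheme.{u}} (F G : DGPresheaf K X) (s : ℤ) where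
  idx : F.J → G.J
  deg_idx : ∀ j, G.deg (idx j) = F.deg j + s
  map : ∀ U j, F.obj U j →ₗ[K] G.obj U (idx j)
  map_res : ∀ {U V : X.Opens} (h : V ≤ U) j (x : F.obj U j),
    map V j (F.res h j x) = G.res h (idx j) (map U j x)

/-- A family of bilinear maps, homogeneous of degree `0` and compatible with restrictions. -/
structure Pairing {K : Type u} [Field K] {X : Scheme.{u}} (F G H : DGPresheaf K X) where
  idx : F.J → G.J → H.J
  pair : ∀ U j k, F.obj U j →ₗ[K] G.obj U k →ₗ[K] H.obj U (idx j k)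
  deg_idx : ∀ j k, H.deg (idx j k) = F.deg j + G.deg k ∨ ∀ U, pair U j k = 0
  pair_res : ∀ {U V : X.Opens} (h : V ≤ U) j k (x : F.obj U j) (y : G.obj U k),
    pair V j k (F.res h j x) (G.res h k y) = H.res h (idx j k) (pair U j k x y)

variable {K : Type u} [Field K] {X : Scheme.{u}} {ι : Type w} (𝒰 : ι → X.Opens)

/-- The intersection `U_{i₀} ∩ … ∩ U_{iₙ}`. -/
def inter {n : ℕ} (I : Fin (n + 1) → ι) : X.Opens := ⨅ k, 𝒰 (I k)

theorem inter_le {n : ℕ} (I : Fin (n + 2) → ι) (k : Fin (n + 2)) :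
    inter 𝒰 I ≤ inter 𝒰 (I ∘ k.succAbove) :=
  le_iInf fun j => iInf_le _ (k.succAbove j)

variable (F G H : DGPresheaf K X)

/-- Čech cochains `∏ F^j(U_{i₀ ⋯ iₙ})`, over all tuples of indices. -/
abbrev Cech (n : ℕ) (j : F.J) : Type (max u w) :=
  ∀ I : Fin (n + 1) → ι, F.obj (inter 𝒰 I) j

/-- The coface map `δ_k`, which omits the `k`-th index and restricts. -/
def coface (n : ℕ) (k : Fin (n + 2)) (j : F.J) : F.Cech 𝒰 n j →ₗ[K] F.Cech 𝒰 (n + 1) j :=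
  LinearMap.pi fun I => F.res (inter_le 𝒰 I k) j ∘ₗ LinearMap.proj (I ∘ k.succAbove)

/-- The differential of `F` on Čech cochains. -/
def cechD (n : ℕ) (j : F.J) : F.Cech 𝒰 n j →ₗ[K] F.Cech 𝒰 n (F.next j) :=
  LinearMap.pi fun I => F.d _ j ∘ₗ LinearMap.proj I

/-- `A_a ⊗ (Čech c-cochains of F)`. -/
abbrev Cell (a c : ℕ) : Type (max u w) :=
  ⨁ j, PolyForm K a ⊗[K] F.Cech 𝒰 c j

abbrev cellOf (a c : ℕ) (j : F.J) : PolyForm K a ⊗[K] F.Cech 𝒰 c j →ₗ[K] F.Cell 𝒰 a c :=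
  DirectSum.lof K F.J (fun j => PolyForm K a ⊗[K] F.Cech 𝒰 c j) j

/-- The homogeneous elements of total degree `m`. -/
def cellHomog (a c : ℕ) (m : ℤ) : Submodule K (F.Cell 𝒰 a c) :=
  Submodule.span K {x | ∃ (q : ℕ) (j : F.J) (η : PolyForm K a) (s : F.Cech 𝒰 c j),
    η ∈ degForm K a q ∧ q + F.deg j = m ∧ x = F.cellOf 𝒰 a c j (η ⊗ₜ s)}

/-- `δ_k^* ⊗ Id`. -/
def cellFace (a c : ℕ) (k : Fin (a + 2)) : F.Cell 𝒰 (a + 1) c →ₗ[K] F.Cell 𝒰 a c :=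
  DirectSum.lmap fun j => (face K a k).toLinearMap.rTensor (F.Cech 𝒰 c j)

/-- `Id ⊗ δ_k`. -/
def cellCoface (a c : ℕ) (k : Fin (c + 2)) : F.Cell 𝒰 a c →ₗ[K] F.Cell 𝒰 a (c + 1) :=
  DirectSum.lmap fun j => (F.coface 𝒰 c k j).lTensor (PolyForm K a)

/-- The differential `d(η ⊗ s) = dη ⊗ s + (-1)^{deg η} η ⊗ ds`. -/
def cellD (a c : ℕ) : F.Cell 𝒰 a c →ₗ[K] F.Cell 𝒰 a c :=
  DirectSum.toModule K F.J _ fun j =>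
    F.cellOf 𝒰 a c j ∘ₗ (dForm K a).rTensor (F.Cech 𝒰 c j) +
      F.cellOf 𝒰 a c (F.next j) ∘ₗ
        TensorProduct.map (inv K a).toLinearMap (F.cechD 𝒰 c j)

/-- The degree `m` component of the Thom-Whitney totalisation `Tot(𝒰, F)`: sequences of elements
`xₙ ∈ Aₙ ⊗ F(𝒰)ₙ` of degree `m` with `(δ_k^* ⊗ Id) xₙ₊₁ = (Id ⊗ δ_k) xₙ`. -/
def Tot (m : ℤ) : Submodule K (∀ n : ℕ, F.Cell 𝒰 n n) where
  carrier := {x | (∀ n, x n ∈ F.cellHomog 𝒰 n n m) ∧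
    ∀ (n : ℕ) (k : Fin (n + 2)),
      F.cellFace 𝒰 n (n + 1) k (x (n + 1)) = F.cellCoface 𝒰 n n k (x n)}
  add_mem' hx hy := ⟨fun n => add_mem (hx.1 n) (hy.1 n), fun n k => by
    simp only [Pi.add_apply, map_add, hx.2 n k, hy.2 n k]⟩
  zero_mem' := ⟨fun _ => zero_mem _, fun n k => by simp⟩
  smul_mem' c x hx := ⟨fun n => Submodule.smul_mem _ c (hx.1 n), fun n k => by
    simp only [Pi.smul_apply, map_smul, hx.2 n k]⟩

variable {F G H}

theorem cell_hom_ext {a c : ℕ} {N : Type*} [AddCommMonoid N] [Module K N]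
    {f g : F.Cell 𝒰 a c →ₗ[K] N}
    (h : ∀ j η s, f (F.cellOf 𝒰 a c j (η ⊗ₜ s)) = g (F.cellOf 𝒰 a c j (η ⊗ₜ s))) : f = g :=
  DirectSum.linearMap_ext K fun j => TensorProduct.ext' fun η s => h j η s

theorem cellFace_of (a c : ℕ) (k : Fin (a + 2)) (j) (η) (s : F.Cech 𝒰 c j) :
    F.cellFace 𝒰 a c k (F.cellOf 𝒰 (a + 1) c j (η ⊗ₜ s)) =
      F.cellOf 𝒰 a c j (face K a k η ⊗ₜ s) := by
  simp [cellFace, DirectSum.lof_eq_of]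

theorem cellCoface_of (a c : ℕ) (k : Fin (c + 2)) (j) (η) (s : F.Cech 𝒰 c j) :
    F.cellCoface 𝒰 a c k (F.cellOf 𝒰 a c j (η ⊗ₜ s)) =
      F.cellOf 𝒰 a (c + 1) j (η ⊗ₜ F.coface 𝒰 c k j s) := by
  simp [cellCoface, DirectSum.lof_eq_of]

theorem cellD_of (a c : ℕ) (j) (η) (s : F.Cech 𝒰 c j) :
    F.cellD 𝒰 a c (F.cellOf 𝒰 a c j (η ⊗ₜ s)) =
      F.cellOf 𝒰 a c j (dForm K a η ⊗ₜ s) +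
        F.cellOf 𝒰 a c (F.next j) (inv K a η ⊗ₜ F.cechD 𝒰 c j s) := by
  simp [cellD]

theorem cellD_mem {a c : ℕ} {m : ℤ} {x : F.Cell 𝒰 a c} (hx : x ∈ F.cellHomog 𝒰 a c m) :
    F.cellD 𝒰 a c x ∈ F.cellHomog 𝒰 a c (m + 1) := by
  induction hx using Submodule.span_induction with
  | zero => simp
  | add x y _ _ hx hy => rw [map_add]; exact add_mem hx hy
  | smul c x _ hx => rw [map_smul]; exact Submodule.smul_mem _ _ hx
  | mem x h =>
    obtain ⟨q, j, η, s, hη, hq, rfl⟩ := h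
    rw [cellD_of]
    refine add_mem (Submodule.subset_span ⟨q + 1, j, _, _, d_deg hη, ?_, rfl⟩) ?_
    · push_cast; linarith
    · rcases F.deg_next j with h | h
      · exact Submodule.subset_span ⟨q, F.next j, _, _, inv_deg hη, by rw [h]; linarith, rfl⟩
      · have : F.cechD 𝒰 c j s = 0 := by ext I; simp [cechD, h]
        rw [this]; simp

theorem cellFace_d (a c : ℕ) (k : Fin (a + 2)) (x : F.Cell 𝒰 (a + 1) c) :
    F.cellFace 𝒰 a c k (F.cellD 𝒰 (a + 1) c x) = F.cellD 𝒰 a c (F.cellFace 𝒰 a c k x) := by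
  refine DFunLike.congr_fun (f := F.cellFace 𝒰 a c k ∘ₗ F.cellD 𝒰 (a + 1) c)
    (g := F.cellD 𝒰 a c ∘ₗ F.cellFace 𝒰 a c k) (cell_hom_ext 𝒰 fun j η s => ?_) x
  simp only [LinearMap.comp_apply, cellD_of, cellFace_of, map_add, face_d, face_inv]

theorem cellCoface_d (a c : ℕ) (k : Fin (c + 2)) (x : F.Cell 𝒰 a c) :
    F.cellCoface 𝒰 a c k (F.cellD 𝒰 a c x) = F.cellD 𝒰 a (c + 1) (F.cellCoface 𝒰 a c k x) := by
  have h : ∀ j s, F.coface 𝒰 c k (F.next j) (F.cechD 𝒰 c j s) =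
      F.cechD 𝒰 (c + 1) j (F.coface 𝒰 c k j s) := fun j s => by
    ext I
    simp [coface, cechD, F.res_d]
  refine DFunLike.congr_fun (f := F.cellCoface 𝒰 a c k ∘ₗ F.cellD 𝒰 a c)
    (g := F.cellD 𝒰 a (c + 1) ∘ₗ F.cellCoface 𝒰 a c k) (cell_hom_ext 𝒰 fun j η s => ?_) x
  simp only [LinearMap.comp_apply, cellD_of, cellCoface_of, map_add, h]

variable (F) in
/-- The differential of the totalisation. -/
def totD (m : ℤ) : F.Tot 𝒰 m →ₗ[K] F.Tot 𝒰 (m + 1) :=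
  (LinearMap.pi fun n => F.cellD 𝒰 n n ∘ₗ LinearMap.proj n).restrict fun x hx =>
    ⟨fun n => cellD_mem 𝒰 (hx.1 n), fun n k => by
      simp only [LinearMap.pi_apply, LinearMap.comp_apply, LinearMap.proj_apply]
      rw [cellFace_d, hx.2 n k, cellCoface_d]⟩

namespace Hom

variable {s : ℤ} (φ : Hom F G s)

def cechMap (c : ℕ) (j : F.J) : F.Cech 𝒰 c j →ₗ[K] G.Cech 𝒰 c (φ.idx j) :=
  LinearMap.pi fun I => φ.map _ j ∘ₗ LinearMap.proj I

def cellMap (a c : ℕ) : F.Cell 𝒰 a c →ₗ[K] G.Cell 𝒰 a c :=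
  DirectSum.toModule K F.J _ fun j =>
    G.cellOf 𝒰 a c (φ.idx j) ∘ₗ (φ.cechMap 𝒰 c j).lTensor (PolyForm K a)

theorem cellMap_of (a c : ℕ) (j) (η) (x : F.Cech 𝒰 c j) :
    φ.cellMap 𝒰 a c (F.cellOf 𝒰 a c j (η ⊗ₜ x)) =
      G.cellOf 𝒰 a c (φ.idx j) (η ⊗ₜ φ.cechMap 𝒰 c j x) := by
  simp [cellMap]

/-- The map induced on totalisations, componentwise `Id ⊗ φ`. -/
def totMap (m : ℤ) : F.Tot 𝒰 m →ₗ[K] G.Tot 𝒰 (m + s) :=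
  (LinearMap.pi fun n => φ.cellMap 𝒰 n n ∘ₗ LinearMap.proj n).restrict fun x hx =>
    ⟨fun n => by
      have h := hx.1 n
      simp only [LinearMap.pi_apply, LinearMap.comp_apply, LinearMap.proj_apply]
      generalize x n = y at h
      induction h using Submodule.span_induction with
      | zero => simp
      | add x y _ _ hx hy => rw [map_add]; exact add_mem hx hy
      | smul c x _ hx => rw [map_smul]; exact Submodule.smul_mem _ _ hx
      | mem x h =>
        obtain ⟨q, j, η, s, hη, hq, hx'⟩ := h
        rw [hx', cellMap_of]
        exact Submodule.subset_span ⟨q, _, _, _, hη, by rw [φ.deg_idx]; linarith, rfl⟩,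
    fun n k => by
      have h1 : ∀ x, G.cellFace 𝒰 n (n + 1) k (φ.cellMap 𝒰 (n + 1) (n + 1) x) =
          φ.cellMap 𝒰 n (n + 1) (F.cellFace 𝒰 n (n + 1) k x) := fun x => by
        refine DFunLike.congr_fun (f := G.cellFace 𝒰 n (n + 1) k ∘ₗ φ.cellMap 𝒰 (n + 1) (n + 1))
          (g := φ.cellMap 𝒰 n (n + 1) ∘ₗ F.cellFace 𝒰 n (n + 1) k)
          (cell_hom_ext 𝒰 fun j η s => ?_) x
        simp only [LinearMap.comp_apply, cellMap_of, cellFace_of]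
      have h2 : ∀ x, G.cellCoface 𝒰 n n k (φ.cellMap 𝒰 n n x) =
          φ.cellMap 𝒰 n (n + 1) (F.cellCoface 𝒰 n n k x) := fun x => by
        have h : ∀ j x, G.coface 𝒰 n k (φ.idx j) (φ.cechMap 𝒰 n j x) =
            φ.cechMap 𝒰 (n + 1) j (F.coface 𝒰 n k j x) := fun j s => by
          ext I
          simp [coface, cechMap, φ.map_res]
        refine DFunLike.congr_fun (f := G.cellCoface 𝒰 n n k ∘ₗ φ.cellMap 𝒰 n n)
          (g := φ.cellMap 𝒰 n (n + 1) ∘ₗ F.cellCoface 𝒰 n n k)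
          (cell_hom_ext 𝒰 fun j η s => ?_) x
        simp only [LinearMap.comp_apply, cellMap_of, cellCoface_of, h]
      simp only [LinearMap.pi_apply, LinearMap.comp_apply, LinearMap.proj_apply]
      rw [h1, hx.2 n k, h2]⟩

end Hom

namespace Pairing

variable (B : Pairing F G H)

def cechPair (c : ℕ) (j : F.J) (k : G.J) :
    F.Cech 𝒰 c j →ₗ[K] G.Cech 𝒰 c k →ₗ[K] H.Cech 𝒰 c (B.idx j k) :=
  LinearMap.mk₂ K (fun x y I => B.pair _ j k (x I) (y I))
    (fun _ _ _ => by ext; simp) (fun _ _ _ => by ext; simp)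
    (fun _ _ _ => by ext; simp) (fun _ _ _ => by ext; simp)

/-- `(η ⊗ x, φ ⊗ y) ↦ (-1)^{deg φ · deg x} η φ ⊗ B(x, y)`. -/
def cellPair (a c : ℕ) : F.Cell 𝒰 a c →ₗ[K] G.Cell 𝒰 a c →ₗ[K] H.Cell 𝒰 a c :=
  DirectSum.toModule K F.J (G.Cell 𝒰 a c →ₗ[K] H.Cell 𝒰 a c) fun j =>
    (DirectSum.toModule K G.J (PolyForm K a ⊗[K] F.Cech 𝒰 c j →ₗ[K] H.Cell 𝒰 a c) fun k =>
      ((TensorProduct.map₂ ((LinearMap.mul K (PolyForm K a)).compl₂ (koszul K a (F.deg j)))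
        (B.cechPair 𝒰 c j k)).compr₂ (H.cellOf 𝒰 a c (B.idx j k))).flip).flip

theorem cellPair_of (a c : ℕ) (j k) (η φ) (x : F.Cech 𝒰 c j) (y : G.Cech 𝒰 c k) :
    B.cellPair 𝒰 a c (F.cellOf 𝒰 a c j (η ⊗ₜ x)) (G.cellOf 𝒰 a c k (φ ⊗ₜ y)) =
      H.cellOf 𝒰 a c (B.idx j k)
        ((η * koszul K a (F.deg j) φ) ⊗ₜ B.cechPair 𝒰 c j k x y) := by
  simp [cellPair]

theorem cellPair_mem {a c : ℕ} {m l : ℤ} {x : F.Cell 𝒰 a c} {y : G.Cell 𝒰 a c}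
    (hx : x ∈ F.cellHomog 𝒰 a c m) (hy : y ∈ G.cellHomog 𝒰 a c l) :
    B.cellPair 𝒰 a c x y ∈ H.cellHomog 𝒰 a c (m + l) := by
  induction hx using Submodule.span_induction with
  | zero => simp
  | add x y _ _ hx hy => rw [map_add]; exact add_mem hx hy
  | smul c x _ hx => rw [map_smul]; exact Submodule.smul_mem _ _ hx
  | mem x h =>
    obtain ⟨q, j, η, s, hη, hq, rfl⟩ := h
    induction hy using Submodule.span_induction with
    | zero => simp
    | add x y _ _ hx hy => rw [map_add]; exact add_mem hx hy
    | smul c x _ hx => rw [map_smul]; exact Submodule.smul_mem _ _ hx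
    | mem y h =>
      obtain ⟨r, k, φ, t, hφ, hr, rfl⟩ := h
      rw [cellPair_of]
      rcases B.deg_idx j k with h | h
      · exact Submodule.subset_span ⟨q + r, _, _, _, mul_deg hη (koszul_deg _ hφ),
          by rw [h]; push_cast; linarith, rfl⟩
      · have : B.cechPair 𝒰 c j k s t = 0 := by ext I; simp [cechPair, h]
        rw [this]; simp

theorem cell_bilin_ext {a c a' c' : ℕ} {N : Type*} [AddCommMonoid N] [Module K N]
    {f g : F.Cell 𝒰 a c →ₗ[K] G.Cell 𝒰 a' c' →ₗ[K] N}
    (h : ∀ j k η φ s t, f (F.cellOf 𝒰 a c j (η ⊗ₜ s)) (G.cellOf 𝒰 a' c' k (φ ⊗ₜ t)) =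
      g (F.cellOf 𝒰 a c j (η ⊗ₜ s)) (G.cellOf 𝒰 a' c' k (φ ⊗ₜ t))) : f = g :=
  cell_hom_ext 𝒰 fun j η s => cell_hom_ext 𝒰 fun k φ t => h j k η φ s t

theorem cellFace_pair (a c : ℕ) (i : Fin (a + 2)) (x : F.Cell 𝒰 (a + 1) c)
    (y : G.Cell 𝒰 (a + 1) c) :
    H.cellFace 𝒰 a c i (B.cellPair 𝒰 (a + 1) c x y) =
      B.cellPair 𝒰 a c (F.cellFace 𝒰 a c i x) (G.cellFace 𝒰 a c i y) := by
  refine LinearMap.congr_fun₂ (f := (B.cellPair 𝒰 (a + 1) c).compr₂ (H.cellFace 𝒰 a c i))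
    (g := (B.cellPair 𝒰 a c).compl₁₂ (F.cellFace 𝒰 a c i) (G.cellFace 𝒰 a c i))
    (cell_bilin_ext 𝒰 fun j k η φ s t => ?_) x y
  simp only [LinearMap.compr₂_apply, LinearMap.compl₁₂_apply, cellPair_of, cellFace_of, map_mul,
    face_koszul]

theorem cellCoface_pair (a c : ℕ) (i : Fin (c + 2)) (x : F.Cell 𝒰 a c) (y : G.Cell 𝒰 a c) :
    H.cellCoface 𝒰 a c i (B.cellPair 𝒰 a c x y) =
      B.cellPair 𝒰 a (c + 1) (F.cellCoface 𝒰 a c i x) (G.cellCoface 𝒰 a c i y) := by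
  have h : ∀ j k s t, H.coface 𝒰 c i (B.idx j k) (B.cechPair 𝒰 c j k s t) =
      B.cechPair 𝒰 (c + 1) j k (F.coface 𝒰 c i j s) (G.coface 𝒰 c i k t) := fun j k s t => by
    ext I
    simp [coface, cechPair, B.pair_res]
  refine LinearMap.congr_fun₂ (f := (B.cellPair 𝒰 a c).compr₂ (H.cellCoface 𝒰 a c i))
    (g := (B.cellPair 𝒰 a (c + 1)).compl₁₂ (F.cellCoface 𝒰 a c i) (G.cellCoface 𝒰 a c i))
    (cell_bilin_ext 𝒰 fun j k η φ s t => ?_) x y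
  simp only [LinearMap.compr₂_apply, LinearMap.compl₁₂_apply, cellPair_of, cellCoface_of, h]

/-- The bilinear map induced on totalisations. -/
def totPair (m l : ℤ) : F.Tot 𝒰 m →ₗ[K] G.Tot 𝒰 l →ₗ[K] H.Tot 𝒰 (m + l) :=
  LinearMap.mk₂ K (fun x y => ⟨fun n => B.cellPair 𝒰 n n (x.1 n) (y.1 n),
      fun n => B.cellPair_mem 𝒰 (x.2.1 n) (y.2.1 n), fun n k => by
        rw [cellFace_pair, x.2.2 n k, y.2.2 n k, cellCoface_pair]⟩)
    (fun _ _ _ => by ext : 2; simp) (fun _ _ _ => by ext : 2; simp)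
    (fun _ _ _ => by ext : 2; simp) (fun _ _ _ => by ext : 2; simp)

end Pairing

end DGPresheaf
end

noncomputable section

open DGPresheaf

/-- A DG-Lie algebroid over `X`: a complex `cx` of sheaves of `𝒪_X`-modules, a bracket making the
sections into DG-Lie algebras over `K`, and an anchor map to the tangent sheaf (placed in degree
`0`, with zero differential), which is a morphism of complexes of `𝒪_X`-modules and of graded Lie
algebras, and satisfies the Leibniz identity. A section of the tangent sheaf is determined by its
restrictions to smaller opens, seen as derivations of their rings of functions; thus the anchor is
given by a derivation of `Γ(X, U)` for each section on each `U`, compatibly with restriction. -/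
structure DGLieAlgebroid (K : Type u) [Field K] (X : Scheme.{u}) [X.Over (Spec (.of K))] where
  cx : CochainComplex X.Modules ℤ
  bracket : ∀ (U : X.Opens) (p q : ℤ), (DGModPresheaf.ofComplex cx).obj U p →ₗ[K]
    (DGModPresheaf.ofComplex cx).obj U q →ₗ[K] (DGModPresheaf.ofComplex cx).obj U (p + q)
  bracket_res : ∀ {U V : X.Opens} (h : V ≤ U) (p q : ℤ)
    (a : (DGModPresheaf.ofComplex cx).obj U p) (b : (DGModPresheaf.ofComplex cx).obj U q),
    (DGModPresheaf.ofComplex cx).res h (p + q) (bracket U p q a b) =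
      bracket V p q ((DGModPresheaf.ofComplex cx).res h p a)
        ((DGModPresheaf.ofComplex cx).res h q b)
  isDGLieAlgebra : ∀ U : X.Opens, DGLieData.IsDGLieAlgebra (K := K)
    { obj := (DGModPresheaf.ofComplex cx).obj U
      d := fun p => ((DGModPresheaf.ofComplex cx).d U p).restrictScalars K
      bracket := bracket U }
  anchor : ∀ (U : X.Opens) (p : ℤ), (DGModPresheaf.ofComplex cx).obj U p →ₗ[Γ(X, U)]
    Derivation K Γ(X, U) Γ(X, U)
  anchor_res : ∀ {U V : X.Opens} (h : V ≤ U) (p : ℤ)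
    (a : (DGModPresheaf.ofComplex cx).obj U p) (f : Γ(X, U)),
    anchor V p ((DGModPresheaf.ofComplex cx).res h p a) (resRing h f) =
      resRing h (anchor U p a f)
  anchor_of_ne_zero : ∀ (U : X.Opens) (p : ℤ), p ≠ 0 → anchor U p = 0
  anchor_d : ∀ (U : X.Opens) (p : ℤ) (a : (DGModPresheaf.ofComplex cx).obj U p),
    anchor U (p + 1) ((DGModPresheaf.ofComplex cx).d U p a) = 0
  anchor_bracket : ∀ (U : X.Opens) (p q : ℤ)
    (a : (DGModPresheaf.ofComplex cx).obj U p) (b : (DGModPresheaf.ofComplex cx).obj U q),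
    anchor U (p + q) (bracket U p q a b) = ⁅anchor U p a, anchor U q b⁆
  leibniz : ∀ (U : X.Opens) (p q : ℤ) (a : (DGModPresheaf.ofComplex cx).obj U p)
    (f : Γ(X, U)) (b : (DGModPresheaf.ofComplex cx).obj U q),
    DirectSum.of ((DGModPresheaf.ofComplex cx).obj U) (p + q) (bracket U p q a (f • b)) =
      DirectSum.of ((DGModPresheaf.ofComplex cx).obj U) (p + q) (f • bracket U p q a b) +
        DirectSum.of ((DGModPresheaf.ofComplex cx).obj U) q (anchor U p a f • b)

/-- A section on `U` of the tangent sheaf `𝒟er_K(𝒪_X, 𝒪_X)`. -/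
structure TangentSection (K : Type u) [Field K] {X : Scheme.{u}} [X.Over (Spec (.of K))]
    (U : X.Opens) where
  der : ∀ V : X.Opens, V ≤ U → Derivation K Γ(X, V) Γ(X, V)
  der_res : ∀ {V W : X.Opens} (hV : V ≤ U) (h : W ≤ V) (f : Γ(X, V)),
    der W (h.trans hV) (resRing h f) = resRing h (der V hV f)

namespace DGLieAlgebroid

variable {K : Type u} [Field K] {X : Scheme.{u}} [X.Over (Spec (.of K))]
  (𝒜 : DGLieAlgebroid K X)

/-- The underlying complex, through its sections. -/
abbrev A : DGModPresheaf X := DGModPresheaf.ofComplex 𝒜.cx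

/-- The anchor is surjective, as a morphism of sheaves from `A⁰` to the tangent sheaf. -/
def IsTransitive : Prop :=
  ∀ (U : X.Opens) (θ : TangentSection K U) (x : X), x ∈ U →
    ∃ (V : X.Opens) (hV : V ≤ U), x ∈ V ∧ ∃ a : 𝒜.A.obj V 0,
      ∀ (W : X.Opens) (hW : W ≤ V), 𝒜.anchor W 0 (𝒜.A.res hW 0 a) = θ.der W (hW.trans hV)

/-- Sections of the kernel of the anchor, as a morphism of sheaves. -/
def kerAnchor (U : X.Opens) (p : ℤ) : Submodule Γ(X, U) (𝒜.A.obj U p) where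
  carrier := {a | ∀ (V : X.Opens) (h : V ≤ U), 𝒜.anchor V p (𝒜.A.res h p a) = 0}
  add_mem' ha hb V h := by rw [map_add, map_add, ha V h, hb V h, add_zero]
  zero_mem' V h := by rw [map_zero, map_zero]
  smul_mem' f a ha V h := by rw [𝒜.A.res_smul, map_smul, ha V h, smul_zero]

theorem res_mem_kerAnchor {U V : X.Opens} (h : V ≤ U) {p : ℤ} {a : 𝒜.A.obj U p}
    (ha : a ∈ 𝒜.kerAnchor U p) : 𝒜.A.res h p a ∈ 𝒜.kerAnchor V p := fun W h' => by
  rw [𝒜.A.res_res]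
  exact ha W _

theorem anchor_eq_zero {U : X.Opens} {p : ℤ} {a : 𝒜.A.obj U p} (ha : a ∈ 𝒜.kerAnchor U p) :
    𝒜.anchor U p a = 0 := by
  simpa [𝒜.A.res_self] using ha U le_rfl

/-- The kernel `L` of the anchor. -/
def L : DGModPresheaf X where
  obj U p := 𝒜.kerAnchor U p
  res h p := ((𝒜.A.res h p).comp (𝒜.kerAnchor _ p).subtype.toAddMonoidHom).codRestrict
    (𝒜.kerAnchor _ p) fun a => 𝒜.res_mem_kerAnchor h a.2
  res_smul h p f s := Subtype.ext (𝒜.A.res_smul h p f s.1)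
  res_self p s := Subtype.ext (𝒜.A.res_self p s.1)
  res_res h h' p s := Subtype.ext (𝒜.A.res_res h h' p s.1)
  d U p := (𝒜.A.d U p).restrict fun a _ V h => by rw [𝒜.A.res_d, 𝒜.anchor_d]
  d_d U p s := Subtype.ext (𝒜.A.d_d U p s.1)
  res_d h p s := Subtype.ext (𝒜.A.res_d h p s.1)

def incl (U : X.Opens) (p : ℤ) : 𝒜.L.obj U p →ₗ[Γ(X, U)] 𝒜.A.obj U p :=
  (𝒜.kerAnchor U p).subtype

/-- The kernel of the anchor is a finite complex of locally free sheaves. -/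
structure IsFiniteLocallyFreeKernel : Prop where
  bounded : ∃ a b : ℤ, ∀ p, p < a ∨ b < p → ∀ U, Subsingleton (𝒜.L.obj U p)
  locallyFree : ∀ (p : ℤ) (x : X), ∃ V : X.Opens, x ∈ V ∧
    ∃ (κ : Type u) (e : κ → 𝒜.L.obj V p), ∀ (W : X.Opens) (h : W ≤ V),
      LinearIndependent Γ(X, W) (fun i => 𝒜.L.res h p (e i)) ∧
        Submodule.span Γ(X, W) (Set.range fun i => 𝒜.L.res h p (e i)) = ⊤

theorem bracket_mem {U : X.Opens} {p q : ℤ} (a : 𝒜.A.obj U p) {x : 𝒜.A.obj U q}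
    (hx : x ∈ 𝒜.kerAnchor U q) : 𝒜.bracket U p q a x ∈ 𝒜.kerAnchor U (p + q) := fun V h => by
  rw [𝒜.bracket_res, 𝒜.anchor_bracket, hx V h, lie_zero]

theorem bracket_smul_left {U : X.Opens} {p q : ℤ} (f : Γ(X, U)) (a : 𝒜.A.obj U p)
    {x : 𝒜.A.obj U q} (hx : x ∈ 𝒜.kerAnchor U q) :
    𝒜.bracket U p q (f • a) x = f • 𝒜.bracket U p q a x := by
  apply DirectSum.of_injective (β := 𝒜.A.obj U) (p + q)
  have h1 := (𝒜.isDGLieAlgebra U).bracket_symm p q (f • a) x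
  have h2 := (𝒜.isDGLieAlgebra U).bracket_symm p q a x
  have h3 := 𝒜.leibniz U q p x f a
  rw [𝒜.anchor_eq_zero hx, Derivation.zero_apply, zero_smul, map_zero, add_zero] at h3
  simp only [DGLieData.inj, DirectSum.lof_eq_of] at h1 h2
  have h4 : ∀ (n : ℤ) (y : 𝒜.A.obj U n), DirectSum.of (𝒜.A.obj U) n (f • y) =
      f • DirectSum.of (𝒜.A.obj U) n y := fun n y =>
    (DirectSum.lof Γ(X, U) ℤ (𝒜.A.obj U) n).map_smul f y
  refine h1.trans ?_
  rw [h4, h2, smul_neg, smul_comm]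
  refine congrArg _ (congrArg _ ?_)
  rw [← h4]
  exact h3

/-- The adjoint action `a ↦ [a, x]` for `x` in `L`. -/
def act (U : X.Opens) (p q : ℤ) (x : 𝒜.L.obj U q) :
    𝒜.A.obj U p →ₗ[Γ(X, U)] 𝒜.L.obj U (p + q) where
  toFun a := ⟨𝒜.bracket U p q a x.1, 𝒜.bracket_mem a x.2⟩
  map_add' a b := Subtype.ext (by
    change 𝒜.bracket U p q (a + b) x.1 = 𝒜.bracket U p q a x.1 + 𝒜.bracket U p q b x.1
    rw [map_add, LinearMap.add_apply])
  map_smul' f a := Subtype.ext (𝒜.bracket_smul_left f a x.2)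

theorem incl_injective (U : X.Opens) (p : ℤ) : Function.Injective (𝒜.incl U p) :=
  Subtype.val_injective

theorem incl_act (U : X.Opens) (p q : ℤ) (x : 𝒜.L.obj U q) (a : 𝒜.A.obj U p) :
    𝒜.incl U (p + q) (𝒜.act U p q x a) = 𝒜.bracket U p q a (𝒜.incl U q x) :=
  rfl

theorem incl_res {U V : X.Opens} (h : V ≤ U) (p : ℤ) (x : 𝒜.L.obj U p) :
    𝒜.incl V p (𝒜.L.res h p x) = 𝒜.A.res h p (𝒜.incl U p x) :=
  rfl

theorem incl_smul (U : X.Opens) (p : ℤ) (c : K) (x : 𝒜.L.obj U p) :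
    𝒜.incl U p (c • x) = c • 𝒜.incl U p x :=
  rfl

theorem act_add (U : X.Opens) (p q : ℤ) (x y : 𝒜.L.obj U q) :
    𝒜.act U p q (x + y) = 𝒜.act U p q x + 𝒜.act U p q y := by
  refine LinearMap.ext fun a => 𝒜.incl_injective U _ ?_
  rw [incl_act, LinearMap.add_apply, map_add, map_add, map_add, incl_act, incl_act]

theorem act_smul (U : X.Opens) (p q : ℤ) (c : K) (x : 𝒜.L.obj U q) (a : 𝒜.A.obj U p) :
    𝒜.act U p q (c • x) a = c • 𝒜.act U p q x a := by
  refine 𝒜.incl_injective U _ ?_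
  rw [incl_act, incl_smul, incl_smul, map_smul, incl_act]

theorem act_res {U V : X.Opens} (h : V ≤ U) (p q : ℤ) (x : 𝒜.L.obj U q) (a : 𝒜.A.obj U p) :
    𝒜.L.res h (p + q) (𝒜.act U p q x a) = 𝒜.act V p q (𝒜.L.res h q x) (𝒜.A.res h p a) := by
  refine 𝒜.incl_injective V _ ?_
  rw [incl_res, incl_act, incl_act, incl_res, 𝒜.bracket_res]

/-- The bracket `[η ⊗ a, x] = η ⊗ [a, x]`. -/
def omegaActMap (U : X.Opens) (p q : ℤ) :
    OmegaTensor K 𝒜.A U p →ₗ[K] 𝒜.L.obj U q →ₗ[K] OmegaTensor K 𝒜.L U (p + q) :=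
  LinearMap.mk₂ K (fun t x => (𝒜.act U p q x).lTensor Ω[Γ(X, U)⁄K] t)
    (fun _ _ _ => map_add _ _ _)
    (fun c t x => (((𝒜.act U p q x).lTensor Ω[Γ(X, U)⁄K]).restrictScalars K).map_smul c t)
    (fun t x y => by
      rw [act_add, LinearMap.lTensor_add, LinearMap.add_apply])
    (fun c t x => by
      induction t using TensorProduct.induction_on with
      | zero => simp
      | add s t hs ht => rw [map_add, hs, ht, map_add, smul_add]
      | tmul ω a =>
        rw [LinearMap.lTensor_tmul, LinearMap.lTensor_tmul, act_smul, TensorProduct.tmul_smul])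

theorem omegaActMap_res {U V : X.Opens} (h : V ≤ U) (p q : ℤ) (t : OmegaTensor K 𝒜.A U p)
    (x : 𝒜.L.obj U q) : 𝒜.omegaActMap V p q (tensorRes 𝒜.A h p t) (𝒜.L.res h q x) =
      tensorRes 𝒜.L h (p + q) (𝒜.omegaActMap U p q t x) := by
  induction t using TensorProduct.induction_on with
  | zero => simp
  | add s t hs ht => simp only [map_add, LinearMap.add_apply, hs, ht]
  | tmul ω a =>
    rw [tensorRes_tmul]
    change kaehlerMap (resAlg K h) ω ⊗ₜ 𝒜.act V p q (𝒜.L.res h q x) (𝒜.A.res h p a) =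
      kaehlerMap (resAlg K h) ω ⊗ₜ 𝒜.L.res h (p + q) (𝒜.act U p q x a)
    rw [act_res]

/-- The bracket `(Ω¹[-1] ⊗ A) × L → Ω¹[-1] ⊗ L`. -/
def omegaAct : Pairing (omegaTensor (K := K) 𝒜.A) (ofModules 𝒜.L) (omegaTensor 𝒜.L) where
  idx (p q : ℤ) := (p + q : ℤ)
  pair U (p q : ℤ) := 𝒜.omegaActMap U p q
  deg_idx (p q : ℤ) := .inl (by
    change p + q + 1 = p + 1 + q
    ring)
  pair_res h (p q : ℤ) t x := 𝒜.omegaActMap_res h p q t x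

def lieBracketMap (U : X.Opens) (p q : ℤ) :
    𝒜.L.obj U p →ₗ[K] 𝒜.L.obj U q →ₗ[K] 𝒜.L.obj U (p + q) :=
  LinearMap.mk₂ K (fun x y => 𝒜.act U p q y (𝒜.incl U p x))
    (fun _ _ _ => by rw [map_add, map_add])
    (fun c x y => by
      rw [incl_smul]
      exact ((𝒜.act U p q y).restrictScalars K).map_smul c _)
    (fun x y z => by rw [act_add, LinearMap.add_apply])
    (fun c x y => 𝒜.act_smul U p q c y _)

theorem lieBracketMap_res {U V : X.Opens} (h : V ≤ U) (p q : ℤ) (x : 𝒜.L.obj U p)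
    (y : 𝒜.L.obj U q) : 𝒜.lieBracketMap (K := K) V p q (𝒜.L.res h p x) (𝒜.L.res h q y) =
      𝒜.L.res h (p + q) (𝒜.lieBracketMap (K := K) U p q x y) := by
  change 𝒜.act V p q (𝒜.L.res h q y) (𝒜.incl V p (𝒜.L.res h p x)) =
    𝒜.L.res h (p + q) (𝒜.act U p q y (𝒜.incl U p x))
  rw [incl_res, act_res]

/-- The bracket of `L`. -/
def lieBracket : Pairing (ofModules (K := K) 𝒜.L) (ofModules 𝒜.L) (ofModules 𝒜.L) where
  idx (p q : ℤ) := (p + q : ℤ)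
  pair U (p q : ℤ) := 𝒜.lieBracketMap U p q
  deg_idx _ _ := .inl rfl
  pair_res h (p q : ℤ) x y := 𝒜.lieBracketMap_res h p q x y

/-- The inclusion `Id ⊗ i : Ω¹[-1] ⊗ L → Ω¹[-1] ⊗ A`. -/
def inclTensor : Hom (omegaTensor (K := K) 𝒜.L) (omegaTensor 𝒜.A) 0 where
  idx p := p
  deg_idx p := (add_zero _).symm
  map U (p : ℤ) := ((𝒜.incl U p).lTensor Ω[Γ(X, U)⁄K]).restrictScalars K
  map_res {U V} h (p : ℤ) t := by
    change (𝒜.incl V p).lTensor _ (tensorRes 𝒜.L h p t) =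
      tensorRes 𝒜.A h p ((𝒜.incl U p).lTensor _ t)
    induction t using TensorProduct.induction_on with
    | zero => simp
    | add s t hs ht => simp only [map_add, hs, ht]
    | tmul ω a =>
      rw [tensorRes_tmul, LinearMap.lTensor_tmul, LinearMap.lTensor_tmul, tensorRes_tmul, incl_res]

/-- The map `Id ⊗ ρ : Ω¹ ⊗ A → Ω¹ ⊗ Θ ≅ ℋom(Ω¹, Ω¹)`, where `η ⊗ θ` corresponds to
`ω ↦ ω(θ) η`. -/
def anchorHom (U : X.Opens) (p : ℤ) :
    OmegaTensor K 𝒜.A U p →ₗ[Γ(X, U)] Module.End Γ(X, U) Ω[Γ(X, U)⁄K] :=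
  TensorProduct.lift (LinearMap.mk₂ Γ(X, U)
    (fun η a => (𝒜.anchor U p a).liftKaehlerDifferential.smulRight η)
    (fun η η' a => LinearMap.ext fun ω => smul_add _ _ _)
    (fun f η a => LinearMap.ext fun ω => smul_comm _ _ _)
    (fun η a b => LinearMap.ext fun ω => by
      have h : (𝒜.anchor U p (a + b)).liftKaehlerDifferential =
          (𝒜.anchor U p a).liftKaehlerDifferential + (𝒜.anchor U p b).liftKaehlerDifferential := by
        rw [map_add]
        exact map_add (KaehlerDifferential.linearMapEquivDerivation K Γ(X, U)).symm _ _
      rw [h]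
      exact add_smul _ _ _)
    (fun f η a => LinearMap.ext fun ω => by
      have h : (𝒜.anchor U p (f • a)).liftKaehlerDifferential =
          f • (𝒜.anchor U p a).liftKaehlerDifferential := by
        rw [map_smul]
        exact map_smul (KaehlerDifferential.linearMapEquivDerivation K Γ(X, U)).symm f _
      rw [h]
      exact mul_smul _ _ _))

end DGLieAlgebroid

/-- A cyclic bilinear form: a graded symmetric `𝒪_X`-bilinear product `L × L → 𝒪_X` of degree zero
with `⟨[a, x], y⟩ + (-1)^{deg a · deg x} ⟨x, [a, y]⟩ = ρ(a)(⟨x, y⟩)`. -/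
structure CyclicForm {K : Type u} [Field K] {X : Scheme.{u}} [X.Over (Spec (.of K))]
    (𝒜 : DGLieAlgebroid K X) where
  form : ∀ (U : X.Opens) (p q : ℤ), 𝒜.L.obj U p →ₗ[Γ(X, U)] 𝒜.L.obj U q →ₗ[Γ(X, U)] Γ(X, U)
  form_res : ∀ {U V : X.Opens} (h : V ≤ U) (p q : ℤ) (x : 𝒜.L.obj U p) (y : 𝒜.L.obj U q),
    form V p q (𝒜.L.res h p x) (𝒜.L.res h q y) = resRing h (form U p q x y)
  form_of_ne_zero : ∀ (U : X.Opens) (p q : ℤ), p + q ≠ 0 → form U p q = 0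
  form_symm : ∀ (U : X.Opens) (p q : ℤ) (x : 𝒜.L.obj U p) (y : 𝒜.L.obj U q),
    form U p q x y = (p * q).negOnePow • form U q p y x
  cyclic : ∀ (U : X.Opens) (p q r : ℤ) (a : 𝒜.A.obj U p) (x : 𝒜.L.obj U q) (y : 𝒜.L.obj U r),
    form U (p + q) r (𝒜.act U p q x a) y +
      (p * q).negOnePow • form U q (p + r) x (𝒜.act U p r y a) =
    𝒜.anchor U p a (form U q r x y)

namespace CyclicForm

variable {K : Type u} [Field K] {X : Scheme.{u}} [X.Over (Spec (.of K))]
  {𝒜 : DGLieAlgebroid K X} (B : CyclicForm 𝒜)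

theorem form_smul_left (U : X.Opens) (p q : ℤ) (c : K) (x : 𝒜.L.obj U p) (y : 𝒜.L.obj U q) :
    B.form U p q (c • x) y = c • B.form U p q x y := by
  rw [← algebraMap_smul Γ(X, U) c x, map_smul, LinearMap.smul_apply, algebraMap_smul]

theorem form_smul_right (U : X.Opens) (p q : ℤ) (c : K) (x : 𝒜.L.obj U p) (y : 𝒜.L.obj U q) :
    B.form U p q x (c • y) = c • B.form U p q x y := by
  rw [← algebraMap_smul Γ(X, U) c y, map_smul, algebraMap_smul]

def formMap (U : X.Opens) (p q : ℤ) : 𝒜.L.obj U p →ₗ[K] 𝒜.L.obj U q →ₗ[K] Γ(X, U) :=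
  LinearMap.mk₂ K (fun x y => B.form U p q x y)
    (fun _ _ _ => by rw [map_add, LinearMap.add_apply]) (B.form_smul_left U p q)
    (fun _ _ _ => map_add _ _ _) (fun c x y => B.form_smul_right U p q c x y)

/-- The form `L × L → 𝒪_X`. -/
def pairing₀ : Pairing (ofModules (K := K) 𝒜.L) (ofModules 𝒜.L) structureSheaf where
  idx _ _ := ()
  pair U (p q : ℤ) := B.formMap U p q
  deg_idx (p q : ℤ) := by
    by_cases h : p + q = 0
    · exact .inl h.symm
    · exact .inr fun U => LinearMap.ext fun x => LinearMap.ext fun y =>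
        congrArg (fun f => f x y) (B.form_of_ne_zero U p q h)
  pair_res h (p q : ℤ) x y := B.form_res h p q x y

/-- `ω ⊗ x ↦ ⟨ω ⊗ x, y⟩ = ⟨x, y⟩ ω`. -/
def omegaFormAux (U : X.Opens) (p q : ℤ) (y : 𝒜.L.obj U q) :
    OmegaTensor K 𝒜.L U p →ₗ[Γ(X, U)] Ω[Γ(X, U)⁄K] :=
  TensorProduct.lift
    ((LinearMap.lsmul Γ(X, U) Ω[Γ(X, U)⁄K]).flip.compl₂ ((B.form U p q).flip y))

theorem omegaFormAux_tmul (U : X.Opens) (p q : ℤ) (ω : Ω[Γ(X, U)⁄K]) (x : 𝒜.L.obj U p)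
    (y : 𝒜.L.obj U q) : B.omegaFormAux U p q y (ω ⊗ₜ x) = B.form U p q x y • ω := by
  simp [omegaFormAux]

def omegaFormMap (U : X.Opens) (p q : ℤ) :
    OmegaTensor K 𝒜.L U p →ₗ[K] 𝒜.L.obj U q →ₗ[K] Ω[Γ(X, U)⁄K] :=
  LinearMap.mk₂ K (fun t y => B.omegaFormAux U p q y t)
    (fun _ _ _ => map_add _ _ _)
    (fun c t y => ((B.omegaFormAux U p q y).restrictScalars K).map_smul c t)
    (fun t x y => by
      induction t using TensorProduct.induction_on with
      | zero => simp
      | add s t hs ht => rw [map_add, hs, ht, map_add, map_add, add_add_add_comm]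
      | tmul ω a => simp only [omegaFormAux_tmul, map_add, add_smul])
    (fun c t x => by
      induction t using TensorProduct.induction_on with
      | zero => simp
      | add s t hs ht => rw [map_add, hs, ht, map_add, smul_add]
      | tmul ω a => rw [omegaFormAux_tmul, omegaFormAux_tmul, form_smul_right, smul_assoc])

theorem omegaFormMap_res {U V : X.Opens} (h : V ≤ U) (p q : ℤ) (t : OmegaTensor K 𝒜.L U p)
    (y : 𝒜.L.obj U q) : B.omegaFormMap V p q (tensorRes 𝒜.L h p t) (𝒜.L.res h q y) =
      kaehlerMap (resAlg K h) (B.omegaFormMap U p q t y) := by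
  change B.omegaFormAux V p q (𝒜.L.res h q y) (tensorRes 𝒜.L h p t) =
    kaehlerMap (resAlg K h) (B.omegaFormAux U p q y t)
  induction t using TensorProduct.induction_on with
  | zero => simp
  | add s t hs ht => simp only [map_add, hs, ht]
  | tmul ω a =>
    rw [tensorRes_tmul, omegaFormAux_tmul, omegaFormAux_tmul, kaehlerMap_smul, B.form_res]
    rfl

/-- The extended form `(Ω¹[-1] ⊗ L) × L → Ω¹[-1]`. -/
def pairing₁ : Pairing (omegaTensor (K := K) 𝒜.L) (ofModules 𝒜.L) omegaOne where
  idx _ _ := ()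
  pair U (p q : ℤ) := B.omegaFormMap U p q
  deg_idx (p q : ℤ) := by
    by_cases h : p + q = 0
    · refine .inl ?_
      change (1 : ℤ) = p + 1 + q
      linarith
    · refine .inr fun U => LinearMap.ext fun t => LinearMap.ext fun y => ?_
      change B.omegaFormAux U p q y t = 0
      induction t using TensorProduct.induction_on with
      | zero => simp
      | add s t hs ht => rw [map_add, hs, ht, add_zero]
      | tmul ω a => rw [omegaFormAux_tmul, B.form_of_ne_zero U p q h]; simp
  pair_res h (p q : ℤ) t y := B.omegaFormMap_res h p q t y

end CyclicForm

namespace DGPresheaf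

variable {K : Type u} [Field K] {X : Scheme.{u}} [X.Over (Spec (.of K))]

/-- `𝒪_X` as the component of degree `-2` of `Ω_X^{≤1}[2]`. -/
def inclDeRham₀ : Hom (structureSheaf (K := K) (X := X)) truncDeRham (-2) where
  idx _ := (0 : Fin 2)
  deg_idx _ := by
    change ((0 : Fin 2).val : ℤ) - 2 = 0 + -2
    norm_num
  map U _ := (LinearMap.id : Γ(X, U) →ₗ[K] Γ(X, U))
  map_res _ _ _ := rfl

/-- `Ω¹_X` as the component of degree `-1` of `Ω_X^{≤1}[2]`. -/
def inclDeRham₁ : Hom (omegaOne (K := K) (X := X)) truncDeRham (-2) where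
  idx _ := (1 : Fin 2)
  deg_idx _ := by
    change ((1 : Fin 2).val : ℤ) - 2 = 1 + -2
    norm_num
  map U _ := (LinearMap.id : Ω[Γ(X, U)⁄K] →ₗ[K] Ω[Γ(X, U)⁄K])
  map_res _ _ _ := rfl

end DGPresheaf

section TotLie

variable {K : Type u} [Field K] {X : Scheme.{u}} [X.Over (Spec (.of K))]
  (𝒜 : DGLieAlgebroid K X) {ι : Type w} (𝒰 : ι → X.Opens)

/-- `Tot(𝒰, L)` with the induced differential and bracket. -/
def DGLieAlgebroid.totL : DGLieData.{u, max u w} K where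
  obj m := (ofModules (K := K) 𝒜.L).Tot 𝒰 m
  acg m := Module.addCommMonoidToAddCommGroup K
  mod m := inferInstanceAs (Module K ((ofModules (K := K) 𝒜.L).Tot 𝒰 m))
  d m := totD 𝒰 (ofModules (K := K) 𝒜.L) m
  bracket p q := 𝒜.lieBracket.totPair 𝒰 p q

variable (K) in
/-- `Tot(𝒰, Ω_X^{≤1}[2])`, with zero bracket. -/
def totDeRham : DGLieData.{u, max u w} K where
  obj m := (truncDeRham (K := K) (X := X)).Tot 𝒰 m
  acg m := Module.addCommMonoidToAddCommGroup K
  mod m := inferInstanceAs (Module K ((truncDeRham (K := K) (X := X)).Tot 𝒰 m))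
  d m := totD 𝒰 (truncDeRham (K := K) (X := X)) m
  bracket p q := 0

/-- `Id ⊗ ρ` on Čech cochains. -/
def DGLieAlgebroid.cechAnchor (n : ℕ) (p : ℤ) :
    (∀ I : Fin (n + 1) → ι, OmegaTensor K 𝒜.A (inter 𝒰 I) p) →ₗ[K]
      (∀ I : Fin (n + 1) → ι, Module.End Γ(X, inter 𝒰 I) Ω[Γ(X, inter 𝒰 I)⁄K]) :=
  LinearMap.pi fun I => ((𝒜.anchorHom (inter 𝒰 I) p).restrictScalars K) ∘ₗ LinearMap.proj I

/-- `Id ⊗ ρ` on the `n`-th component of the totalisation. -/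
def DGLieAlgebroid.cellAnchor (n : ℕ) :
    (omegaTensor (K := K) 𝒜.A).Cell 𝒰 n n →ₗ[K]
      TWForms.PolyForm K n ⊗[K]
        (∀ I : Fin (n + 1) → ι, Module.End Γ(X, inter 𝒰 I) Ω[Γ(X, inter 𝒰 I)⁄K]) :=
  DirectSum.toModule K (omegaTensor (K := K) 𝒜.A).J _ fun p =>
    LinearMap.lTensor (TWForms.PolyForm K n) (𝒜.cechAnchor 𝒰 n p)

/-- `D` is a simplicial lifting of the identity: `(Id ⊗ ρ)(D)` is the element `(1 ⊗ Id)ₙ` given by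
the global section `Id` of `Ω¹ ⊗ Θ ≅ ℋom(Ω¹, Ω¹)`. -/
def DGLieAlgebroid.IsSimplicialLifting (D : (omegaTensor (K := K) 𝒜.A).Tot 𝒰 1) : Prop :=
  ∀ n : ℕ, 𝒜.cellAnchor 𝒰 n (D.1 n) = 1 ⊗ₜ fun _ => LinearMap.id

/-- The connection `∇ = [D, -]` associated with a simplicial lifting of the identity. -/
def DGLieAlgebroid.connection (D : (omegaTensor (K := K) 𝒜.A).Tot 𝒰 1) (p : ℤ) :
    (ofModules (K := K) 𝒜.L).Tot 𝒰 p →ₗ[K] (omegaTensor (K := K) 𝒜.L).Tot 𝒰 (1 + p) :=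
  𝒜.omegaAct.totPair 𝒰 1 p D

/-- The forms induced on the totalisations of `L` and `Ω¹[-1] ⊗ L` satisfy
`⟨d_Tot z, w⟩ + (-1)^{deg z} ⟨z, d_Tot w⟩ = d_Tot ⟨z, w⟩`, where `𝒪_X` and `Ω¹[-1]` have zero
differential. -/
structure CyclicForm.IsTotClosed {𝒜 : DGLieAlgebroid K X} (B : CyclicForm 𝒜) : Prop where
  closed₀ : ∀ (p q : ℤ) (z : (ofModules (K := K) 𝒜.L).Tot 𝒰 p)
    (w : (ofModules (K := K) 𝒜.L).Tot 𝒰 q),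
    ((B.pairing₀.totPair 𝒰 (p + 1) q (totD 𝒰 _ p z) w).1 +
      p.negOnePow • (B.pairing₀.totPair 𝒰 p (q + 1) z (totD 𝒰 _ q w)).1) =
    (totD 𝒰 _ (p + q) (B.pairing₀.totPair 𝒰 p q z w)).1
  closed₁ : ∀ (p q : ℤ) (z : (omegaTensor (K := K) 𝒜.L).Tot 𝒰 p)
    (w : (ofModules (K := K) 𝒜.L).Tot 𝒰 q),
    ((B.pairing₁.totPair 𝒰 (p + 1) q (totD 𝒰 _ p z) w).1 +
      p.negOnePow • (B.pairing₁.totPair 𝒰 p (q + 1) z (totD 𝒰 _ q w)).1) =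
    (totD 𝒰 _ (p + q) (B.pairing₁.totPair 𝒰 p q z w)).1

end TotLie
end

/-! Put g(x) = ⟨u, x⟩, N(x, y) = ⟨∇x, y⟩ and C(x, y) = ⟨x, y⟩, the last one placed in the summand 𝒪
of the truncated de Rham complex. The theorem rests on a few identities between these maps,
collected in `ChernSimonsData`. As du = 0, closedness of the form gives d g(x) = g(dx). As D has
degree one and dD = u, one has d(∇x) = [u, x] - ∇(dx); closedness and invariance then give dN(x, y)
= g([x, y]) - N(dx, y) - (-1)^x N(x, dy). The differential of C has one more summand, the de Rham
differential of ⟨x, y⟩. Since D lifts the identity, the de Rham differential of a function is the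
action of ρ(D) on it, so cyclicity makes this summand N(x, y) + (-1)^{xy} N(y, x). Finally ∇ is a
derivation of the bracket, whence N([x, y], z) = N(x, [y, z]) - (-1)^{xy} N(y, [x, z]), and C is
graded symmetric and invariant.

The `L∞` relations are now formal. In arity two, skew-symmetrise the formula for dN
(`ChernSimonsData.d_quadratic`). In arity three, the N-terms in the differential of C(x, [y, z])
match the sum of the f₂([x, y], z) once the latter is expanded by the derivation rule
(`ChernSimonsData.d_cubic`). In arity four only the sum of the f₃([x, y], z, w) remains, and it
vanishes by the Jacobi identity and the invariance of C (`ChernSimonsData.cubic_bracket`). In higher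
arity every term is zero.

The existence of u is a statement about affine opens. There Ω¹ is finite projective by smoothness,
so Ω¹ ⊗ L is exactly the kernel of Ω¹ ⊗ A → End(Ω¹) (`DGLieAlgebroid.exact_anchorHom`). Exactness
survives products over Čech indices and tensoring over K with polynomial forms. Since the image of D
is the constant 1 ⊗ Id, that of dD is zero, and dD comes from a unique u; uniqueness also gives du =
0.

All identities are proved for sections and carried to the totalisation by general lemmas that supply
the Koszul signs of the forms. `Pairing.cellPair_trilinear` serves three times: with ε = -1 for
Jacobi identities, with ε = 0 for invariance, and with ε = 1 for the action of D on ⟨x, y⟩. To fit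
it, the identities keep the first argument in front and exchange only the other two. -/

/-! ### Signs as scalars of the base field -/

/-- The sign `(-1)^p` as an element of `K`. -/
def ksign (K : Type*) [Field K] (p : ℤ) : K := ((p.negOnePow : ℤ) : K)

section ksign

variable {K : Type*} [Field K]

theorem ksign_add (p q : ℤ) : ksign K (p + q) = ksign K p * ksign K q := by
  simp [ksign, Int.negOnePow_add]

theorem ksign_congr {p q : ℤ} (h : Even (p - q)) : ksign K p = ksign K q := by
  rw [ksign, ksign, (Int.negOnePow_eq_iff p q).2 h]

@[simp] theorem ksign_zero : ksign K 0 = 1 := by simp [ksign]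

@[simp] theorem ksign_one : ksign K 1 = -1 := by simp [ksign]

theorem ksign_mul_self (p : ℤ) : ksign K p * ksign K p = 1 := by
  rw [← ksign_add, ksign_congr (q := 0) ⟨p, by ring⟩, ksign_zero]

theorem negOnePow_smul {M : Type*} [AddCommGroup M] [Module K M] (p : ℤ) (x : M) :
    p.negOnePow • x = ksign K p • x := by
  rw [ksign, Units.smul_def, Int.cast_smul_eq_zsmul]

end ksign

/-! ### Polynomial forms: graded commutativity, Leibniz rule, degree projections -/

namespace TWForms

variable {K : Type u} [Field K]

/-- Generators anticommute. The grading involution carries the sign, so `w` need not be homogeneous.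
-/
theorem ι_mul_eq_involute_mul {V : Type*} [AddCommGroup V] [Module K V] (v : V)
    (w : ExteriorAlgebra K V) :
    ExteriorAlgebra.ι K v * w = CliffordAlgebra.involute w * ExteriorAlgebra.ι K v := by
  induction w using ExteriorAlgebra.induction with
  | algebraMap r => simp [Algebra.commutes]
  | ι x =>
    have h : CliffordAlgebra.involute (ExteriorAlgebra.ι K x) = -ExteriorAlgebra.ι K x :=
      CliffordAlgebra.involute_ι x
    rw [h, neg_mul, ← add_eq_zero_iff_eq_neg]
    exact ExteriorAlgebra.ι_add_mul_swap v x
  | mul a b ha hb => rw [← mul_assoc, ha, mul_assoc, hb, ← mul_assoc, map_mul]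
  | add a b ha hb => rw [mul_add, ha, hb, map_add, add_mul]

theorem involute_exteriorPower {V : Type*} [AddCommGroup V] [Module K V] {a : ℕ}
    {w : ExteriorAlgebra K V} (hw : w ∈ ⋀[K]^a V) :
    CliffordAlgebra.involute w = (a : ℤ).negOnePow • w := by
  rw [ExteriorAlgebra.exteriorPower] at hw
  induction a generalizing w with
  | zero =>
    rw [pow_zero, Submodule.mem_one] at hw
    obtain ⟨c, rfl⟩ := hw
    simp
  | succ a ih =>
    rw [pow_succ] at hw
    induction hw using Submodule.mul_induction_on' with
    | mem_mul_mem x hx y hy =>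
      obtain ⟨v, rfl⟩ := hy
      have h : CliffordAlgebra.involute (ExteriorAlgebra.ι K v) = -ExteriorAlgebra.ι K v :=
        CliffordAlgebra.involute_ι v
      rw [map_mul, ih hx, h, Nat.cast_succ, Int.negOnePow_succ, Units.smul_def, Units.smul_def,
        Units.val_neg, neg_smul, mul_neg, smul_mul_assoc]
    | add x _ y _ hx hy => rw [map_add, hx, hy, smul_add]

theorem mul_eq_involute_mul {V : Type*} [AddCommGroup V] [Module K V] {a : ℕ}
    {w : ExteriorAlgebra K V} (hw : w ∈ ⋀[K]^a V) (x : ExteriorAlgebra K V) :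
    w * x = (if Even a then x else CliffordAlgebra.involute x) * w := by
  rw [ExteriorAlgebra.exteriorPower] at hw
  induction a generalizing w x with
  | zero =>
    rw [pow_zero, Submodule.mem_one] at hw
    obtain ⟨c, rfl⟩ := hw
    simp [Algebra.commutes]
  | succ a ih =>
    rw [pow_succ] at hw
    induction hw using Submodule.mul_induction_on' with
    | mem_mul_mem y hy z hz =>
      obtain ⟨v, rfl⟩ := hz
      rw [mul_assoc, ι_mul_eq_involute_mul, ← mul_assoc, ih hy, mul_assoc]
      by_cases h : Even a <;> simp [h, Nat.even_add_one]
    | add x _ y _ hx hy => rw [add_mul, hx, hy, mul_add]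

theorem inv_inv (n : ℕ) (x : PolyForm K n) : inv K n (inv K n x) = x := by
  induction x using TensorProduct.induction_on with
  | zero => simp
  | add x y hx hy => rw [map_add, map_add, hx, hy]
  | tmul f w => rw [inv_tmul, inv_tmul, CliffordAlgebra.involute_involute]

theorem inv_of_mem {n a : ℕ} {x : PolyForm K n} (hx : x ∈ degForm K n a) :
    inv K n x = ksign K a • x := by
  induction hx using Submodule.span_induction with
  | zero => simp
  | add x y _ _ hx hy => rw [map_add, hx, hy, smul_add]
  | smul c x _ hx => rw [map_smul, hx, smul_comm]
  | mem x h =>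
    obtain ⟨f, w, hw, rfl⟩ := h
    rw [inv_tmul, involute_exteriorPower hw, negOnePow_smul (K := K), TensorProduct.tmul_smul]

/-- Graded commutativity with only the left factor homogeneous; the sign operator replaces the
degree of `y`. -/
theorem mul_eq_of_mem {n a : ℕ} {x : PolyForm K n} (hx : x ∈ degForm K n a) (y : PolyForm K n) :
    x * y = koszul K n a y * x := by
  induction hx using Submodule.span_induction with
  | zero => simp
  | add x x' _ _ hx hx' => rw [add_mul, hx, hx', mul_add]
  | smul c x _ hx => rw [smul_mul_assoc, hx, mul_smul_comm]
  | mem x h =>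
    obtain ⟨f, w, hw, rfl⟩ := h
    induction y using TensorProduct.induction_on with
    | zero => simp
    | add y y' hy hy' => rw [mul_add, hy, hy', map_add, add_mul]
    | tmul g v =>
      rw [Algebra.TensorProduct.tmul_mul_tmul, mul_eq_involute_mul hw, mul_comm f g]
      unfold koszul
      by_cases h : Even a <;> simp [h, inv_tmul]

theorem koszul_even {n : ℕ} {p : ℤ} (h : Even p) (x : PolyForm K n) : koszul K n p x = x := by
  simp [koszul, h]

theorem koszul_odd {n : ℕ} {p : ℤ} (h : ¬Even p) (x : PolyForm K n) :
    koszul K n p x = inv K n x := by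
  simp [koszul, h]

theorem koszul_mul (n : ℕ) (p : ℤ) (x y : PolyForm K n) :
    koszul K n p (x * y) = koszul K n p x * koszul K n p y := by
  by_cases h : Even p <;> simp [koszul, h]

theorem koszul_add (n : ℕ) (p q : ℤ) (x : PolyForm K n) :
    koszul K n (p + q) x = koszul K n p (koszul K n q x) := by
  by_cases hp : Even p <;> by_cases hq : Even q <;> simp [koszul, hp, hq, Int.even_add, inv_inv]

theorem koszul_of_mem {n a : ℕ} (p : ℤ) {x : PolyForm K n} (hx : x ∈ degForm K n a) :
    koszul K n p x = ksign K (p * a) • x := by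
  by_cases h : Even p
  · rw [koszul_even h, ksign_congr (q := 0) (by simpa using h.mul_right _), ksign_zero, one_smul]
  · rw [koszul_odd h, inv_of_mem hx]
    congr 1
    obtain ⟨k, rfl⟩ := Int.not_even_iff_odd.1 h
    exact ksign_congr ⟨-k * a, by ring⟩

/-- The one sign computation behind the transfer to cells. Exchanging two elements of total degrees
`b + j` and `c + k` costs the full Koszul sign; the sections account for the part `j * k`, and the
forms must produce the rest. -/
theorem mul_koszul_swap {n b c : ℕ} (j k : ℤ) {φ ψ : PolyForm K n} (hφ : φ ∈ degForm K n b)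
    (hψ : ψ ∈ degForm K n c) :
    ψ * koszul K n k φ = ksign K ((b + j) * (c + k) + j * k) • (φ * koszul K n j ψ) := by
  rw [koszul_of_mem k hφ, koszul_of_mem j hψ, mul_smul_comm, mul_smul_comm, mul_eq_of_mem hψ,
    koszul_of_mem c hφ, smul_mul_assoc, smul_smul, smul_smul, ← ksign_add, ← ksign_add]
  congr 1
  exact ksign_congr ⟨-(j * c) - j * k, by ring⟩

theorem koszul_smul (n : ℕ) (p : ℤ) (r : K) (x : PolyForm K n) :
    koszul K n p (r • x) = r • koszul K n p x :=
  (koszul K n p).map_smul r x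

theorem mul_smul_polyForm (n : ℕ) (r : K) (x y : PolyForm K n) : x * r • y = r • (x * y) :=
  Algebra.mul_smul_comm r x y

theorem smul_mul_polyForm (n : ℕ) (r : K) (x y : PolyForm K n) : r • x * y = r • (x * y) :=
  Algebra.smul_mul_assoc r x y

theorem mul_koszul_swap_left {n b c : ℕ} (i j k : ℤ) (η : PolyForm K n) {φ ψ : PolyForm K n}
    (hφ : φ ∈ degForm K n b) (hψ : ψ ∈ degForm K n c) :
    η * koszul K n i (ψ * koszul K n k φ) =
      ksign K ((b + j) * (c + k) + j * k) • (η * koszul K n i (φ * koszul K n j ψ)) := by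
  rw [mul_koszul_swap j k hφ hψ, koszul_smul, mul_smul_polyForm]

theorem dForm_inv (n : ℕ) (x : PolyForm K n) : dForm K n (inv K n x) = -inv K n (dForm K n x) := by
  induction x using TensorProduct.induction_on with
  | zero => simp
  | add x y hx hy => rw [map_add, map_add, hx, hy, map_add, map_add, neg_add]
  | tmul f w =>
    rw [inv_tmul, dForm_tmul, dForm_tmul, map_sum, ← Finset.sum_neg_distrib]
    refine Finset.sum_congr rfl fun i _ => ?_
    have h : CliffordAlgebra.involute (ExteriorAlgebra.ι K (Pi.single i 1 : Fin n → K)) =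
        -ExteriorAlgebra.ι K (Pi.single i 1 : Fin n → K) := CliffordAlgebra.involute_ι _
    rw [inv_tmul, map_mul, h, neg_mul, TensorProduct.tmul_neg, neg_neg]

theorem dForm_koszul (n : ℕ) (p : ℤ) (x : PolyForm K n) :
    dForm K n (koszul K n p x) = ksign K p • koszul K n p (dForm K n x) := by
  by_cases h : Even p
  · rw [koszul_even h, koszul_even h, ksign_congr (q := 0) (by simpa using h), ksign_zero, one_smul]
  · rw [koszul_odd h, koszul_odd h, dForm_inv]
    obtain ⟨k, rfl⟩ := Int.not_even_iff_odd.1 h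
    rw [ksign_congr (q := 1) ⟨k, by ring⟩, ksign_one]
    exact (neg_one_smul K _).symm

/-- Each partial derivative is a derivation, and moving its `dtᵢ` past the exterior part of `x`
costs the grading involution. -/
theorem dForm_mul (n : ℕ) (x y : PolyForm K n) :
    dForm K n (x * y) = dForm K n x * y + inv K n x * dForm K n y := by
  induction x using TensorProduct.induction_on with
  | zero => simp
  | add x x' hx hx' => rw [add_mul, map_add, hx, hx', map_add, map_add, add_mul, add_mul]; abel
  | tmul f w =>
    induction y using TensorProduct.induction_on with
    | zero => simp
    | add y y' hy hy' => rw [mul_add, map_add, hy, hy', map_add, mul_add, mul_add]; abel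
    | tmul g v =>
      rw [Algebra.TensorProduct.tmul_mul_tmul, dForm_tmul, dForm_tmul, dForm_tmul, inv_tmul,
        Finset.sum_mul, Finset.mul_sum, ← Finset.sum_add_distrib]
      refine Finset.sum_congr rfl fun i _ => ?_
      rw [Algebra.TensorProduct.tmul_mul_tmul, Algebra.TensorProduct.tmul_mul_tmul,
        Derivation.leibniz, ← mul_assoc, ← mul_assoc, ← ι_mul_eq_involute_mul,
        TensorProduct.add_tmul, smul_eq_mul, smul_eq_mul, mul_comm g, add_comm]

theorem dForm_dForm (n : ℕ) (x : PolyForm K n) : dForm K n (dForm K n x) = 0 := by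
  induction x using TensorProduct.induction_on with
  | zero => simp
  | add x y hx hy => rw [map_add, map_add, hx, hy, add_zero]
  | tmul f w =>
    have hswap : ∀ i j : Fin n,
        MvPolynomial.pderiv j (MvPolynomial.pderiv i f) ⊗ₜ[K]
          (ExteriorAlgebra.ι K (Pi.single j 1 : Fin n → K) *
            (ExteriorAlgebra.ι K (Pi.single i 1 : Fin n → K) * w)) =
        -(MvPolynomial.pderiv i (MvPolynomial.pderiv j f) ⊗ₜ[K]
          (ExteriorAlgebra.ι K (Pi.single i 1 : Fin n → K) *
            (ExteriorAlgebra.ι K (Pi.single j 1 : Fin n → K) * w))) := fun i j => by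
      have h : MvPolynomial.pderiv j (MvPolynomial.pderiv i f) =
          MvPolynomial.pderiv i (MvPolynomial.pderiv j f) := by
        have h0 : ⁅MvPolynomial.pderiv (R := K) j, MvPolynomial.pderiv (R := K) i⁆ = 0 := by
          classical
          refine MvPolynomial.derivation_ext fun k => ?_
          rw [Derivation.commutator_apply]
          simp [MvPolynomial.pderiv_X, Pi.single_apply, apply_ite]
        have h1 := DFunLike.congr_fun h0 f
        rw [Derivation.commutator_apply] at h1
        exact sub_eq_zero.1 h1
      rw [h, ← TensorProduct.tmul_neg, ← mul_assoc, ← mul_assoc, ← neg_mul,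
        eq_neg_of_add_eq_zero_left (ExteriorAlgebra.ι_add_mul_swap _ _)]
    have hdiag : ∀ (i : Fin n) (g : MvPolynomial (Fin n) K), g ⊗ₜ[K]
          (ExteriorAlgebra.ι K (Pi.single i 1 : Fin n → K) *
            (ExteriorAlgebra.ι K (Pi.single i 1 : Fin n → K) * w)) = 0 := fun i g => by
      rw [← mul_assoc, ExteriorAlgebra.ι_sq_zero, zero_mul, TensorProduct.tmul_zero]
    rw [dForm_tmul, map_sum]
    simp_rw [dForm_tmul]
    rw [← Finset.sum_product']
    -- The terms (i, j) and (j, i) cancel because partial derivatives commute and the `dtᵢ`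
    -- anticommute. Terms fixed by the exchange vanish by themselves, the square of `dtᵢ` being
    -- zero.
    refine Finset.sum_involution (fun p _ => (p.2, p.1)) (fun p _ => ?_) (fun p _ h h' => h ?_)
      (fun _ _ => Finset.mem_univ _) (fun _ _ => rfl)
    · rw [hswap p.1 p.2, neg_add_cancel]
    · obtain ⟨i, j⟩ := p
      obtain rfl : j = i := (Prod.ext_iff.1 h').1
      exact hdiag _ _

/-- The projection of forms onto their component of degree `a`. -/
noncomputable def degProj (n a : ℕ) : PolyForm K n →ₗ[K] PolyForm K n :=
  LinearMap.lTensor _ ((⋀[K]^a (Fin n → K)).subtype ∘ₗ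
    (DirectSum.component K ℕ (fun i : ℕ => ⋀[K]^i (Fin n → K)) a) ∘ₗ
    (DirectSum.decomposeLinearEquiv (R := K) (fun i : ℕ => ⋀[K]^i (Fin n → K))).toLinearMap)

theorem degProj_tmul (n a : ℕ) (f : MvPolynomial (Fin n) K) (w : ExteriorAlgebra K (Fin n → K)) :
    degProj n a (f ⊗ₜ w) =
      f ⊗ₜ (DirectSum.decompose (fun i : ℕ => ⋀[K]^i (Fin n → K)) w a :
        ExteriorAlgebra K (Fin n → K)) :=
  rfl

theorem degProj_mem (n a : ℕ) (x : PolyForm K n) : degProj n a x ∈ degForm K n a := by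
  induction x using TensorProduct.induction_on with
  | zero => simp
  | add x y hx hy => rw [map_add]; exact add_mem hx hy
  | tmul f w => exact Submodule.subset_span ⟨f, _, Subtype.prop _, rfl⟩

theorem degProj_of_mem {n a : ℕ} {x : PolyForm K n} (hx : x ∈ degForm K n a) :
    degProj n a x = x := by
  induction hx using Submodule.span_induction with
  | zero => simp
  | add x y _ _ hx hy => rw [map_add, hx, hy]
  | smul c x _ hx => rw [map_smul, hx]
  | mem x h =>
    obtain ⟨f, w, hw, rfl⟩ := h
    rw [degProj_tmul,
      DirectSum.decompose_of_mem_same (fun i : ℕ => ⋀[K]^i (Fin n → K)) hw]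

end TWForms

theorem ksign_mul_cancel {K : Type*} [Field K] (p : ℤ) (c : K) :
    ksign K p * (ksign K p * c) = c := by
  rw [← mul_assoc, ksign_mul_self, one_mul]

/-! ### Transfer of identities from sections to cells -/

noncomputable section

namespace DGPresheaf

open TWForms

variable {K : Type u} [Field K] {X : Scheme.{u}} {ι : Type w} (𝒰 : ι → X.Opens)
variable {F G H F' G' : DGPresheaf K X}

variable (F) in
/-- The inclusion of the sections of a component in the sum of all components. -/
abbrev secOf (U : X.Opens) (j : F.J) : F.obj U j →ₗ[K] ⨁ j, F.obj U j :=
  DirectSum.lof K F.J (F.obj U) j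

variable (F) in
/-- The inclusion of the Čech cochains of a component in the sum of all components. -/
abbrev cechOf (c : ℕ) (j : F.J) : F.Cech 𝒰 c j →ₗ[K] ⨁ j, F.Cech 𝒰 c j :=
  DirectSum.lof K F.J (F.Cech 𝒰 c) j

/-- The value of a Čech cochain on an intersection. -/
def cechEval (c : ℕ) (I : Fin (c + 1) → ι) :
    (⨁ j, F.Cech 𝒰 c j) →ₗ[K] ⨁ j, F.obj (inter 𝒰 I) j :=
  DirectSum.lmap fun _ => LinearMap.proj I

theorem cechEval_of (c : ℕ) (I : Fin (c + 1) → ι) (j) (s : F.Cech 𝒰 c j) :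
    cechEval 𝒰 c I (F.cechOf 𝒰 c j s) = F.secOf _ j (s I) := by
  simp [cechEval, DirectSum.lof_eq_of]

/-- Cochains are compared in the sum of all components because the two sides of an identity usually
lie in components whose indices agree only up to arithmetic. This reduces such an identity to the
sections over each intersection. -/
theorem cech_ext {c : ℕ} {x y : ⨁ j, F.Cech 𝒰 c j}
    (h : ∀ I, cechEval 𝒰 c I x = cechEval 𝒰 c I y) : x = y :=
  DFinsupp.ext fun j => funext fun I => DFunLike.congr_fun (h I) j

theorem cell_induction {a c : ℕ} {P : F.Cell 𝒰 a c → Prop} (zero : P 0)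
    (add : ∀ x y, P x → P y → P (x + y)) (of : ∀ j η s, P (F.cellOf 𝒰 a c j (η ⊗ₜ s)))
    (x : F.Cell 𝒰 a c) : P x := by
  induction x using DirectSum.induction_on with
  | zero => exact zero
  | add x y hx hy => exact add x y hx hy
  | of j x =>
    induction x using TensorProduct.induction_on with
    | zero => rwa [map_zero]
    | add x y hx hy => rw [map_add]; exact add _ _ hx hy
    | tmul η s => exact of j η s

theorem homog_induction {a c : ℕ} {m : ℤ} {P : ∀ x, x ∈ F.cellHomog 𝒰 a c m → Prop}
    (zero : P 0 (zero_mem _))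
    (add : ∀ x y hx hy, P x hx → P y hy → P (x + y) (add_mem hx hy))
    (of : ∀ (q : ℕ) j η s (hη : η ∈ degForm K a q) (hj : q + F.deg j = m),
      P (F.cellOf 𝒰 a c j (η ⊗ₜ s)) (Submodule.subset_span ⟨q, j, η, s, hη, hj, rfl⟩))
    {x : F.Cell 𝒰 a c} (hx : x ∈ F.cellHomog 𝒰 a c m) : P x hx := by
  -- `P` is not assumed stable under scalars: a scalar is carried along and finally absorbed into
  -- the form of a generator.
  suffices ∀ r : K, P (r • x) (Submodule.smul_mem _ r hx) by simpa using this 1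
  induction hx using Submodule.span_induction with
  | zero => intro r; simpa using zero
  | add x y hx' hy' hx hy => intro r; simpa using add _ _ _ _ (hx r) (hy r)
  | smul r x _ hx => intro r'; simpa [smul_smul] using hx (r' * r)
  | mem x h =>
    obtain ⟨q, j, η, s, hη, hq, rfl⟩ := h
    intro r
    have := of q j _ s (Submodule.smul_mem _ r hη) hq
    simp only [← TensorProduct.smul_tmul', map_smul] at this
    exact this

/-- `s ↦ η ⊗ s` on Čech cochains. -/
def cellTmul (a c : ℕ) (η : PolyForm K a) : (⨁ j, F.Cech 𝒰 c j) →ₗ[K] F.Cell 𝒰 a c :=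
  DirectSum.lmap fun j => TensorProduct.mk K (PolyForm K a) (F.Cech 𝒰 c j) η

theorem cellTmul_of (a c : ℕ) (η : PolyForm K a) (j) (s : F.Cech 𝒰 c j) :
    cellTmul 𝒰 a c η (F.cechOf 𝒰 c j s) = F.cellOf 𝒰 a c j (η ⊗ₜ s) := by
  simp [cellTmul, DirectSum.lof_eq_of]

theorem cellTmul_add (a c : ℕ) (η : PolyForm K a) (x y : ⨁ j, F.Cech 𝒰 c j) :
    cellTmul 𝒰 a c η (x + y) = cellTmul 𝒰 a c η x + cellTmul 𝒰 a c η y :=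
  (cellTmul 𝒰 a c η).map_add x y

theorem cellTmul_smul (a c : ℕ) (η : PolyForm K a) (r : K) (x : ⨁ j, F.Cech 𝒰 c j) :
    cellTmul 𝒰 a c η (r • x) = r • cellTmul 𝒰 a c η x :=
  (cellTmul 𝒰 a c η).map_smul r x

theorem cech_induction {c : ℕ} {P : (⨁ j, F.Cech 𝒰 c j) → Prop} (zero : P 0)
    (add : ∀ x y, P x → P y → P (x + y)) (of : ∀ j s, P (F.cechOf 𝒰 c j s))
    (x : ⨁ j, F.Cech 𝒰 c j) : P x :=
  DirectSum.induction_on x zero of add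

theorem cellTmul_smul_left (a c : ℕ) (r : K) (η : PolyForm K a) (x : ⨁ j, F.Cech 𝒰 c j) :
    cellTmul 𝒰 a c (r • η) x = r • cellTmul 𝒰 a c η x := by
  induction x using cech_induction with
  | zero => simp
  | add x y hx hy => rw [map_add, map_add, hx, hy, smul_add]
  | of j s => rw [cellTmul_of, cellTmul_of, ← map_smul, TensorProduct.smul_tmul']

theorem cellTmul_add_left (a c : ℕ) (η η' : PolyForm K a) (x : ⨁ j, F.Cech 𝒰 c j) :
    cellTmul 𝒰 a c (η + η') x = cellTmul 𝒰 a c η x + cellTmul 𝒰 a c η' x := by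
  induction x using cech_induction with
  | zero => simp
  | add x y hx hy => rw [map_add, map_add, map_add, hx, hy, add_add_add_comm]
  | of j s => rw [cellTmul_of, cellTmul_of, cellTmul_of, TensorProduct.add_tmul, map_add]

theorem cellD_cellD (a c : ℕ) (x : F.Cell 𝒰 a c) :
    F.cellD 𝒰 a c (F.cellD 𝒰 a c x) = 0 := by
  have hd : ∀ j s, F.cechD 𝒰 c (F.next j) (F.cechD 𝒰 c j s) = 0 := fun j s => by
    ext I
    simp [cechD, F.d_d]
  refine DFunLike.congr_fun (f := F.cellD 𝒰 a c ∘ₗ F.cellD 𝒰 a c) (g := 0)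
    (cell_hom_ext 𝒰 fun j η s => ?_) x
  simp only [LinearMap.comp_apply, cellD_of, map_add, LinearMap.zero_apply, dForm_dForm, dForm_inv,
    hd, TensorProduct.zero_tmul, TensorProduct.tmul_zero, map_zero, zero_add, add_zero]
  rw [← map_add, ← TensorProduct.add_tmul, add_neg_cancel, TensorProduct.zero_tmul, map_zero]

variable (F) in
/-- The projection of cells onto their component of total degree `m`. -/
def cellProj (a c : ℕ) (m : ℤ) : F.Cell 𝒰 a c →ₗ[K] F.Cell 𝒰 a c :=
  DirectSum.lmap fun j =>
    -- Without the test, a negative difference would be truncated to zero and forms of degree zero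
    -- would wrongly be kept.
    (if 0 ≤ m - F.deg j then degProj a (m - F.deg j).toNat else 0).rTensor (F.Cech 𝒰 c j)

theorem cellProj_of (a c : ℕ) (m : ℤ) (j) (η) (s : F.Cech 𝒰 c j) :
    F.cellProj 𝒰 a c m (F.cellOf 𝒰 a c j (η ⊗ₜ s)) =
      F.cellOf 𝒰 a c j
        ((if 0 ≤ m - F.deg j then degProj a (m - F.deg j).toNat else 0) η ⊗ₜ s) := by
  simp [cellProj, DirectSum.lof_eq_of]

theorem cellProj_mem (a c : ℕ) (m : ℤ) (x : F.Cell 𝒰 a c) :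
    F.cellProj 𝒰 a c m x ∈ F.cellHomog 𝒰 a c m := by
  induction x using cell_induction with
  | zero => simp
  | add x y hx hy => rw [map_add]; exact add_mem hx hy
  | of j η s =>
    rw [cellProj_of]
    split_ifs with h
    · exact Submodule.subset_span ⟨_, j, _, s, degProj_mem _ _ _, by
        rw [Int.toNat_of_nonneg h]; ring, rfl⟩
    · simp

theorem cellProj_of_mem {a c : ℕ} {m : ℤ} {x : F.Cell 𝒰 a c} (hx : x ∈ F.cellHomog 𝒰 a c m) :
    F.cellProj 𝒰 a c m x = x := by
  induction hx using homog_induction with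
  | zero => simp
  | add x y _ _ hx hy => rw [map_add, hx, hy]
  | of q j η s hη hq =>
    have h : m - F.deg j = q := by linarith
    rw [cellProj_of, h, if_pos (Int.natCast_nonneg q), Int.toNat_natCast, degProj_of_mem hη]

namespace Hom

variable {s : ℤ} (φ : Hom F G s)

/-- Injectivity on indices prevents several source components from being added up in the same target
component. -/
theorem cellMap_apply (hφ : Function.Injective φ.idx) (a c : ℕ) (x : F.Cell 𝒰 a c) (j : F.J) :
    φ.cellMap 𝒰 a c x (φ.idx j) = (φ.cechMap 𝒰 c j).lTensor (PolyForm K a) (x j) := by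
  induction x using cell_induction with
  | zero => simp
  | add x y hx hy => rw [map_add, DirectSum.add_apply, hx, hy, DirectSum.add_apply, map_add]
  | of k η s =>
    rw [cellMap_of]
    simp only [cellOf, DirectSum.lof_eq_of]
    by_cases h : k = j
    · subst h
      rw [DirectSum.of_eq_same, DirectSum.of_eq_same, LinearMap.lTensor_tmul]
    · rw [DirectSum.of_eq_of_ne _ _ _ fun h' => h (hφ h'.symm),
        DirectSum.of_eq_of_ne _ _ _ fun h' => h h'.symm, map_zero]

theorem exists_cellMap_eq (hφ : Function.Surjective φ.idx) {a c : ℕ} {x : G.Cell 𝒰 a c}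
    (hx : ∀ j, ∃ y, (φ.cechMap 𝒰 c j).lTensor (PolyForm K a) y = x (φ.idx j)) :
    ∃ y, φ.cellMap 𝒰 a c y = x := by
  classical
  rw [← DirectSum.sum_support_of x]
  refine Submodule.sum_mem (LinearMap.range (φ.cellMap 𝒰 a c)) fun k _ => ?_
  obtain ⟨j, rfl⟩ := hφ k
  obtain ⟨y, hy⟩ := hx j
  refine ⟨F.cellOf 𝒰 a c j y, ?_⟩
  rw [← hy, cellMap, cellOf, DirectSum.toModule_lof]
  rfl

theorem cellProj_map (a c : ℕ) (m : ℤ) (x : F.Cell 𝒰 a c) :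
    G.cellProj 𝒰 a c (m + s) (φ.cellMap 𝒰 a c x) = φ.cellMap 𝒰 a c (F.cellProj 𝒰 a c m x) := by
  refine DFunLike.congr_fun (f := G.cellProj 𝒰 a c (m + s) ∘ₗ φ.cellMap 𝒰 a c)
    (g := φ.cellMap 𝒰 a c ∘ₗ F.cellProj 𝒰 a c m) (cell_hom_ext 𝒰 fun j η x => ?_) x
  have h : m + s - G.deg (φ.idx j) = m - F.deg j := by rw [φ.deg_idx]; ring
  simp only [LinearMap.comp_apply, cellMap_of, cellProj_of, h]

theorem cellFace_map (a c : ℕ) (k : Fin (a + 2)) (x : F.Cell 𝒰 (a + 1) c) :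
    G.cellFace 𝒰 a c k (φ.cellMap 𝒰 (a + 1) c x) = φ.cellMap 𝒰 a c (F.cellFace 𝒰 a c k x) := by
  refine DFunLike.congr_fun (f := G.cellFace 𝒰 a c k ∘ₗ φ.cellMap 𝒰 (a + 1) c)
    (g := φ.cellMap 𝒰 a c ∘ₗ F.cellFace 𝒰 a c k) (cell_hom_ext 𝒰 fun j η s => ?_) x
  simp only [LinearMap.comp_apply, cellMap_of, cellFace_of]

theorem cellCoface_map (a c : ℕ) (k : Fin (c + 2)) (x : F.Cell 𝒰 a c) :
    G.cellCoface 𝒰 a c k (φ.cellMap 𝒰 a c x) =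
      φ.cellMap 𝒰 a (c + 1) (F.cellCoface 𝒰 a c k x) := by
  have h : ∀ j x, G.coface 𝒰 c k (φ.idx j) (φ.cechMap 𝒰 c j x) =
      φ.cechMap 𝒰 (c + 1) j (F.coface 𝒰 c k j x) := fun j s => by
    ext I
    simp [coface, cechMap, φ.map_res]
  refine DFunLike.congr_fun (f := G.cellCoface 𝒰 a c k ∘ₗ φ.cellMap 𝒰 a c)
    (g := φ.cellMap 𝒰 a (c + 1) ∘ₗ F.cellCoface 𝒰 a c k) (cell_hom_ext 𝒰 fun j η s => ?_) x
  simp only [LinearMap.comp_apply, cellMap_of, cellCoface_of, h]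

/-- A family of maps commuting with the differentials induces a morphism of complexes on cells. -/
theorem cellD_map (h : ∀ U j (x : F.obj U j), G.secOf U _ (G.d U _ (φ.map U j x)) =
      G.secOf U _ (φ.map U _ (F.d U j x))) (a c : ℕ) (x : F.Cell 𝒰 a c) :
    G.cellD 𝒰 a c (φ.cellMap 𝒰 a c x) = φ.cellMap 𝒰 a c (F.cellD 𝒰 a c x) := by
  have h' : ∀ j x, G.cechOf 𝒰 c _ (G.cechD 𝒰 c _ (φ.cechMap 𝒰 c j x)) =
      G.cechOf 𝒰 c _ (φ.cechMap 𝒰 c _ (F.cechD 𝒰 c j x)) := fun j s => cech_ext 𝒰 fun I => by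
    simp only [cechEval_of]
    exact h _ _ _
  refine DFunLike.congr_fun (f := G.cellD 𝒰 a c ∘ₗ φ.cellMap 𝒰 a c)
    (g := φ.cellMap 𝒰 a c ∘ₗ F.cellD 𝒰 a c) (cell_hom_ext 𝒰 fun j η s => ?_) x
  simp only [LinearMap.comp_apply, cellMap_of, cellD_of, map_add]
  rw [← cellTmul_of _ _ _ (inv K a η), h', cellTmul_of]

end Hom

namespace Pairing

/-- A graded symmetric or skew-symmetric pairing induces such a pairing on cells. -/
theorem cellPair_symm (B : Pairing F F H) (ε : K)
    (h : ∀ U j k (x : F.obj U j) (y : F.obj U k), H.secOf U _ (B.pair U j k x y) =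
      (ε * ksign K (F.deg j * F.deg k)) • H.secOf U _ (B.pair U k j y x))
    {a c : ℕ} {m l : ℤ} {x y : F.Cell 𝒰 a c} (hx : x ∈ F.cellHomog 𝒰 a c m)
    (hy : y ∈ F.cellHomog 𝒰 a c l) :
    B.cellPair 𝒰 a c x y = (ε * ksign K (m * l)) • B.cellPair 𝒰 a c y x := by
  have h' : ∀ j k (x : F.Cech 𝒰 c j) (y : F.Cech 𝒰 c k), H.cechOf 𝒰 c _ (B.cechPair 𝒰 c j k x y) =
      (ε * ksign K (F.deg j * F.deg k)) • H.cechOf 𝒰 c _ (B.cechPair 𝒰 c k j y x) :=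
    fun j k x y => cech_ext 𝒰 fun I => by
      rw [map_smul, cechEval_of, cechEval_of]
      exact h _ _ _ _ _
  induction hx using homog_induction with
  | zero => simp
  | add x x' _ _ hx hx' => rw [map_add, LinearMap.add_apply, hx, hx', map_add, smul_add]
  | of q j η s hη hj =>
    induction hy using homog_induction with
    | zero => simp
    | add x x' _ _ hx hx' => rw [map_add, hx, hx', map_add, LinearMap.add_apply, smul_add]
    | of r k φ t hφ hk =>
      rw [cellPair_of, cellPair_of, ← cellTmul_of, ← cellTmul_of, h', map_smul,
        mul_koszul_swap (F.deg j) (F.deg k) hη hφ, cellTmul_smul_left, smul_smul, hj, hk,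
        ksign_add, mul_assoc ε, ksign_mul_cancel]

theorem cellPair_right (B₁ : Pairing F G' H) (B₂ : Pairing G G G') (a c : ℕ) (i j k) (η φ ψ)
    (x : F.Cech 𝒰 c i) (y : G.Cech 𝒰 c j) (z : G.Cech 𝒰 c k) :
    B₁.cellPair 𝒰 a c (F.cellOf 𝒰 a c i (η ⊗ₜ x))
        (B₂.cellPair 𝒰 a c (G.cellOf 𝒰 a c j (φ ⊗ₜ y)) (G.cellOf 𝒰 a c k (ψ ⊗ₜ z))) =
      cellTmul 𝒰 a c (η * koszul K a (F.deg i) (φ * koszul K a (G.deg j) ψ))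
        (H.cechOf 𝒰 c _ (B₁.cechPair 𝒰 c _ _ x (B₂.cechPair 𝒰 c j k y z))) := by
  rw [cellPair_of, cellPair_of, cellTmul_of]

/-- The product of forms is the same as in `cellPair_right`: when degrees add under `B₃`, the sign
operators compose, and otherwise `B₃` vanishes on these components and nothing is to be shown. Thus
both bracketings differ only in their sections. -/
theorem cellPair_left (B₃ : Pairing F G F') (B₄ : Pairing F' G H) (a c : ℕ) (i j k) (η φ ψ)
    (x : F.Cech 𝒰 c i) (y : G.Cech 𝒰 c j) (z : G.Cech 𝒰 c k) :
    B₄.cellPair 𝒰 a c (B₃.cellPair 𝒰 a c (F.cellOf 𝒰 a c i (η ⊗ₜ x))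
        (G.cellOf 𝒰 a c j (φ ⊗ₜ y))) (G.cellOf 𝒰 a c k (ψ ⊗ₜ z)) =
      cellTmul 𝒰 a c (η * koszul K a (F.deg i) (φ * koszul K a (G.deg j) ψ))
        (H.cechOf 𝒰 c _ (B₄.cechPair 𝒰 c _ _ (B₃.cechPair 𝒰 c i j x y) z)) := by
  rw [cellPair_of, cellPair_of, cellTmul_of]
  rcases B₃.deg_idx i j with h | h
  · rw [h, koszul_mul, koszul_add, mul_assoc]
  · have : B₃.cechPair 𝒰 c i j x y = 0 := by ext I; simp [cechPair, h]
    simp [this]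

set_option maxHeartbeats 2000000 in
/-- A trilinear identity `B₁(x, B₂(y, z)) = B₄(B₃(x, y), z) ± B₄(B₃(x, z), y)` between pairings
carries over to cells. -/
theorem cellPair_trilinear (B₁ : Pairing F G' H) (B₂ : Pairing G G G') (B₃ : Pairing F G F')
    (B₄ : Pairing F' G H) (ε : K)
    (h : ∀ U i j k (x : F.obj U i) (y : G.obj U j) (z : G.obj U k),
      H.secOf U _ (B₁.pair U _ _ x (B₂.pair U _ _ y z)) =
        H.secOf U _ (B₄.pair U _ _ (B₃.pair U _ _ x y) z) +
          (ε * ksign K (G.deg j * G.deg k)) • H.secOf U _ (B₄.pair U _ _ (B₃.pair U _ _ x z) y))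
    {a c : ℕ} {m l : ℤ} (x : F.Cell 𝒰 a c) {y z : G.Cell 𝒰 a c} (hy : y ∈ G.cellHomog 𝒰 a c m)
    (hz : z ∈ G.cellHomog 𝒰 a c l) :
    B₁.cellPair 𝒰 a c x (B₂.cellPair 𝒰 a c y z) =
      B₄.cellPair 𝒰 a c (B₃.cellPair 𝒰 a c x y) z +
        (ε * ksign K (m * l)) • B₄.cellPair 𝒰 a c (B₃.cellPair 𝒰 a c x z) y := by
  have h' : ∀ i j k (x : F.Cech 𝒰 c i) (y : G.Cech 𝒰 c j) (z : G.Cech 𝒰 c k),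
      H.cechOf 𝒰 c _ (B₁.cechPair 𝒰 c _ _ x (B₂.cechPair 𝒰 c _ _ y z)) =
        H.cechOf 𝒰 c _ (B₄.cechPair 𝒰 c _ _ (B₃.cechPair 𝒰 c _ _ x y) z) +
          (ε * ksign K (G.deg j * G.deg k)) •
            H.cechOf 𝒰 c _ (B₄.cechPair 𝒰 c _ _ (B₃.cechPair 𝒰 c _ _ x z) y) :=
    fun i j k x y z => cech_ext 𝒰 fun I => by
      rw [map_add, map_smul, cechEval_of, cechEval_of, cechEval_of]
      exact h _ _ _ _ _ _ _
  induction hy using homog_induction with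
  | zero => simp
  | add y y' _ _ hy hy' =>
    simp only [map_add, LinearMap.add_apply, smul_add, hy, hy']
    rw [add_add_add_comm]
  | of q j φ t hφ hj =>
    induction hz using homog_induction with
    | zero => simp
    | add y y' _ _ hy hy' =>
      simp only [map_add, LinearMap.add_apply, smul_add, hy, hy']
      rw [add_add_add_comm]
    | of r k ψ s hψ hk =>
      induction x using cell_induction with
      | zero => simp
      | add y y' hy hy' =>
        simp only [map_add, LinearMap.add_apply, smul_add, hy, hy']
        rw [add_add_add_comm]
      | of i η x =>
        -- The first two terms carry the same form. In the third, exchanging `φ` and `ψ` turns the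
        -- sign of the section degrees into the sign of the total degrees.
        rw [cellPair_right, cellPair_left, cellPair_left, h', cellTmul_add, cellTmul_smul,
          mul_koszul_swap_left _ (G.deg j) (G.deg k) η hφ hψ,
          cellTmul_smul_left, smul_smul, hj, hk, ksign_add, mul_assoc ε, ksign_mul_cancel]

set_option maxHeartbeats 2000000 in
/-- A pairing of complexes satisfying the Leibniz rule induces such a pairing on cells. -/
theorem cellD_pair (B : Pairing F G H)
    (h : ∀ U j k (x : F.obj U j) (y : G.obj U k), H.secOf U _ (H.d U _ (B.pair U j k x y)) =
      H.secOf U _ (B.pair U _ _ (F.d U j x) y) +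
        ksign K (F.deg j) • H.secOf U _ (B.pair U _ _ x (G.d U k y)))
    {a c : ℕ} {m : ℤ} {x : F.Cell 𝒰 a c} (hx : x ∈ F.cellHomog 𝒰 a c m) (y : G.Cell 𝒰 a c) :
    H.cellD 𝒰 a c (B.cellPair 𝒰 a c x y) =
      B.cellPair 𝒰 a c (F.cellD 𝒰 a c x) y +
        ksign K m • B.cellPair 𝒰 a c x (G.cellD 𝒰 a c y) := by
  have h' : ∀ j k (x : F.Cech 𝒰 c j) (y : G.Cech 𝒰 c k),
      H.cechOf 𝒰 c _ (H.cechD 𝒰 c _ (B.cechPair 𝒰 c j k x y)) =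
        H.cechOf 𝒰 c _ (B.cechPair 𝒰 c _ _ (F.cechD 𝒰 c j x) y) +
          ksign K (F.deg j) • H.cechOf 𝒰 c _ (B.cechPair 𝒰 c _ _ x (G.cechD 𝒰 c k y)) :=
    fun j k x y => cech_ext 𝒰 fun I => by
      rw [map_add, map_smul, cechEval_of, cechEval_of, cechEval_of]
      exact h _ _ _ _ _
  induction hx using homog_induction with
  | zero => simp
  | add y y' _ _ hy hy' =>
    simp only [map_add, LinearMap.add_apply, smul_add, hy, hy']
    rw [add_add_add_comm]
  | of q j η s hη hj =>
    induction y using cell_induction with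
    | zero => simp
    | add y y' hy hy' =>
      simp only [map_add, smul_add, hy, hy']
      rw [add_add_add_comm]
    | of k φ t =>
      -- The section part of the differential raises the degree of `s` by one, so `φ` picks up an
      -- extra involution; together with that on `η` it is the involution of the product. If the
      -- degree does not rise, the differential is zero.
      have hl : B.cellPair 𝒰 a c (F.cellOf 𝒰 a c (F.next j) (inv K a η ⊗ₜ F.cechD 𝒰 c j s))
          (G.cellOf 𝒰 a c k (φ ⊗ₜ t)) =
            cellTmul 𝒰 a c (inv K a (η * koszul K a (F.deg j) φ))
              (H.cechOf 𝒰 c _ (B.cechPair 𝒰 c _ _ (F.cechD 𝒰 c j s) t)) := by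
        rw [cellPair_of, cellTmul_of]
        rcases F.deg_next j with hd | hd
        · have h1 : ∀ x : PolyForm K a, koszul K a 1 x = inv K a x := koszul_odd (by decide)
          rw [hd, add_comm (F.deg j) 1, koszul_add, h1, map_mul]
        · have : F.cechD 𝒰 c j s = 0 := by ext I; simp [cechD, hd]
          simp [this]
      have hc : koszul K a (F.deg j) (inv K a φ) = inv K a (koszul K a (F.deg j) φ) := by
        by_cases h : Even (F.deg j) <;> simp [koszul, h]
      rw [cellPair_of, cellD_of, ← cellTmul_of _ _ _ (inv K a _), h', cellD_of, cellD_of,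
        cellTmul_add, cellTmul_smul]
      simp only [map_add, LinearMap.add_apply]
      rw [hl, cellPair_of, cellPair_of, cellPair_of, ← cellTmul_of, ← cellTmul_of, ← cellTmul_of,
        ← cellTmul_of, dForm_mul, cellTmul_add_left, dForm_koszul, map_mul (inv K a), hc,
        inv_of_mem hη, ← hj, ksign_add]
      simp only [smul_mul_polyForm, mul_smul_polyForm, cellTmul_smul_left]
      module

end Pairing
end DGPresheaf
end

/-! ### Exactness of Ω¹ ⊗ L → Ω¹ ⊗ A → End(Ω¹) over affine opens and on cells -/

noncomputable section

section DualBasis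

variable {K S : Type u} [Field K] [CommRing S] [Algebra K S]

/-- If `Ω[S/K]` is finitely generated and projective, then the map
`Ω ⊗ Der(S) → End(Ω)`, `η ⊗ θ ↦ (ω ↦ ω(θ) η)`, has a left inverse. -/
theorem exists_leftInverse_derivation [Module.Finite S Ω[S⁄K]] [Module.Projective S Ω[S⁄K]] :
    ∃ L : Module.End S Ω[S⁄K] →ₗ[S] Ω[S⁄K] ⊗[S] Derivation K S S,
      ∀ (η : Ω[S⁄K]) (θ : Derivation K S S),
        L (θ.liftKaehlerDifferential.smulRight η) = η ⊗ₜ θ := by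
  obtain ⟨n, f, hf⟩ := Module.Finite.exists_fin' S Ω[S⁄K]
  obtain ⟨g, hg⟩ := Module.projective_lifting_property f LinearMap.id hf
  let e := KaehlerDifferential.linearMapEquivDerivation K S (M := S)
  -- Dual basis: `f` is a surjection from a free module and `g` a section of it. An endomorphism φ
  -- goes to the sum of φ(fᵢ) ⊗ θᵢ, where fᵢ is the image of the i-th basis vector and θᵢ the
  -- derivation of the i-th coordinate of `g`.
  refine ⟨∑ i, (TensorProduct.mk S Ω[S⁄K] (Derivation K S S)).flip (e (LinearMap.proj i ∘ₗ g)) ∘ₗ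
    LinearMap.applyₗ (f (Pi.single i 1)), fun η θ => ?_⟩
  have h : θ = ∑ i, θ.liftKaehlerDifferential (f (Pi.single i 1)) • e (LinearMap.proj i ∘ₗ g) := by
    have h1 : ∀ x, ∑ i, g x i • f (Pi.single i 1) = x := fun x => by
      have h2 := DFunLike.congr_fun hg x
      simp only [LinearMap.comp_apply, LinearMap.id_apply] at h2
      conv_rhs => rw [← h2, pi_eq_sum_univ' (g x), map_sum]
      refine Finset.sum_congr rfl fun i _ => ?_
      rw [map_smul]
    apply e.symm.injective
    refine LinearMap.ext fun ω => ?_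
    rw [map_sum]
    have h3 := congrArg θ.liftKaehlerDifferential (h1 ω)
    rw [map_sum] at h3
    rw [LinearMap.sum_apply]
    refine h3.symm.trans (Finset.sum_congr rfl fun i _ => ?_)
    rw [map_smul, map_smul, LinearEquiv.symm_apply_apply, LinearMap.smul_apply, smul_eq_mul,
      smul_eq_mul, mul_comm]
    rfl
  conv_rhs => rw [h, TensorProduct.tmul_sum]
  rw [LinearMap.sum_apply]
  refine Finset.sum_congr rfl fun i _ => ?_
  simp [TensorProduct.smul_tmul']

end DualBasis

section Affine

variable {K : Type u} [Field K] {X : Scheme.{u}} [X.Over (Spec (.of K))]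

/-- This is how smoothness enters: it makes the module of differentials finite projective, in
particular flat. -/
theorem sections_smooth [Smooth (X ↘ Spec (.of K))] {U : X.Opens} (hU : IsAffineOpen U) :
    Algebra.Smooth K Γ(X, U) := by
  have h1 := Smooth.smooth_appLE (X ↘ Spec (.of K)) (isAffineOpen_top _) hU le_top
  have h2 : ((Scheme.ΓSpecIso (.of K)).inv.hom).Smooth :=
    RingHom.Smooth.of_bijective ((ConcreteCategory.bijective_of_isIso _))
  have h3 := h2.comp h1
  rw [← RingHom.smooth_algebraMap]
  convert! h3 using 1

/-- A derivation of a localisation is determined by its values on numerators: from f s = a follows s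
θ(f) = 0, and s is a unit. -/
theorem eq_zero_of_basicOpen {U : X.Opens} (hU : IsAffineOpen U) (g : Γ(X, U))
    (θ : Derivation K Γ(X, X.basicOpen g) Γ(X, X.basicOpen g))
    (h : ∀ f : Γ(X, U), θ (resRing (X.basicOpen_le g) f) = 0) : θ = 0 := by
  have := hU.isLocalization_basicOpen g
  ext f
  obtain ⟨⟨a, s⟩, hs⟩ := IsLocalization.surj (Submonoid.powers g) f
  have hu := IsLocalization.map_units Γ(X, X.basicOpen g) s
  have h1 := congrArg θ hs
  have h2 : ∀ a, θ (algebraMap Γ(X, U) Γ(X, X.basicOpen g) a) = 0 := h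
  dsimp only at h1
  rw [h2, Derivation.leibniz, h2, smul_zero, zero_add, smul_eq_mul] at h1
  exact (hu.mul_right_eq_zero).1 h1

/-- The kernel of the anchor asks for vanishing on all smaller opens `V`. Such a `V` is covered by
basic opens of `U`, and there `eq_zero_of_basicOpen` applies; the values of the derivation on `V`
vanish because they do locally. -/
theorem DGLieAlgebroid.mem_kerAnchor (𝒜 : DGLieAlgebroid K X) {U : X.Opens} (hU : IsAffineOpen U)
    {p : ℤ} {a : 𝒜.A.obj U p} (ha : 𝒜.anchor U p a = 0) : a ∈ 𝒜.kerAnchor U p := by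
  intro V hV
  ext f
  refine TopCat.Sheaf.eq_of_locally_eq' X.sheaf
    (fun W : {g : Γ(X, U) // X.basicOpen g ≤ V} => X.basicOpen W.1) V (fun W => homOfLE W.2)
    (fun x hx => ?_) _ _ fun W => ?_
  · obtain ⟨g, hg, hxg⟩ := hU.exists_basicOpen_le ⟨x, hx⟩ (hV hx)
    exact TopologicalSpace.Opens.mem_iSup.2 ⟨⟨g, hg⟩, hxg⟩
  · change resRing W.2 _ = resRing W.2 _
    have h : 𝒜.anchor (X.basicOpen W.1) p (𝒜.A.res (X.basicOpen_le W.1) p a) = 0 :=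
      eq_zero_of_basicOpen hU W.1 _ fun f => by rw [𝒜.anchor_res, ha]; simp
    rw [← 𝒜.anchor_res, 𝒜.A.res_res, h]
    simp

theorem isAffineOpen_inter [IsSeparated (X ↘ Spec (.of K))] {ι : Type w} {𝒰 : ι → X.Opens}
    (h𝒰 : ∀ i, IsAffineOpen (𝒰 i)) {n : ℕ} (I : Fin (n + 1) → ι) :
    IsAffineOpen (DGPresheaf.inter 𝒰 I) := by
  -- Separated over an affine base implies separated, so finite nonempty intersections of affine
  -- opens are affine.
  have : X.IsSeparated := ⟨by
    rw [← Limits.terminal.comp_from (X ↘ Spec (.of K))]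
    infer_instance⟩
  exact IsAffineOpen.iInf fun k => h𝒰 (I k)

end Affine

/-- With at most one nonzero summand there is no cancellation. Applied to the anchor, which is
nonzero only in degree zero. -/
theorem apply_eq_zero_of_toModule_eq_zero {K J N : Type*} {M : J → Type*} [DecidableEq J]
    [CommSemiring K] [∀ j, AddCommMonoid (M j)] [∀ j, Module K (M j)] [AddCommMonoid N] [Module K N]
    {f : ∀ j, M j →ₗ[K] N} {j₀ : J} (hf : ∀ j, j ≠ j₀ → f j = 0) {x : ⨁ j, M j}
    (hx : DirectSum.toModule K J N f x = 0) (j : J) : f j (x j) = 0 := by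
  by_cases hj : j = j₀
  · subst hj
    rw [← hx]
    refine (DFunLike.congr_fun (f := DirectSum.toModule K J N f)
      (g := f j ∘ₗ DirectSum.component K J M j) (DirectSum.linearMap_ext K fun k => ?_) x).symm
    ext y
    by_cases h : k = j
    · subst h
      simp
    · rw [LinearMap.comp_apply, DirectSum.toModule_lof, hf k h]
      simp [DirectSum.component.of, h]
  · rw [hf j hj, LinearMap.zero_apply]

namespace DGLieAlgebroid

open DGPresheaf

variable {K : Type u} [Field K] {X : Scheme.{u}} [X.Over (Spec (.of K))]
  (𝒜 : DGLieAlgebroid K X)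

section Local

variable [Smooth (X ↘ Spec (.of K))] {U : X.Opens} (hU : IsAffineOpen U) (p : ℤ)
include hU

theorem lTensor_incl_injective : Function.Injective ((𝒜.incl U p).lTensor Ω[Γ(X, U)⁄K]) := by
  have := sections_smooth (K := K) hU
  exact Module.Flat.lTensor_preserves_injective_linearMap _ (𝒜.incl_injective U p)

/-- Tensoring the kernel sequence of the anchor with the flat module Ω¹ is exact in the middle. By
the left inverse `L`, passing from Ω¹ ⊗ Der to End(Ω¹) does not enlarge the kernel. -/
theorem exact_anchorHom :
    Function.Exact ((𝒜.incl U p).lTensor Ω[Γ(X, U)⁄K]) (𝒜.anchorHom U p) := by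
  have := sections_smooth (K := K) hU
  obtain ⟨L, hL⟩ := exists_leftInverse_derivation (K := K) (S := Γ(X, U))
  have h1 : Function.Exact (𝒜.incl U p) (𝒜.anchor U p) := fun a =>
    ⟨fun ha => ⟨⟨a, 𝒜.mem_kerAnchor hU ha⟩, rfl⟩, by
      rintro ⟨x, rfl⟩
      exact 𝒜.anchor_eq_zero x.2⟩
  have h2 := Module.Flat.lTensor_exact Ω[Γ(X, U)⁄K] h1
  have h3 : ∀ t, L (𝒜.anchorHom U p t) = (𝒜.anchor U p).lTensor Ω[Γ(X, U)⁄K] t := fun t => by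
    induction t using TensorProduct.induction_on with
    | zero => simp
    | add s t hs ht => rw [map_add, map_add, hs, ht, map_add]
    | tmul η a => exact hL η _
  intro t
  refine ⟨fun ht => (h2 t).1 ?_, ?_⟩
  · rw [← h3, ht, map_zero]
  · rintro ⟨s, rfl⟩
    induction s using TensorProduct.induction_on with
    | zero => simp
    | add s t hs ht => rw [map_add, map_add, hs, ht, add_zero]
    | tmul η x =>
      have h4 : 𝒜.anchor U p (𝒜.incl U p x) = 0 := 𝒜.anchor_eq_zero x.2
      change (𝒜.anchor U p (𝒜.incl U p x)).liftKaehlerDifferential.smulRight η = 0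
      rw [h4]
      have h5 : (0 : Derivation K Γ(X, U) Γ(X, U)).liftKaehlerDifferential = 0 :=
        map_zero (KaehlerDifferential.linearMapEquivDerivation K Γ(X, U)).symm
      rw [h5]
      ext
      simp

end Local

variable [Smooth (X ↘ Spec (.of K))] {ι : Type w} {𝒰 : ι → X.Opens}

omit [Smooth (X ↘ Spec (.of K))] in
theorem anchorHom_of_ne_zero (U : X.Opens) {p : ℤ} (hp : p ≠ 0) : 𝒜.anchorHom U p = 0 := by
  refine LinearMap.ext fun t => ?_
  induction t using TensorProduct.induction_on with
  | zero => simp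
  | add s t hs ht => rw [map_add, hs, ht, map_add]
  | tmul η a =>
    change (𝒜.anchor _ p a).liftKaehlerDifferential.smulRight η = 0
    have h : (𝒜.anchor U p a).liftKaehlerDifferential = 0 := by
      rw [𝒜.anchor_of_ne_zero _ p hp]
      exact map_zero (KaehlerDifferential.linearMapEquivDerivation K _).symm
    rw [h]
    ext
    simp

omit [Smooth (X ↘ Spec (.of K))] in
theorem cechAnchor_of_ne_zero (n : ℕ) {p : ℤ} (hp : p ≠ 0) : 𝒜.cechAnchor 𝒰 n p = 0 := by
  refine LinearMap.ext fun s => funext fun I => ?_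
  change 𝒜.anchorHom _ p (s I) = 0
  rw [𝒜.anchorHom_of_ne_zero _ hp, LinearMap.zero_apply]

section Cech

variable (hI : ∀ (c : ℕ) (I : Fin (c + 1) → ι), IsAffineOpen (inter 𝒰 I)) (a c : ℕ)
include hI

theorem cechMap_inclTensor_injective (p : ℤ) :
    Function.Injective (𝒜.inclTensor.cechMap (K := K) 𝒰 c p) := fun _ _ h =>
  funext fun I => 𝒜.lTensor_incl_injective (hI c I) p (congrFun h I)

/-- Products of exact sequences are exact: preimages are chosen separately on each intersection. -/
theorem exact_cechAnchor (p : ℤ) :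
    Function.Exact (𝒜.inclTensor.cechMap (K := K) 𝒰 c p) (𝒜.cechAnchor 𝒰 c p) := by
  intro s
  refine ⟨fun h => ?_, ?_⟩
  · choose t ht using fun I => (𝒜.exact_anchorHom (hI c I) p (s I)).1 (congrFun h I)
    exact ⟨t, funext ht⟩
  · rintro ⟨t, rfl⟩
    exact funext fun I => (𝒜.exact_anchorHom (hI c I) p _).2 ⟨t I, rfl⟩

/-- Tensoring over a field keeps the injectivity on cochains. It provides the uniqueness of lifts,
from which homogeneity, compatibility with faces and closedness of u are deduced. -/
theorem cellMap_inclTensor_injective :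
    Function.Injective (𝒜.inclTensor.cellMap (K := K) 𝒰 a c) := fun y y' h =>
  DFinsupp.ext fun p => by
    have h1 := DFunLike.congr_fun h (𝒜.inclTensor.idx p)
    rw [Hom.cellMap_apply _ _ (fun _ _ h => h), Hom.cellMap_apply _ _ (fun _ _ h => h)] at h1
    exact Module.Flat.lTensor_preserves_injective_linearMap _
      (𝒜.cechMap_inclTensor_injective hI c p) h1

/-- `cellAnchor` adds up all components, but only p = 0 contributes, so its vanishing is vanishing
on each component and exactness can be used there. -/
theorem exists_cellMap_of_cellAnchor_eq_zero {n : ℕ} {x : (omegaTensor (K := K) 𝒜.A).Cell 𝒰 n n}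
    (hx : 𝒜.cellAnchor 𝒰 n x = 0) : ∃ y, 𝒜.inclTensor.cellMap (K := K) 𝒰 n n y = x := by
  refine Hom.exists_cellMap_eq 𝒰 𝒜.inclTensor (fun p => ⟨p, rfl⟩) fun p => ?_
  refine (Module.Flat.lTensor_exact (TWForms.PolyForm K n) (𝒜.exact_cechAnchor hI n p) _).1 ?_
  exact apply_eq_zero_of_toModule_eq_zero (J := ℤ) (j₀ := 0)
    (fun p hp => (congrArg (LinearMap.lTensor _) (𝒜.cechAnchor_of_ne_zero n hp)).trans
      (LinearMap.lTensor_zero _)) hx p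

end Cech
end DGLieAlgebroid
end

/-! ### Lifting elements of the totalisation through the kernel of the anchor -/

noncomputable section

namespace DGLieAlgebroid

open DGPresheaf

variable {K : Type u} [Field K] {X : Scheme.{u}} [X.Over (Spec (.of K))]
  (𝒜 : DGLieAlgebroid K X)

theorem anchorHom_tmul (U : X.Opens) (p : ℤ) (η : Ω[Γ(X, U)⁄K]) (a : 𝒜.A.obj U p) :
    𝒜.anchorHom U p (η ⊗ₜ a) = (𝒜.anchor U p a).liftKaehlerDifferential.smulRight η :=
  rfl

theorem anchorHom_tmul_D (U : X.Opens) (p : ℤ) (η : Ω[Γ(X, U)⁄K]) (a : 𝒜.A.obj U p) (f : Γ(X, U)) :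
    𝒜.anchorHom U p (η ⊗ₜ a) (KaehlerDifferential.D K _ f) = 𝒜.anchor U p a f • η := by
  rw [anchorHom_tmul, LinearMap.smulRight_apply, Derivation.liftKaehlerDifferential_comp_D]

section lift

variable {ι : Type w} (𝒰 : ι → X.Opens)

theorem anchorHom_d (U : X.Opens) (p : ℤ) (t : OmegaTensor K 𝒜.A U p) :
    𝒜.anchorHom U (p + 1) ((omegaTensor (K := K) 𝒜.A).d U p t) = 0 := by
  have h : (0 : Derivation K Γ(X, U) Γ(X, U)).liftKaehlerDifferential = 0 :=
    map_zero (KaehlerDifferential.linearMapEquivDerivation K Γ(X, U)).symm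
  change 𝒜.anchorHom U (p + 1) (-(𝒜.A.d U p).lTensor Ω[Γ(X, U)⁄K] t) = 0
  induction t using TensorProduct.induction_on with
  | zero => simp
  | add s t hs ht => rw [map_add, neg_add, map_add, hs, ht, add_zero]
  | tmul η a =>
    rw [LinearMap.lTensor_tmul, map_neg, anchorHom_tmul, 𝒜.anchor_d, h]
    ext
    simp

theorem cellAnchor_of (n : ℕ) (p) (η) (s : (omegaTensor (K := K) 𝒜.A).Cech 𝒰 n p) :
    𝒜.cellAnchor 𝒰 n ((omegaTensor (K := K) 𝒜.A).cellOf 𝒰 n n p (η ⊗ₜ s)) =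
      η ⊗ₜ 𝒜.cechAnchor 𝒰 n p s := by
  rw [cellAnchor, cellOf, DirectSum.toModule_lof]
  rfl

/-- The anchor is a morphism of complexes to a complex with zero differential, so only the
differential of the form survives. -/
theorem cellAnchor_cellD (n : ℕ) (x : (omegaTensor (K := K) 𝒜.A).Cell 𝒰 n n) :
    𝒜.cellAnchor 𝒰 n ((omegaTensor (K := K) 𝒜.A).cellD 𝒰 n n x) =
      (TWForms.dForm K n).rTensor _ (𝒜.cellAnchor 𝒰 n x) := by
  have h : ∀ p s, 𝒜.cechAnchor 𝒰 n ((omegaTensor (K := K) 𝒜.A).next p)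
      ((omegaTensor (K := K) 𝒜.A).cechD 𝒰 n p s) = 0 := fun p s =>
    funext fun I => 𝒜.anchorHom_d _ p (s I)
  induction x using cell_induction with
  | zero => simp
  | add x y hx hy => simp only [map_add, hx, hy]
  | of p η s =>
    rw [cellD_of, map_add, cellAnchor_of, cellAnchor_of, cellAnchor_of, h,
      TensorProduct.tmul_zero, add_zero, LinearMap.rTensor_tmul]

theorem _root_.TWForms.dForm_one (n : ℕ) : TWForms.dForm K n 1 = 0 := by
  rw [Algebra.TensorProduct.one_def, TWForms.dForm_tmul]
  simp

variable {𝒰}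

theorem exists_tot_lift [Smooth (X ↘ Spec (.of K))]
    (hI : ∀ (c : ℕ) (I : Fin (c + 1) → ι), IsAffineOpen (inter 𝒰 I)) {m : ℤ}
    {x : ∀ n, (omegaTensor (K := K) 𝒜.A).Cell 𝒰 n n} (hx : x ∈ (omegaTensor (K := K) 𝒜.A).Tot 𝒰 m)
    (h : ∀ n, 𝒜.cellAnchor 𝒰 n (x n) = 0) :
    ∃ u : (omegaTensor (K := K) 𝒜.L).Tot 𝒰 m, ∀ n, 𝒜.inclTensor.cellMap 𝒰 n n (u.1 n) = x n := by
  choose y hy using fun n => 𝒜.exists_cellMap_of_cellAnchor_eq_zero hI (h n)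
  refine ⟨⟨y, fun n => ?_, fun n k => ?_⟩, hy⟩
  -- The projection of `y n` to degree `m` is also a lift of `x n`; by uniqueness it equals `y n`,
  -- which is therefore homogeneous.
  · have h1 := 𝒜.inclTensor.cellProj_map 𝒰 n n m (y n)
    rw [hy, add_zero, cellProj_of_mem 𝒰 (hx.1 n), ← hy] at h1
    rw [𝒜.cellMap_inclTensor_injective hI n n h1]
    exact cellProj_mem 𝒰 n n m (y n)
  -- Both sides of the face condition have the same image, by the face condition for `x`.
  · apply 𝒜.cellMap_inclTensor_injective hI n (n + 1)
    rw [← Hom.cellFace_map, ← Hom.cellCoface_map, hy, hy, hx.2 n k]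

end lift

/-! ### Lie algebra identities on sections, in the shape required by the transfer lemmas -/

section Sections

variable (U : X.Opens)

/-- The inclusion of a component in the sum of all components. -/
abbrev secA (p : ℤ) : 𝒜.A.obj U p →ₗ[K] ⨁ p, 𝒜.A.obj U p :=
  DirectSum.lof K ℤ (𝒜.A.obj U) p

/-- The inclusion of a component in the sum of all components. -/
abbrev secL (p : ℤ) : 𝒜.L.obj U p →ₗ[K] ⨁ p, 𝒜.L.obj U p :=
  DirectSum.lof K ℤ (𝒜.L.obj U) p

/-- The inclusion of the sum of all components of the kernel of the anchor. -/
def inclSum : (⨁ p, 𝒜.L.obj U p) →ₗ[K] ⨁ p, 𝒜.A.obj U p :=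
  DirectSum.lmap fun p => (𝒜.incl U p).restrictScalars K

theorem inclSum_secL (p : ℤ) (x : 𝒜.L.obj U p) :
    𝒜.inclSum (K := K) U (𝒜.secL U p x) = 𝒜.secA U p (𝒜.incl U p x) := by
  simp [inclSum, DirectSum.lof_eq_of]

theorem inclSum_injective : Function.Injective (𝒜.inclSum (K := K) U) := fun x y h =>
  DFinsupp.ext fun p => 𝒜.incl_injective U p <| by
    have := DFunLike.congr_fun h p
    rwa [inclSum, DirectSum.lmap_apply, DirectSum.lmap_apply] at this

theorem bracket_symm {p q : ℤ} (a : 𝒜.A.obj U p) (b : 𝒜.A.obj U q) :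
    𝒜.secA (K := K) U (p + q) (𝒜.bracket U p q a b) =
      (-1 * ksign K (p * q)) • 𝒜.secA U (q + p) (𝒜.bracket U q p b a) := by
  have h := (𝒜.isDGLieAlgebra U).bracket_symm p q a b
  rw [negOnePow_smul (K := K)] at h
  rw [neg_one_mul, neg_smul]
  exact h

theorem d_bracket {p q : ℤ} (a : 𝒜.A.obj U p) (b : 𝒜.A.obj U q) :
    𝒜.secA (K := K) U (p + q + 1) (𝒜.A.d U _ (𝒜.bracket U p q a b)) =
      𝒜.secA U (p + 1 + q) (𝒜.bracket U (p + 1) q (𝒜.A.d U _ a) b) +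
        ksign K p • 𝒜.secA U (p + (q + 1)) (𝒜.bracket U p (q + 1) a (𝒜.A.d U _ b)) := by
  have h := (𝒜.isDGLieAlgebra U).d_bracket p q a b
  rw [negOnePow_smul (K := K)] at h
  exact h

/-- In the usual Jacobi identity the term [b, [a, c]] is flipped by skew-symmetry, so that `a` stays
in front. The sign exponent pq + q(p + r) is congruent to qr modulo two. -/
theorem jacobi {p q r : ℤ} (a : 𝒜.A.obj U p) (b : 𝒜.A.obj U q) (c : 𝒜.A.obj U r) :
    𝒜.secA (K := K) U (p + (q + r)) (𝒜.bracket U p (q + r) a (𝒜.bracket U q r b c)) =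
      𝒜.secA U (p + q + r) (𝒜.bracket U (p + q) r (𝒜.bracket U p q a b) c) +
        (-1 * ksign K (q * r)) •
          𝒜.secA U (p + r + q) (𝒜.bracket U (p + r) q (𝒜.bracket U p r a c) b) := by
  have h := (𝒜.isDGLieAlgebra U).jacobi p q r a b c
  rw [negOnePow_smul (K := K)] at h
  have h1 := 𝒜.bracket_symm (K := K) U b (𝒜.bracket U p r a c)
  refine h.trans (congrArg _ ?_)
  refine (congrArg _ h1).trans ?_
  rw [smul_smul, mul_left_comm, ← ksign_add, ksign_congr (q := q * r) ⟨p * q, by ring⟩]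

theorem act_jacobi {p q r : ℤ} (a : 𝒜.A.obj U p) (x : 𝒜.L.obj U q) (y : 𝒜.L.obj U r) :
    𝒜.secL (K := K) U (p + (q + r)) (𝒜.act U p (q + r) (𝒜.act U q r y (𝒜.incl U q x)) a) =
      𝒜.secL U (p + q + r) (𝒜.act U (p + q) r y (𝒜.incl U _ (𝒜.act U p q x a))) +
        (-1 * ksign K (q * r)) •
          𝒜.secL U (p + r + q) (𝒜.act U (p + r) q x (𝒜.incl U _ (𝒜.act U p r y a))) := by
  apply 𝒜.inclSum_injective
  rw [map_add, map_smul, inclSum_secL, inclSum_secL, inclSum_secL]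
  exact 𝒜.jacobi U a _ _

theorem act_symm {p q : ℤ} (x : 𝒜.L.obj U p) (y : 𝒜.L.obj U q) :
    𝒜.secL (K := K) U (p + q) (𝒜.act U p q y (𝒜.incl U p x)) =
      (-1 * ksign K (p * q)) • 𝒜.secL U (q + p) (𝒜.act U q p x (𝒜.incl U q y)) := by
  apply 𝒜.inclSum_injective
  rw [map_smul, inclSum_secL, inclSum_secL]
  exact 𝒜.bracket_symm U _ _

theorem d_act {p q : ℤ} (a : 𝒜.A.obj U p) (x : 𝒜.L.obj U q) :
    𝒜.secL (K := K) U (p + q + 1) (𝒜.L.d U _ (𝒜.act U p q x a)) =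
      𝒜.secL U (p + 1 + q) (𝒜.act U (p + 1) q x (𝒜.A.d U _ a)) +
        ksign K p • 𝒜.secL U (p + (q + 1)) (𝒜.act U p (q + 1) (𝒜.L.d U _ x) a) := by
  apply 𝒜.inclSum_injective
  rw [map_add, map_smul, inclSum_secL, inclSum_secL, inclSum_secL]
  exact 𝒜.d_bracket U _ _

/-- The index of the component `Ω¹ ⊗ E^p`. -/
def _root_.DGPresheaf.omegaIdx (E : DGModPresheaf X) (p : ℤ) : (omegaTensor (K := K) E).J := p

/-- `x ↦ ω ⊗ x`. -/
def omegaTmul (ω : Ω[Γ(X, U)⁄K]) :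
    (⨁ p, 𝒜.L.obj U p) →ₗ[K]
      ⨁ p : (omegaTensor (K := K) 𝒜.L).J, (omegaTensor (K := K) 𝒜.L).obj U p :=
  DirectSum.toModule K ℤ _ fun p : ℤ => (omegaTensor (K := K) 𝒜.L).secOf U (omegaIdx 𝒜.L p) ∘ₗ
    (TensorProduct.mk Γ(X, U) Ω[Γ(X, U)⁄K] (𝒜.L.obj U p) ω).restrictScalars K

theorem omegaTmul_secL (ω : Ω[Γ(X, U)⁄K]) (p : ℤ) (x : 𝒜.L.obj U p) :
    𝒜.omegaTmul (K := K) U ω (𝒜.secL U p x) =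
      (omegaTensor (K := K) 𝒜.L).secOf U (omegaIdx 𝒜.L p) (ω ⊗ₜ x : OmegaTensor K 𝒜.L U p) := by
  rw [omegaTmul, secL, DirectSum.toModule_lof]
  rfl

end Sections

theorem _root_.DGPresheaf.omegaTensor_induction {E : DGModPresheaf X} {U : X.Opens}
    {p : (omegaTensor (K := K) E).J} {P : (omegaTensor (K := K) E).obj U p → Prop} (t : (omegaTensor (K := K) E).obj U p)
    (zero : P 0) (add : ∀ s t, P s → P t → P (s + t))
    (tmul : ∀ ω (a : E.obj U (id p : ℤ)), P (ω ⊗ₜ a : OmegaTensor K E U (id p : ℤ))) : P t :=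
  TensorProduct.induction_on (motive := P) (M := Ω[Γ(X, U)⁄K]) (N := E.obj U (id p : ℤ)) t zero tmul add

/-- The bracket `(Ω¹[-1] ⊗ L) × L → Ω¹[-1] ⊗ L`. -/
def omegaActL : Pairing (omegaTensor (K := K) 𝒜.L) (ofModules 𝒜.L) (omegaTensor 𝒜.L) where
  idx p q := 𝒜.omegaAct.idx (𝒜.inclTensor.idx p) q
  pair U p q := 𝒜.omegaAct.pair U (𝒜.inclTensor.idx p) q ∘ₗ 𝒜.inclTensor.map U p
  deg_idx p q := by
    rcases 𝒜.omegaAct.deg_idx (𝒜.inclTensor.idx p) q with h | h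
    · exact .inl (by rw [h, 𝒜.inclTensor.deg_idx, add_zero])
    · exact .inr fun U => by rw [h, LinearMap.zero_comp]
  pair_res h p q t x := by
    rw [LinearMap.comp_apply, 𝒜.inclTensor.map_res, 𝒜.omegaAct.pair_res]
    rfl

theorem lieBracket_symm (U : X.Opens) (j k) (x : (ofModules (K := K) 𝒜.L).obj U j)
    (y : (ofModules (K := K) 𝒜.L).obj U k) :
    (ofModules (K := K) 𝒜.L).secOf U _ (𝒜.lieBracket.pair U j k x y) =
      (-1 * ksign K ((ofModules (K := K) 𝒜.L).deg j * (ofModules (K := K) 𝒜.L).deg k)) •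
        (ofModules (K := K) 𝒜.L).secOf U _ (𝒜.lieBracket.pair U k j y x) :=
  𝒜.act_symm U x y

theorem lieBracket_jacobi (U : X.Opens) (i j k) (x : (ofModules (K := K) 𝒜.L).obj U i)
    (y : (ofModules (K := K) 𝒜.L).obj U j) (z : (ofModules (K := K) 𝒜.L).obj U k) :
    (ofModules (K := K) 𝒜.L).secOf U _
        (𝒜.lieBracket.pair U _ _ x (𝒜.lieBracket.pair U _ _ y z)) =
      (ofModules (K := K) 𝒜.L).secOf U _
          (𝒜.lieBracket.pair U _ _ (𝒜.lieBracket.pair U _ _ x y) z) +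
        (-1 * ksign K ((ofModules (K := K) 𝒜.L).deg j * (ofModules (K := K) 𝒜.L).deg k)) •
          (ofModules (K := K) 𝒜.L).secOf U _
            (𝒜.lieBracket.pair U _ _ (𝒜.lieBracket.pair U _ _ x z) y) :=
  𝒜.act_jacobi U (𝒜.incl U i x) y z

theorem d_lieBracket (U : X.Opens) (j k) (x : (ofModules (K := K) 𝒜.L).obj U j)
    (y : (ofModules (K := K) 𝒜.L).obj U k) :
    (ofModules (K := K) 𝒜.L).secOf U _
        ((ofModules (K := K) 𝒜.L).d U _ (𝒜.lieBracket.pair U j k x y)) =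
      (ofModules (K := K) 𝒜.L).secOf U _
          (𝒜.lieBracket.pair U _ _ ((ofModules (K := K) 𝒜.L).d U j x) y) +
        ksign K ((ofModules (K := K) 𝒜.L).deg j) • (ofModules (K := K) 𝒜.L).secOf U _
          (𝒜.lieBracket.pair U _ _ x ((ofModules (K := K) 𝒜.L).d U k y)) :=
  𝒜.d_act U (𝒜.incl U j x) y

theorem omegaAct_jacobi (U : X.Opens) (i j k) (t : (omegaTensor (K := K) 𝒜.A).obj U i)
    (y : (ofModules (K := K) 𝒜.L).obj U j) (z : (ofModules (K := K) 𝒜.L).obj U k) :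
    (omegaTensor (K := K) 𝒜.L).secOf U _
        (𝒜.omegaAct.pair U _ _ t (𝒜.lieBracket.pair U _ _ y z)) =
      (omegaTensor (K := K) 𝒜.L).secOf U _
          (𝒜.omegaActL.pair U _ _ (𝒜.omegaAct.pair U _ _ t y) z) +
        (-1 * ksign K ((ofModules (K := K) 𝒜.L).deg j * (ofModules (K := K) 𝒜.L).deg k)) •
          (omegaTensor (K := K) 𝒜.L).secOf U _
            (𝒜.omegaActL.pair U _ _ (𝒜.omegaAct.pair U _ _ t z) y) := by
  induction t using omegaTensor_induction with
  | zero => simp only [map_zero, LinearMap.zero_apply, smul_zero, add_zero]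
  | add s t hs ht =>
    simp only [map_add, LinearMap.add_apply, hs, ht, smul_add]
    rw [add_add_add_comm]
  | tmul ω a =>
    have h := congrArg (𝒜.omegaTmul (K := K) U ω) (𝒜.act_jacobi (K := K) U a y z)
    rw [map_add, map_smul, omegaTmul_secL, omegaTmul_secL, omegaTmul_secL] at h
    exact h

theorem d_omegaAct (U : X.Opens) (j k) (t : (omegaTensor (K := K) 𝒜.A).obj U j)
    (y : (ofModules (K := K) 𝒜.L).obj U k) :
    (omegaTensor (K := K) 𝒜.L).secOf U _
        ((omegaTensor (K := K) 𝒜.L).d U _ (𝒜.omegaAct.pair U j k t y)) =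
      (omegaTensor (K := K) 𝒜.L).secOf U _
          (𝒜.omegaAct.pair U _ _ ((omegaTensor (K := K) 𝒜.A).d U j t) y) +
        ksign K ((omegaTensor (K := K) 𝒜.A).deg j) • (omegaTensor (K := K) 𝒜.L).secOf U _
          (𝒜.omegaAct.pair U _ _ t ((ofModules (K := K) 𝒜.L).d U k y)) := by
  induction t using omegaTensor_induction with
  | zero => simp only [map_zero, LinearMap.zero_apply, smul_zero, add_zero]
  | add s t hs ht =>
    simp only [map_add, LinearMap.add_apply, hs, ht, smul_add]
    rw [add_add_add_comm]
  | tmul ω a =>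
    -- The differential on Ω¹[-1] ⊗ E carries a minus sign, hence the `-ω`. In the last term this
    -- sign combines with that of the degree of `a` into the sign of ω ⊗ a, whose degree is one
    -- higher.
    have h := congrArg (𝒜.omegaTmul (K := K) U (-ω)) (𝒜.d_act (K := K) U a y)
    rw [map_add, map_smul, omegaTmul_secL, omegaTmul_secL, omegaTmul_secL] at h
    refine h.trans (congrArg _ ?_)
    rw [show (omegaTensor (K := K) 𝒜.A).deg j = (id j : ℤ) + 1 from rfl, ksign_add, ksign_one, mul_neg_one, neg_smul, ← smul_neg, TensorProduct.neg_tmul]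
    exact congrArg _ (map_neg ((omegaTensor (K := K) 𝒜.L).secOf U _) _)

end DGLieAlgebroid
end

/-! ### The cyclic form on sections -/

noncomputable section

open DGPresheaf

namespace CyclicForm

variable {K : Type u} [Field K] {X : Scheme.{u}} [X.Over (Spec (.of K))]
  {𝒜 : DGLieAlgebroid K X} (B : CyclicForm 𝒜)

/-- The functional `x ↦ ⟨x, y⟩` on the sum of all components. -/
def formSum (U : X.Opens) {r : ℤ} (y : 𝒜.L.obj U r) : (⨁ p, 𝒜.L.obj U p) →ₗ[K] Γ(X, U) :=
  DirectSum.toModule K ℤ _ fun p => (B.formMap U p r).flip y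

theorem formSum_secL (U : X.Opens) {p r : ℤ} (x : 𝒜.L.obj U p) (y : 𝒜.L.obj U r) :
    B.formSum U y (𝒜.secL U p x) = B.form U p r x y := by
  rw [formSum, DGLieAlgebroid.secL, DirectSum.toModule_lof]
  rfl

theorem form_symm' (U : X.Opens) {p q : ℤ} (x : 𝒜.L.obj U p) (y : 𝒜.L.obj U q) :
    B.form U p q x y = ksign K (p * q) • B.form U q p y x := by
  rw [B.form_symm, negOnePow_smul (K := K)]

/-- Symmetry of the form brings `a` to the front of the second term; again pq + q(p + r) is
congruent to qr modulo two. -/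
theorem cyclic' (U : X.Opens) {p q r : ℤ} (a : 𝒜.A.obj U p) (x : 𝒜.L.obj U q)
    (y : 𝒜.L.obj U r) :
    𝒜.anchor U p a (B.form U q r x y) =
      B.form U (p + q) r (𝒜.act U p q x a) y +
        ksign K (q * r) • B.form U (p + r) q (𝒜.act U p r y a) x := by
  rw [← B.cyclic, negOnePow_smul (K := K), B.form_symm' U x, smul_smul, ← ksign_add,
    ksign_congr (q := q * r) ⟨p * q, by ring⟩]

/-- Cyclicity for a section of L, whose anchor is zero, gives ⟨[y, x], z⟩ + (-1)^{pq} ⟨x, [y, z]⟩ =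
0; skew-symmetry of the bracket does the rest. -/
theorem form_act (U : X.Opens) {p q r : ℤ} (x : 𝒜.L.obj U p) (y : 𝒜.L.obj U q)
    (z : 𝒜.L.obj U r) :
    B.form U p (q + r) x (𝒜.act U q r z (𝒜.incl U q y)) =
      B.form U (p + q) r (𝒜.act U p q y (𝒜.incl U p x)) z := by
  have h1 := B.cyclic U q p r (𝒜.incl U q y) x z
  have h2 := congrArg (B.formSum U z) (𝒜.act_symm (K := K) U x y)
  rw [map_smul, formSum_secL, formSum_secL] at h2
  rw [show 𝒜.anchor U q (𝒜.incl U q y) = 0 from 𝒜.anchor_eq_zero y.2, Derivation.zero_apply,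
    negOnePow_smul (K := K), mul_comm q p] at h1
  rw [h2, ← sub_eq_zero, neg_one_mul, neg_smul, sub_neg_eq_add]
  have h3 := congrArg (ksign K (p * q) • ·) h1
  simp only [smul_add, smul_zero, smul_smul, ksign_mul_self, one_smul] at h3
  rw [add_comm, h3]

theorem pairing₀_symm (U : X.Opens) (j k) (x : (ofModules (K := K) 𝒜.L).obj U j)
    (y : (ofModules (K := K) 𝒜.L).obj U k) :
    (structureSheaf (K := K) (X := X)).secOf U _ (B.pairing₀.pair U j k x y) =
      (1 * ksign K ((ofModules (K := K) 𝒜.L).deg j * (ofModules (K := K) 𝒜.L).deg k)) •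
        (structureSheaf (K := K) (X := X)).secOf U _ (B.pairing₀.pair U k j y x) := by
  rw [one_mul, ← map_smul]
  exact congrArg _ (B.form_symm' U x y)

theorem pairing₀_assoc (U : X.Opens) (i j k) (x : (ofModules (K := K) 𝒜.L).obj U i)
    (y : (ofModules (K := K) 𝒜.L).obj U j) (z : (ofModules (K := K) 𝒜.L).obj U k) :
    (structureSheaf (K := K) (X := X)).secOf U _
        (B.pairing₀.pair U _ _ x (𝒜.lieBracket.pair U _ _ y z)) =
      (structureSheaf (K := K) (X := X)).secOf U _
          (B.pairing₀.pair U _ _ (𝒜.lieBracket.pair U _ _ x y) z) +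
        (0 * ksign K ((ofModules (K := K) 𝒜.L).deg j * (ofModules (K := K) 𝒜.L).deg k)) •
          (structureSheaf (K := K) (X := X)).secOf U _
            (B.pairing₀.pair U _ _ (𝒜.lieBracket.pair U _ _ x z) y) := by
  rw [zero_mul, zero_smul, add_zero]
  exact congrArg _ (B.form_act U x y z)

theorem pairing₁_assoc (U : X.Opens) (i j k) (t : (omegaTensor (K := K) 𝒜.L).obj U i)
    (y : (ofModules (K := K) 𝒜.L).obj U j) (z : (ofModules (K := K) 𝒜.L).obj U k) :
    (omegaOne (K := K) (X := X)).secOf U _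
        (B.pairing₁.pair U _ _ t (𝒜.lieBracket.pair U _ _ y z)) =
      (omegaOne (K := K) (X := X)).secOf U _
          (B.pairing₁.pair U _ _ (𝒜.omegaActL.pair U _ _ t y) z) +
        (0 * ksign K ((ofModules (K := K) 𝒜.L).deg j * (ofModules (K := K) 𝒜.L).deg k)) •
          (omegaOne (K := K) (X := X)).secOf U _
            (B.pairing₁.pair U _ _ (𝒜.omegaActL.pair U _ _ t z) y) := by
  rw [zero_mul, zero_smul, add_zero]
  induction t using omegaTensor_induction with
  | zero => simp only [map_zero, LinearMap.zero_apply]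
  | add s t hs ht => simp only [map_add, LinearMap.add_apply, hs, ht]
  | tmul ω x =>
    refine congrArg ((omegaOne (K := K) (X := X)).secOf U _) ?_
    refine (B.omegaFormAux_tmul U _ _ ω x _).trans (Eq.trans ?_
      (B.omegaFormAux_tmul U _ _ ω _ z).symm)
    exact congrArg (· • ω) (B.form_act U x y z)

end CyclicForm

/-! ### The de Rham differential as the action of a simplicial lifting -/

namespace DGLieAlgebroid

variable {K : Type u} [Field K] {X : Scheme.{u}} [X.Over (Spec (.of K))]
  (𝒜 : DGLieAlgebroid K X)

/-- The map `(η ⊗ a, f) ↦ a(f) η`. -/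
def omegaDerMap (U : X.Opens) (p : ℤ) :
    OmegaTensor K 𝒜.A U p →ₗ[K] Γ(X, U) →ₗ[K] Ω[Γ(X, U)⁄K] :=
  LinearMap.mk₂ K (fun t f => 𝒜.anchorHom U p t (KaehlerDifferential.D K _ f))
    (fun _ _ _ => by rw [map_add, LinearMap.add_apply])
    (fun c t f => congrArg (fun e => e (KaehlerDifferential.D K _ f))
      (((𝒜.anchorHom U p).restrictScalars K).map_smul c t))
    (fun _ _ _ => by rw [map_add, map_add])
    (fun c t f => by
      rw [(KaehlerDifferential.D K _).map_smul]
      exact ((𝒜.anchorHom U p t).restrictScalars K).map_smul c _)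

theorem omegaDerMap_res {U V : X.Opens} (h : V ≤ U) (p : ℤ) (t : OmegaTensor K 𝒜.A U p)
    (f : Γ(X, U)) : 𝒜.omegaDerMap V p (tensorRes 𝒜.A h p t) (resAlg K h f) =
      kaehlerMap (resAlg K h) (𝒜.omegaDerMap U p t f) := by
  induction t using TensorProduct.induction_on with
  | zero => simp only [map_zero, LinearMap.zero_apply]
  | add s t hs ht => simp only [map_add, LinearMap.add_apply, hs, ht]
  | tmul η a =>
    rw [tensorRes_tmul]
    refine (𝒜.anchorHom_tmul_D V p _ _ _).trans (Eq.trans ?_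
      (congrArg (kaehlerMap (resAlg K h)) (𝒜.anchorHom_tmul_D U p η a f)).symm)
    rw [kaehlerMap_smul]
    exact congrArg (· • _) (𝒜.anchor_res h p a f)

/-- The derivation `Ω¹[-1] ⊗ A → Der(𝒪, Ω¹)[-1]` as a pairing. -/
def omegaDer : Pairing (omegaTensor (K := K) 𝒜.A) structureSheaf omegaOne where
  idx _ _ := ()
  pair U (p : ℤ) _ := 𝒜.omegaDerMap U p
  deg_idx (p : ℤ) _ := by
    by_cases h : p = 0
    · refine .inl ?_
      change (1 : ℤ) = p + 1 + 0
      linarith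
    · refine .inr fun U => LinearMap.ext fun t => LinearMap.ext fun f => ?_
      change 𝒜.anchorHom U p t _ = 0
      rw [𝒜.anchorHom_of_ne_zero U h]
      rfl
  pair_res h (p : ℤ) _ t f := 𝒜.omegaDerMap_res h p t f

theorem omegaDerMap_tmul_form (B : CyclicForm 𝒜) (U : X.Opens) (p q r : ℤ)
    (ω : Ω[Γ(X, U)⁄K]) (a : 𝒜.A.obj U p) (y : 𝒜.L.obj U q) (z : 𝒜.L.obj U r) :
    𝒜.omegaDerMap U p (ω ⊗ₜ a) (B.form U q r y z) =
      B.omegaFormMap U (p + q) r (𝒜.omegaActMap U p q (ω ⊗ₜ a) y) z +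
        ksign K (q * r) • B.omegaFormMap U (p + r) q (𝒜.omegaActMap U p r (ω ⊗ₜ a) z) y := by
  refine (𝒜.anchorHom_tmul_D U p ω a _).trans ?_
  refine Eq.trans ?_ (congrArg₂ (· + ksign K _ • ·) (B.omegaFormAux_tmul U _ _ ω _ z)
    (B.omegaFormAux_tmul U _ _ ω _ y)).symm
  rw [B.cyclic' U a y z, add_smul, smul_assoc]

/-- The cyclic identity tensored with a one-form. Applied to D, it becomes the formula for the de
Rham differential of ⟨y, z⟩. -/
theorem omegaDer_pairing₀ (B : CyclicForm 𝒜) (U : X.Opens) (i j k)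
    (t : (omegaTensor (K := K) 𝒜.A).obj U i)
    (y : (ofModules (K := K) 𝒜.L).obj U j) (z : (ofModules (K := K) 𝒜.L).obj U k) :
    (omegaOne (K := K) (X := X)).secOf U _
        (𝒜.omegaDer.pair U _ _ t (B.pairing₀.pair U _ _ y z)) =
      (omegaOne (K := K) (X := X)).secOf U _
          (B.pairing₁.pair U _ _ (𝒜.omegaAct.pair U _ _ t y) z) +
        (1 * ksign K ((ofModules (K := K) 𝒜.L).deg j * (ofModules (K := K) 𝒜.L).deg k)) •
          (omegaOne (K := K) (X := X)).secOf U _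
            (B.pairing₁.pair U _ _ (𝒜.omegaAct.pair U _ _ t z) y) := by
  rw [one_mul]
  induction t using omegaTensor_induction with
  | zero => simp only [map_zero, LinearMap.zero_apply, smul_zero, add_zero]
  | add s t hs ht =>
    simp only [map_add, LinearMap.add_apply, hs, ht, smul_add]
    rw [add_add_add_comm]
  | tmul ω a =>
    let e : Ω[Γ(X, U)⁄K] →ₗ[K] ⨁ j, (omegaOne (K := K) (X := X)).obj U j :=
      (omegaOne (K := K) (X := X)).secOf U ()
    exact (congrArg e (𝒜.omegaDerMap_tmul_form B U _ _ _ ω a y z)).trans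
      ((e.map_add _ _).trans (congrArg (e _ + ·) (e.map_smul _ _)))

section Cells

variable {ι : Type w} (𝒰 : ι → X.Opens)

/-- The evaluation of endomorphisms on the differentials of functions. -/
def evalD (n : ℕ) (f : ∀ I : Fin (n + 1) → ι, Γ(X, inter 𝒰 I)) :
    (∀ I : Fin (n + 1) → ι, Module.End Γ(X, inter 𝒰 I) Ω[Γ(X, inter 𝒰 I)⁄K]) →ₗ[K]
      ∀ I : Fin (n + 1) → ι, Ω[Γ(X, inter 𝒰 I)⁄K] :=
  LinearMap.pi fun I => ((LinearMap.applyₗ (R := Γ(X, inter 𝒰 I))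
    (KaehlerDifferential.D K Γ(X, inter 𝒰 I) (f I))).restrictScalars K) ∘ₗ LinearMap.proj I

/-- The inclusion of the only component. -/
def omegaCell (n : ℕ) :
    (TWForms.PolyForm K n ⊗[K] ∀ I : Fin (n + 1) → ι, Ω[Γ(X, inter 𝒰 I)⁄K]) →ₗ[K]
      (omegaOne (K := K) (X := X)).Cell 𝒰 n n :=
  (omegaOne (K := K) (X := X)).cellOf 𝒰 n n ()

/-- The action on functions depends on `x` only through its image under the anchor, which is all
that is prescribed about a simplicial lifting. -/
theorem omegaDer_cellPair_of (n : ℕ) (x : (omegaTensor (K := K) 𝒜.A).Cell 𝒰 n n) (j) (φ)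
    (f : (structureSheaf (K := K) (X := X)).Cech 𝒰 n j) :
    𝒜.omegaDer.cellPair 𝒰 n n x ((structureSheaf (K := K) (X := X)).cellOf 𝒰 n n j (φ ⊗ₜ f)) =
      omegaCell 𝒰 n (TensorProduct.map (LinearMap.mulRight K (TWForms.inv K n φ)) (evalD 𝒰 n f)
        (𝒜.cellAnchor 𝒰 n x)) := by
  induction x using cell_induction with
  | zero => simp only [map_zero, LinearMap.zero_apply]
  | add x y hx hy => simp only [map_add, LinearMap.add_apply, hx, hy]
  | of p η s =>
    rw [Pairing.cellPair_of, cellAnchor_of, TensorProduct.map_tmul]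
    -- For p = 0 the sections of Ω¹ ⊗ A⁰ have degree one, so the Koszul operator is the involution.
    -- For other p the anchor vanishes and both sides are zero.
    by_cases hp : (id p : ℤ) = 0
    · have h1 : ∀ x, TWForms.koszul K n ((omegaTensor (K := K) 𝒜.A).deg p) x =
          TWForms.inv K n x := TWForms.koszul_odd (by
            change ¬ Even ((id p : ℤ) + 1)
            rw [hp]; decide)
      rw [h1]
      rfl
    · have h1 : 𝒜.cechAnchor 𝒰 n p s = 0 := congrArg (fun g => g s) (𝒜.cechAnchor_of_ne_zero n hp)
      have h2 : 𝒜.omegaDer.cechPair 𝒰 n p j s f = 0 := funext fun I => by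
        change 𝒜.anchorHom (inter 𝒰 I) p (s I) _ = 0
        exact congrArg (fun g => g (s I) (KaehlerDifferential.D K Γ(X, inter 𝒰 I) (f I)))
          (𝒜.anchorHom_of_ne_zero (inter 𝒰 I) hp)
      rw [h1, h2, map_zero, TensorProduct.tmul_zero, TensorProduct.tmul_zero]
      exact (map_zero _).trans (map_zero _).symm

/-- The de Rham differential on the totalisation of `𝒪 → Ω¹`, in terms of a simplicial lifting of
the identity. -/
theorem cellD_inclDeRham₀ {n : ℕ} {D : (omegaTensor (K := K) 𝒜.A).Cell 𝒰 n n}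
    (hD : 𝒜.cellAnchor 𝒰 n D = 1 ⊗ₜ fun _ => LinearMap.id)
    (g : (structureSheaf (K := K) (X := X)).Cell 𝒰 n n) :
    truncDeRham.cellD 𝒰 n n (inclDeRham₀.cellMap 𝒰 n n g) =
      inclDeRham₀.cellMap 𝒰 n n (structureSheaf.cellD 𝒰 n n g) +
        inclDeRham₁.cellMap 𝒰 n n (𝒜.omegaDer.cellPair 𝒰 n n D g) := by
  induction g using cell_induction with
  | zero => simp only [map_zero, add_zero]
  | add x y hx hy => simp only [map_add, hx, hy]; rw [add_add_add_comm]
  | of j φ f =>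
    rw [Hom.cellMap_of, cellD_of, cellD_of, map_add, Hom.cellMap_of, Hom.cellMap_of,
      show (structureSheaf (K := K) (X := X)).cechD 𝒰 n j f = 0 from rfl, map_zero (Hom.cechMap ..),
      TensorProduct.tmul_zero, map_zero, add_zero]
    refine congrArg _ ?_
    -- With 1 ⊗ Id in place of D, the action gives the involution of `φ` tensored with df, which is
    -- the de Rham term in the differential of φ ⊗ f.
    rw [omegaDer_cellPair_of, hD, TensorProduct.map_tmul, LinearMap.mulRight_apply, one_mul]
    exact (Hom.cellMap_of 𝒰 inclDeRham₁ n n () _ _).symm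

theorem cellD_inclDeRham₁ (a c : ℕ) (x : (omegaOne (K := K) (X := X)).Cell 𝒰 a c) :
    truncDeRham.cellD 𝒰 a c (inclDeRham₁.cellMap 𝒰 a c x) =
      inclDeRham₁.cellMap 𝒰 a c (omegaOne.cellD 𝒰 a c x) :=
  Hom.cellD_map 𝒰 _ (fun _ _ _ => rfl) a c x

theorem d_inclTensor (U : X.Opens) (j) (t : (omegaTensor (K := K) 𝒜.L).obj U j) :
    (omegaTensor (K := K) 𝒜.A).secOf U _
        ((omegaTensor (K := K) 𝒜.A).d U _ (𝒜.inclTensor.map U j t)) =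
      (omegaTensor (K := K) 𝒜.A).secOf U _
        (𝒜.inclTensor.map U _ ((omegaTensor (K := K) 𝒜.L).d U j t)) := by
  induction t using omegaTensor_induction with
  | zero => simp only [map_zero]
  | add s t hs ht => simp only [map_add, hs, ht]
  | tmul ω x =>
    refine congrArg ((omegaTensor (K := K) 𝒜.A).secOf U _) ?_
    exact (map_neg ((𝒜.incl U ((id j : ℤ) + 1)).lTensor Ω[Γ(X, U)⁄K])
      (ω ⊗ₜ 𝒜.L.d U (id j) x)).symm

theorem cellD_inclTensor (a c : ℕ) (x : (omegaTensor (K := K) 𝒜.L).Cell 𝒰 a c) :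
    (omegaTensor (K := K) 𝒜.A).cellD 𝒰 a c (𝒜.inclTensor.cellMap 𝒰 a c x) =
      𝒜.inclTensor.cellMap 𝒰 a c ((omegaTensor (K := K) 𝒜.L).cellD 𝒰 a c x) :=
  Hom.cellD_map 𝒰 _ 𝒜.d_inclTensor a c x

/-- Used to read [dD, x] as [u, x], where invariance of the form is available. -/
theorem omegaAct_cellMap (a c : ℕ) (t : (omegaTensor (K := K) 𝒜.L).Cell 𝒰 a c)
    (x : (ofModules (K := K) 𝒜.L).Cell 𝒰 a c) :
    𝒜.omegaAct.cellPair 𝒰 a c (𝒜.inclTensor.cellMap 𝒰 a c t) x =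
      𝒜.omegaActL.cellPair 𝒰 a c t x := by
  induction t using cell_induction with
  | zero => simp only [map_zero, LinearMap.zero_apply]
  | add s t hs ht => simp only [map_add, LinearMap.add_apply, hs, ht]
  | of p η s =>
    induction x using cell_induction with
    | zero => simp only [map_zero]
    | add s t hs ht => simp only [map_add, hs, ht]
    | of q φ x =>
      rw [Hom.cellMap_of, Pairing.cellPair_of, Pairing.cellPair_of]
      rfl

end Cells

end DGLieAlgebroid
end

/-! ### Explicit sums over shuffles in arities two, three and four -/

section Shuffles

open Equiv

variable {K : Type*} [Field K] {A : Type*} [AddCommGroup A] [Module K A]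

theorem units_smul (ε : ℤˣ) (x : A) : ε • x = (((ε : ℤˣ) : ℤ) : K) • x := by
  rw [Units.smul_def, Int.cast_smul_eq_zsmul]

variable (K) in
/-- The antisymmetric Koszul sign as an element of the base field. -/
def koszulScalar {n : ℕ} (σ : Perm (Fin n)) (p : Fin n → ℤ) : K :=
  ((koszulSign σ p : ℤ) : K)

/-- The Koszul sign as a product over inversions inside `K`, so that shuffle sums become linear
combinations with scalar coefficients. -/
theorem koszulScalar_eq {n : ℕ} (σ : Perm (Fin n)) (p : Fin n → ℤ) :
    koszulScalar K σ p =
      ∏ i, ∏ j, if i < j ∧ σ j < σ i then -ksign K (p (σ i) * p (σ j)) else 1 := by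
  simp only [koszulScalar, koszulSign, Units.coe_prod, Int.cast_prod, ksign]
  refine Finset.prod_congr rfl fun i _ => Finset.prod_congr rfl fun j _ => ?_
  split_ifs <;> simp

theorem koszulScalar_fin_two {σ : Perm (Fin 2)} (p : Fin 2 → ℤ) :
    koszulScalar K σ p = if σ 1 < σ 0 then -ksign K (p (σ 0) * p (σ 1)) else 1 := by
  simp [koszulScalar_eq, Fin.prod_univ_succ]

theorem koszulScalar_fin_three {σ : Perm (Fin 3)} (p : Fin 3 → ℤ) :
    koszulScalar K σ p = (if σ 1 < σ 0 then -ksign K (p (σ 0) * p (σ 1)) else 1) *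
      (if σ 2 < σ 0 then -ksign K (p (σ 0) * p (σ 2)) else 1) *
      (if σ 2 < σ 1 then -ksign K (p (σ 1) * p (σ 2)) else 1) := by
  simp [koszulScalar_eq, Fin.prod_univ_succ]

theorem koszulScalar_fin_four {σ : Perm (Fin 4)} (p : Fin 4 → ℤ) :
    koszulScalar K σ p = (if σ 1 < σ 0 then -ksign K (p (σ 0) * p (σ 1)) else 1) *
      (if σ 2 < σ 0 then -ksign K (p (σ 0) * p (σ 2)) else 1) *
      (if σ 3 < σ 0 then -ksign K (p (σ 0) * p (σ 3)) else 1) *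
      (if σ 2 < σ 1 then -ksign K (p (σ 1) * p (σ 2)) else 1) *
      (if σ 3 < σ 1 then -ksign K (p (σ 1) * p (σ 3)) else 1) *
      (if σ 3 < σ 2 then -ksign K (p (σ 2) * p (σ 3)) else 1) := by
  simp [koszulScalar_eq, Fin.prod_univ_succ, mul_assoc]

theorem sum_shuffles_one_two (p : Fin 2 → ℤ) (F : Fin 2 → Fin 2 → A) :
    ∑ σ ∈ shuffles 1 2, koszulScalar K σ p • F (σ 0) (σ 1) =
      F 0 1 - ksign K (p 0 * p 1) • F 1 0 := by
  have h : shuffles 1 2 = {1, swap 0 1} := by decide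
  rw [h, Finset.sum_insert (by decide), Finset.sum_singleton]
  simp [koszulScalar_fin_two, mul_comm, sub_eq_add_neg]

theorem sum_shuffles_two_two (p : Fin 2 → ℤ) (F : Fin 2 → Fin 2 → A) :
    ∑ σ ∈ shuffles 2 2, koszulScalar K σ p • F (σ 0) (σ 1) = F 0 1 := by
  have h : shuffles 2 2 = {1} := by decide
  rw [h, Finset.sum_singleton]
  simp [koszulScalar_fin_two]

theorem sum_shuffles_one_three (p : Fin 3 → ℤ) (F : Fin 3 → Fin 3 → Fin 3 → A) :
    ∑ σ ∈ shuffles 1 3, koszulScalar K σ p • F (σ 0) (σ 1) (σ 2) =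
      F 0 1 2 - ksign K (p 0 * p 1) • F 1 0 2 +
        (ksign K (p 0 * p 2) * ksign K (p 1 * p 2)) • F 2 0 1 := by
  have h : shuffles 1 3 = {1, swap 0 1, swap 0 1 * swap 0 2} := by decide
  have h0 : (swap (0 : Fin 3) 1 * swap 0 2 : Perm (Fin 3)) 0 = 2 := by decide
  have h1 : (swap (0 : Fin 3) 1 * swap 0 2 : Perm (Fin 3)) 1 = 0 := by decide
  have h2 : (swap (0 : Fin 3) 1 * swap 0 2 : Perm (Fin 3)) 2 = 1 := by decide
  have h3 : swap (0 : Fin 3) 1 2 = 2 := by decide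
  rw [h, Finset.sum_insert (by decide), Finset.sum_insert (by decide), Finset.sum_singleton,
    koszulScalar_fin_three, koszulScalar_fin_three, koszulScalar_fin_three, h0, h1, h2]
  simp [h3, mul_comm, sub_eq_add_neg, add_assoc]

theorem sum_shuffles_two_three (p : Fin 3 → ℤ) (F : Fin 3 → Fin 3 → Fin 3 → A) :
    ∑ σ ∈ shuffles 2 3, koszulScalar K σ p • F (σ 0) (σ 1) (σ 2) =
      F 0 1 2 - ksign K (p 1 * p 2) • F 0 2 1 +
        (ksign K (p 0 * p 1) * ksign K (p 0 * p 2)) • F 1 2 0 := by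
  have h : shuffles 2 3 = {1, swap 1 2, swap 0 1 * swap 1 2} := by decide
  have h0 : (swap (0 : Fin 3) 1 * swap 1 2 : Perm (Fin 3)) 0 = 1 := by decide
  have h1 : (swap (0 : Fin 3) 1 * swap 1 2 : Perm (Fin 3)) 1 = 2 := by decide
  have h2 : (swap (0 : Fin 3) 1 * swap 1 2 : Perm (Fin 3)) 2 = 0 := by decide
  have h3 : swap (1 : Fin 3) 2 0 = 0 := by decide
  rw [h, Finset.sum_insert (by decide), Finset.sum_insert (by decide), Finset.sum_singleton,
    koszulScalar_fin_three, koszulScalar_fin_three, koszulScalar_fin_three, h0, h1, h2]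
  simp [h3, mul_comm, sub_eq_add_neg, add_assoc]

theorem sum_shuffles_two_four (p : Fin 4 → ℤ) (F : Fin 4 → Fin 4 → Fin 4 → Fin 4 → A) :
    ∑ σ ∈ shuffles 2 4, koszulScalar K σ p • F (σ 0) (σ 1) (σ 2) (σ 3) =
      F 0 1 2 3 - ksign K (p 1 * p 2) • F 0 2 1 3 +
        (ksign K (p 1 * p 3) * ksign K (p 2 * p 3)) • F 0 3 1 2 +
        (ksign K (p 0 * p 1) * ksign K (p 0 * p 2)) • F 1 2 0 3 -
        (ksign K (p 0 * p 1) * ksign K (p 0 * p 3) * ksign K (p 2 * p 3)) • F 1 3 0 2 +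
        (ksign K (p 0 * p 2) * ksign K (p 0 * p 3) * ksign K (p 1 * p 2) * ksign K (p 1 * p 3)) •
          F 2 3 0 1 := by
  -- One shuffle for each pair of positions fed to the bracket: 01, 02, 03, 12, 13, 23, in this
  -- order. Their values are tabulated below.
  have h : shuffles 2 4 = {1, swap 1 2, swap 1 2 * swap 1 3, swap 0 1 * swap 1 2,
    swap 0 1 * (swap 1 3 * swap 2 3), swap 0 2 * swap 1 3} := by decide
  have e2 (i) : (swap (1 : Fin 4) 2 * swap 1 3 : Perm (Fin 4)) i = ![0, 3, 1, 2] i := by revert i; decide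
  have e3 (i) : (swap (0 : Fin 4) 1 * swap 1 2 : Perm (Fin 4)) i = ![1, 2, 0, 3] i := by revert i; decide
  have e4 (i) : (swap (0 : Fin 4) 1 * (swap 1 3 * swap 2 3) : Perm (Fin 4)) i = ![1, 3, 0, 2] i := by
    revert i; decide
  have e5 (i) : (swap (0 : Fin 4) 2 * swap 1 3 : Perm (Fin 4)) i = ![2, 3, 0, 1] i := by revert i; decide
  have e1 (i) : (swap (1 : Fin 4) 2 : Perm (Fin 4)) i = ![0, 2, 1, 3] i := by revert i; decide
  rw [h, Finset.sum_insert (by decide), Finset.sum_insert (by decide),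
    Finset.sum_insert (by decide), Finset.sum_insert (by decide), Finset.sum_insert (by decide),
    Finset.sum_singleton]
  simp only [koszulScalar_fin_four, e1, e2, e3, e4, e5]
  simp [mul_comm (p 3), mul_comm (p 2) (p 0), mul_comm (p 2) (p 1), mul_comm (p 1) (p 0)]
  module

end Shuffles

/-- Splitting on parities with this turns any identity with Koszul signs into finitely many
identities with coefficients ±1, which linear algebra decides. -/
theorem ksign_cases {K : Type*} [Field K] (p : ℤ) :
    (ksign K p = 1 ∧ ∀ q, ksign K (p * q) = 1) ∨
      (ksign K p = -1 ∧ ∀ q, ksign K (p * q) = ksign K q) := by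
  rcases Int.even_or_odd p with h | h
  · refine .inl ⟨?_, fun q => ?_⟩
    · rw [ksign_congr (q := 0) (by simpa using h), ksign_zero]
    · rw [ksign_congr (q := 0) (by simpa using h.mul_right q), ksign_zero]
  · obtain ⟨k, rfl⟩ := h
    refine .inr ⟨?_, fun q => ksign_congr ⟨k * q, by ring⟩⟩
    rw [ksign_congr (q := 1) ⟨k, by ring⟩, ksign_one]

/-! ### The formal argument: DG-Lie algebras and Chern-Simons data -/

noncomputable section

namespace DGLieData

variable {K : Type u} [Field K] {V : DGLieData.{u, v} K}
  {N : Type*} [AddCommGroup N] [Module K N]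

/-- The bilinear map on the total space with given components. -/
def bilin (F : ∀ p q, V.obj p →ₗ[K] V.obj q →ₗ[K] N) : V.Total →ₗ[K] V.Total →ₗ[K] N :=
  DirectSum.toModule K ℤ (V.Total →ₗ[K] N) fun p =>
    (DirectSum.toModule K ℤ (V.obj p →ₗ[K] N) fun q => (F p q).flip).flip

theorem bilin_inj (F : ∀ p q, V.obj p →ₗ[K] V.obj q →ₗ[K] N) {p q : ℤ} (x : V.obj p)
    (y : V.obj q) : bilin F (V.inj p x) (V.inj q y) = F p q x y := by
  simp [bilin, inj]

theorem totalD_inj {p : ℤ} (x : V.obj p) : V.totalD (V.inj p x) = V.inj (p + 1) (V.d p x) := by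
  simp [totalD, inj]

theorem totalBracket_inj {p q : ℤ} (x : V.obj p) (y : V.obj q) :
    V.totalBracket (V.inj p x) (V.inj q y) = V.inj (p + q) (V.bracket p q x y) := by
  simp [totalBracket, inj]

variable (V) in
/-- The homogeneous elements of degree `p`. -/
abbrev homog (p : ℤ) : Submodule K V.Total := LinearMap.range (V.inj p)

theorem inj_mem {p : ℤ} (x : V.obj p) : V.inj p x ∈ V.homog p := ⟨x, rfl⟩

theorem totalD_mem {p : ℤ} {x : V.Total} (hx : x ∈ V.homog p) : V.totalD x ∈ V.homog (p + 1) := by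
  obtain ⟨x, rfl⟩ := hx
  rw [totalD_inj]
  exact inj_mem _

theorem totalBracket_mem {p q : ℤ} {x y : V.Total} (hx : x ∈ V.homog p) (hy : y ∈ V.homog q) :
    V.totalBracket x y ∈ V.homog (p + q) := by
  obtain ⟨x, rfl⟩ := hx
  obtain ⟨y, rfl⟩ := hy
  rw [totalBracket_inj]
  exact inj_mem _

namespace IsDGLieAlgebra

variable (hV : V.IsDGLieAlgebra)
include hV

theorem total_symm {p q : ℤ} {x y : V.Total} (hx : x ∈ V.homog p) (hy : y ∈ V.homog q) :
    V.totalBracket x y = -(ksign K (p * q) • V.totalBracket y x) := by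
  obtain ⟨x, rfl⟩ := hx
  obtain ⟨y, rfl⟩ := hy
  rw [totalBracket_inj, totalBracket_inj, hV.bracket_symm, negOnePow_smul (K := K)]

theorem total_leibniz {p : ℤ} {x : V.Total} (hx : x ∈ V.homog p) (y : V.Total) :
    V.totalD (V.totalBracket x y) =
      V.totalBracket (V.totalD x) y + ksign K p • V.totalBracket x (V.totalD y) := by
  obtain ⟨x, rfl⟩ := hx
  induction y using DirectSum.induction_on with
  | zero => simp
  | add y z hy hz => simp only [map_add, hy, hz]; module
  | of q y =>
    change V.totalD (V.totalBracket _ (V.inj q y)) = V.totalBracket _ (V.inj q y) +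
      ksign K p • V.totalBracket _ (V.totalD (V.inj q y))
    simp only [totalD_inj, totalBracket_inj]
    rw [hV.d_bracket, negOnePow_smul (K := K)]

theorem total_jacobi {p q : ℤ} {x y : V.Total} (hx : x ∈ V.homog p) (hy : y ∈ V.homog q)
    (z : V.Total) :
    V.totalBracket x (V.totalBracket y z) = V.totalBracket (V.totalBracket x y) z +
      ksign K (p * q) • V.totalBracket y (V.totalBracket x z) := by
  obtain ⟨x, rfl⟩ := hx
  obtain ⟨y, rfl⟩ := hy
  induction z using DirectSum.induction_on with
  | zero => simp
  | add w z hw hz => simp only [map_add, hw, hz]; module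
  | of r z =>
    change V.totalBracket _ (V.totalBracket _ (V.inj r z)) = V.totalBracket _ (V.inj r z) +
      ksign K _ • V.totalBracket _ (V.totalBracket _ (V.inj r z))
    simp only [totalBracket_inj]
    rw [hV.jacobi, negOnePow_smul (K := K)]

end IsDGLieAlgebra

/-- A linear map as a multilinear map in one variable. -/
def multi₁ (f : V.Total →ₗ[K] N) : MultilinearMap K (fun _ : Fin 1 => V.Total) N where
  toFun v := f (v 0)
  map_update_add' v i x y := by
    obtain rfl := Subsingleton.elim i 0
    simp
  map_update_smul' v i c x := by
    obtain rfl := Subsingleton.elim i 0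
    simp

/-- A bilinear map as a multilinear map in two variables. -/
def multi₂ (f : V.Total →ₗ[K] V.Total →ₗ[K] N) :
    MultilinearMap K (fun _ : Fin 2 => V.Total) N where
  toFun v := f (v 0) (v 1)
  map_update_add' v i x y := by fin_cases i <;> simp
  map_update_smul' v i c x := by fin_cases i <;> simp

/-- A trilinear map as a multilinear map in three variables. -/
def multi₃ (f : V.Total →ₗ[K] V.Total →ₗ[K] V.Total →ₗ[K] N) :
    MultilinearMap K (fun _ : Fin 3 => V.Total) N where
  toFun v := f (v 0) (v 1) (v 2)
  map_update_add' v i x y := by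
    obtain rfl := Subsingleton.elim ‹DecidableEq (Fin 3)› (instDecidableEqFin 3)
    fin_cases i <;> simp
  map_update_smul' v i c x := by
    obtain rfl := Subsingleton.elim ‹DecidableEq (Fin 3)› (instDecidableEqFin 3)
    fin_cases i <;> simp

end DGLieData

open DGLieData

/-- Linear maps `g`, `N`, `C` with the formal properties of `⟨u, -⟩`, `⟨∇ -, -⟩` and `⟨-, -⟩`. -/
structure ChernSimonsData {K : Type u} [Field K] (V : DGLieData.{u, v} K)
    (M : DGLieData.{u, w} K) where
  g : V.Total →ₗ[K] M.Total
  N : V.Total →ₗ[K] V.Total →ₗ[K] M.Total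
  C : V.Total →ₗ[K] V.Total →ₗ[K] M.Total
  g_mem : ∀ {p x}, x ∈ V.homog p → g x ∈ M.homog p
  N_mem : ∀ {p q x y}, x ∈ V.homog p → y ∈ V.homog q → N x y ∈ M.homog (p + q - 1)
  C_mem : ∀ {p q x y}, x ∈ V.homog p → y ∈ V.homog q → C x y ∈ M.homog (p + q - 2)
  d_g : ∀ x, M.totalD (g x) = g (V.totalD x)
  d_N : ∀ {p q x y}, x ∈ V.homog p → y ∈ V.homog q →
    M.totalD (N x y) = g (V.totalBracket x y) - N (V.totalD x) y - ksign K p • N x (V.totalD y)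
  d_C : ∀ {p q x y}, x ∈ V.homog p → y ∈ V.homog q →
    M.totalD (C x y) = C (V.totalD x) y + ksign K p • C x (V.totalD y) + N x y +
      ksign K (p * q) • N y x
  N_bracket : ∀ {p q r x y z}, x ∈ V.homog p → y ∈ V.homog q → z ∈ V.homog r →
    N (V.totalBracket x y) z =
      N x (V.totalBracket y z) - ksign K (p * q) • N y (V.totalBracket x z)
  C_symm : ∀ {p q x y}, x ∈ V.homog p → y ∈ V.homog q → C x y = ksign K (p * q) • C y x
  C_bracket : ∀ {p q r x y z}, x ∈ V.homog p → y ∈ V.homog q → z ∈ V.homog r →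
    C x (V.totalBracket y z) = C (V.totalBracket x y) z

namespace ChernSimonsData

variable {K : Type u} [Field K] {V : DGLieData.{u, v} K} {M : DGLieData.{u, w} K}
  (S : ChernSimonsData V M)

/-- The map `(x, y) ↦ ½ (N(x, y) - (-1)^{deg x deg y} N(y, x))`. -/
def quadratic : V.Total →ₗ[K] V.Total →ₗ[K] M.Total :=
  (1 / 2 : K) • (S.N - bilin fun p q =>
    ksign K (p * q) • (S.N.compl₁₂ (V.inj q) (V.inj p)).flip)

/-- The map `(x, y, z) ↦ -½ C(x, [y, z])`. -/
def cubic : V.Total →ₗ[K] V.Total →ₗ[K] V.Total →ₗ[K] M.Total :=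
  LinearMap.mk₂ K (fun x y => -((1 / 2 : K) • (S.C x ∘ₗ V.totalBracket y)))
    (fun _ _ _ => by rw [map_add, LinearMap.add_comp]; module)
    (fun _ _ _ => by rw [map_smul, LinearMap.smul_comp]; module)
    (fun _ _ _ => by rw [map_add, LinearMap.comp_add]; module)
    (fun _ _ _ => by rw [map_smul, LinearMap.comp_smul]; module)

theorem quadratic_apply {p q x y} (hx : x ∈ V.homog p) (hy : y ∈ V.homog q) :
    S.quadratic x y = (1 / 2 : K) • (S.N x y - ksign K (p * q) • S.N y x) := by
  obtain ⟨x, rfl⟩ := hx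
  obtain ⟨y, rfl⟩ := hy
  simp only [quadratic, LinearMap.smul_apply, LinearMap.sub_apply, bilin_inj]
  rfl

theorem cubic_apply (x y z : V.Total) :
    S.cubic x y z = -((1 / 2 : K) • S.C x (V.totalBracket y z)) := rfl

theorem quadratic_swap {p q x y} (hx : x ∈ V.homog p) (hy : y ∈ V.homog q) :
    S.quadratic x y = -(ksign K (p * q) • S.quadratic y x) := by
  rw [S.quadratic_apply hx hy, S.quadratic_apply hy hx, mul_comm q p]
  rcases ksign_cases (K := K) (p * q) with ⟨h, -⟩ | ⟨h, -⟩ <;> rw [h] <;> module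

theorem cubic_swap_right (hV : V.IsDGLieAlgebra) {q r y z} (x : V.Total) (hy : y ∈ V.homog q)
    (hz : z ∈ V.homog r) : S.cubic x y z = -(ksign K (q * r) • S.cubic x z y) := by
  rw [cubic_apply, cubic_apply, hV.total_symm hy hz, map_neg, map_smul]
  module

/-- By invariance the cubic map is also -½ C([x, y], z), which makes skew-symmetry in the first two
arguments visible. -/
theorem cubic_swap_left (hV : V.IsDGLieAlgebra) {p q r x y z} (hx : x ∈ V.homog p)
    (hy : y ∈ V.homog q) (hz : z ∈ V.homog r) :
    S.cubic x y z = -(ksign K (p * q) • S.cubic y x z) := by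
  rw [cubic_apply, cubic_apply, S.C_bracket hx hy hz, S.C_bracket hy hx hz,
    hV.total_symm hx hy, map_neg, LinearMap.neg_apply, map_smul, LinearMap.smul_apply]
  module

/-- Skew-symmetrising the formula for dN: the two terms in g agree because the bracket is
skew-symmetric, and their halves add up to g([x, y]). -/
theorem d_quadratic [CharZero K] (hV : V.IsDGLieAlgebra) {p q x y} (hx : x ∈ V.homog p)
    (hy : y ∈ V.homog q) :
    M.totalD (S.quadratic x y) = -(S.quadratic (V.totalD x) y -
      ksign K (p * q) • S.quadratic (V.totalD y) x) + S.g (V.totalBracket x y) := by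
  rw [S.quadratic_apply hx hy, S.quadratic_apply (totalD_mem hx) hy,
    S.quadratic_apply (totalD_mem hy) hx, map_smul, map_sub, map_smul, S.d_N hx hy, S.d_N hy hx,
    hV.total_symm hy hx, map_neg, map_smul, add_mul, add_mul, one_mul, one_mul, ksign_add,
    ksign_add, mul_comm q p]
  rcases ksign_cases (K := K) p with ⟨h1, h2⟩ | ⟨h1, h2⟩ <;>
  rcases ksign_cases (K := K) q with ⟨h3, -⟩ | ⟨h3, -⟩ <;>
  simp only [h1, h2, h3] <;> module

/-- Up to Koszul signs, let a, b, c be N(x, [y, z]), N(y, [z, x]), N(z, [x, y]). The derivation rule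
gives N([x, y], z) = a + b and its cyclic analogues, so the quadratic terms add up to ½(2(a + b + c)
- (a + b + c)). The N-terms of dC(x, [y, z]) are a + (b + c), and the factor -½ makes both sides
agree. -/
theorem d_cubic [CharZero K] (hV : V.IsDGLieAlgebra) {p q r x y z} (hx : x ∈ V.homog p)
    (hy : y ∈ V.homog q) (hz : z ∈ V.homog r) :
    M.totalD (S.cubic x y z) =
      (S.cubic (V.totalD x) y z - ksign K (p * q) • S.cubic (V.totalD y) x z +
        (ksign K (p * r) * ksign K (q * r)) • S.cubic (V.totalD z) x y) -
      (S.quadratic (V.totalBracket x y) z - ksign K (q * r) • S.quadratic (V.totalBracket x z) y +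
        (ksign K (p * q) * ksign K (p * r)) • S.quadratic (V.totalBracket y z) x) := by
  -- Differentiated arguments go back to their own positions, where they match the Leibniz expansion
  -- of C(x, [y, z]).
  have e1 : S.cubic (V.totalD y) x z = -(ksign K ((q + 1) * p) • S.cubic x (V.totalD y) z) :=
    S.cubic_swap_left hV (totalD_mem hy) hx hz
  have e2 : S.cubic (V.totalD z) x y = -(ksign K ((r + 1) * p) • S.cubic x (V.totalD z) y) :=
    S.cubic_swap_left hV (totalD_mem hz) hx hy
  have e3 : S.cubic x (V.totalD z) y = -(ksign K ((r + 1) * q) • S.cubic x y (V.totalD z)) :=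
    S.cubic_swap_right hV _ (totalD_mem hz) hy
  rw [e1, e2, e3, S.quadratic_apply (totalBracket_mem hx hy) hz,
    S.quadratic_apply (totalBracket_mem hx hz) hy, S.quadratic_apply (totalBracket_mem hy hz) hx,
    cubic_apply, cubic_apply, cubic_apply, cubic_apply, map_neg, map_smul,
    S.d_C hx (totalBracket_mem hy hz), hV.total_leibniz hy, map_add, map_smul,
    S.N_bracket hx hy hz, S.N_bracket hx hz hy, S.N_bracket hy hz hx,
    hV.total_symm hz hy, hV.total_symm hz hx, hV.total_symm hy hx]
  -- Products of degrees are put in a fixed order, so that the case distinction on parities can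
  -- rewrite all of them.
  simp only [map_neg, map_smul, mul_add, add_mul, one_mul, ksign_add, mul_comm q p, mul_comm r p,
    mul_comm r q]
  rcases ksign_cases (K := K) p with ⟨h1, h2⟩ | ⟨h1, h2⟩ <;>
  rcases ksign_cases (K := K) q with ⟨h3, h4⟩ | ⟨h3, h4⟩ <;>
  rcases ksign_cases (K := K) r with ⟨h5, -⟩ | ⟨h5, -⟩ <;>
  simp only [h1, h2, h3, h4, h5] <;> module

end ChernSimonsData
end

/-! ### The `L∞` relations in every arity -/

noncomputable section

open DGLieData

namespace ChernSimonsData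

variable {K : Type u} [Field K] {V : DGLieData.{u, v} K} {M : DGLieData.{u, w} K}
  (S : ChernSimonsData V M)

/-- All terms are multiples of C applied to two brackets. Symmetry of C identifies the six of them
in pairs; invariance pulls `x` out of the remaining three, leaving C of `x` with a Jacobi
combination of `y`, `z`, `w`. -/
theorem cubic_bracket (hV : V.IsDGLieAlgebra) {p q r t x y z w} (hx : x ∈ V.homog p)
    (hy : y ∈ V.homog q) (hz : z ∈ V.homog r) (hw : w ∈ V.homog t) :
    S.cubic (V.totalBracket x y) z w - ksign K (q * r) • S.cubic (V.totalBracket x z) y w +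
      (ksign K (q * t) * ksign K (r * t)) • S.cubic (V.totalBracket x w) y z +
      (ksign K (p * q) * ksign K (p * r)) • S.cubic (V.totalBracket y z) x w -
      (ksign K (p * q) * ksign K (p * t) * ksign K (r * t)) • S.cubic (V.totalBracket y w) x z +
      (ksign K (p * r) * ksign K (p * t) * ksign K (q * r) * ksign K (q * t)) •
        S.cubic (V.totalBracket z w) x y = 0 := by
  have hyz := totalBracket_mem hy hz
  have hyw := totalBracket_mem hy hw
  have hzw := totalBracket_mem hz hw
  simp only [cubic_apply]
  rw [S.C_symm hyz (totalBracket_mem hx hw), S.C_symm hyw (totalBracket_mem hx hz),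
    S.C_symm hzw (totalBracket_mem hx hy), ← S.C_bracket hx hy hzw, ← S.C_bracket hx hz hyw,
    ← S.C_bracket hx hw hyz, hV.total_jacobi hy hz, hV.total_symm hyz hw, map_add, map_neg,
    map_smul, map_smul]
  simp only [mul_add, add_mul, ksign_add, mul_comm q p, mul_comm r p, mul_comm r q, mul_comm t p,
    mul_comm t q, mul_comm t r]
  rcases ksign_cases (K := K) p with ⟨h1, h2⟩ | ⟨h1, h2⟩ <;>
  rcases ksign_cases (K := K) q with ⟨h3, h4⟩ | ⟨h3, h4⟩ <;>
  rcases ksign_cases (K := K) r with ⟨h5, h6⟩ | ⟨h5, h6⟩ <;>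
  rcases ksign_cases (K := K) t with ⟨h7, -⟩ | ⟨h7, -⟩ <;>
  simp only [h2, h3, h4, h5, h6, h7] <;> module

/-- The components of the `L∞` morphism. -/
def component : ∀ n : ℕ, MultilinearMap K (fun _ : Fin n => V.Total) M.Total
  | 1 => multi₁ S.g
  | 2 => multi₂ S.quadratic
  | 3 => multi₃ S.cubic
  -- This also covers arity zero, whose value is irrelevant.
  | _ => 0

theorem component_of_four_le {n : ℕ} (hn : 4 ≤ n) : S.component n = 0 := by
  match n, hn with
  | n + 4, _ => rfl

theorem component_mem (n : ℕ) (hn : 1 ≤ n) (p : Fin n → ℤ) (v : ∀ i, V.obj (p i)) :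
    S.component n (fun i => V.inj (p i) (v i)) ∈ M.homog (∑ i, p i + 1 - n) := by
  match n, hn with
  | 1, _ =>
    change S.g (V.inj _ (v 0)) ∈ _
    convert S.g_mem (inj_mem (v 0)) using 2
    simp
  | 2, _ =>
    change S.quadratic (V.inj _ (v 0)) (V.inj _ (v 1)) ∈ _
    rw [S.quadratic_apply (inj_mem _) (inj_mem _)]
    refine Submodule.smul_mem _ _ (sub_mem ?_ (Submodule.smul_mem _ _ ?_))
    · convert S.N_mem (inj_mem (v 0)) (inj_mem (v 1)) using 2
      rw [Fin.sum_univ_two]; push_cast; ring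
    · convert S.N_mem (inj_mem (v 1)) (inj_mem (v 0)) using 2
      rw [Fin.sum_univ_two]; push_cast; ring
  | 3, _ =>
    change S.cubic (V.inj _ (v 0)) (V.inj _ (v 1)) (V.inj _ (v 2)) ∈ _
    rw [cubic_apply]
    refine neg_mem (Submodule.smul_mem _ _ ?_)
    convert S.C_mem (inj_mem (v 0)) (totalBracket_mem (inj_mem (v 1)) (inj_mem (v 2))) using 2
    rw [Fin.sum_univ_three]; push_cast; ring
  | n + 4, _ => exact zero_mem _

/-- The permutations of at most three letters are listed and written through adjacent exchanges;
from arity four on the component is zero. -/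
theorem component_perm (hV : V.IsDGLieAlgebra) (n : ℕ) (hn : 1 ≤ n) (σ : Equiv.Perm (Fin n))
    (p : Fin n → ℤ) (v : ∀ i, V.obj (p i)) :
    S.component n (fun i => V.inj (p (σ i)) (v (σ i))) =
      koszulSign σ p • S.component n (fun i => V.inj (p i) (v i)) := by
  rw [units_smul (K := K)]
  change _ = koszulScalar K σ p • _
  -- A family in the total space no longer has types depending on the index, so the values of σ can
  -- be substituted.
  obtain ⟨w, hw'⟩ : ∃ w : Fin n → V.Total, w = fun i => V.inj (p i) (v i) := ⟨_, rfl⟩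
  have hw : ∀ i, w i ∈ V.homog (p i) := fun i => by rw [hw']; exact inj_mem _
  change S.component n (fun i => (fun i => V.inj (p i) (v i)) (σ i)) = _
  rw [← hw']
  clear hw' v
  match n, hn with
  | 1, _ =>
    rw [Subsingleton.elim σ 1]
    simp [koszulScalar_eq]
  | 2, _ =>
    change S.quadratic (w (σ 0)) (w (σ 1)) = koszulScalar K σ p • S.quadratic (w 0) (w 1)
    have h : (σ 0 = 0 ∧ σ 1 = 1) ∨ (σ 0 = 1 ∧ σ 1 = 0) := by revert σ; decide
    rcases h with ⟨h0, h1⟩ | ⟨h0, h1⟩ <;> rw [koszulScalar_fin_two, h0, h1]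
    · simp
    · rw [S.quadratic_swap (hw 1) (hw 0)]
      simp
  | 3, _ =>
    change S.cubic (w (σ 0)) (w (σ 1)) (w (σ 2)) =
      koszulScalar K σ p • S.cubic (w 0) (w 1) (w 2)
    have h : (σ 0 = 0 ∧ σ 1 = 1 ∧ σ 2 = 2) ∨ (σ 0 = 0 ∧ σ 1 = 2 ∧ σ 2 = 1) ∨
        (σ 0 = 1 ∧ σ 1 = 0 ∧ σ 2 = 2) ∨ (σ 0 = 1 ∧ σ 1 = 2 ∧ σ 2 = 0) ∨
        (σ 0 = 2 ∧ σ 1 = 0 ∧ σ 2 = 1) ∨ (σ 0 = 2 ∧ σ 1 = 1 ∧ σ 2 = 0) := by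
      revert σ; decide
    rcases h with ⟨h0, h1, h2⟩ | ⟨h0, h1, h2⟩ | ⟨h0, h1, h2⟩ | ⟨h0, h1, h2⟩ | ⟨h0, h1, h2⟩ |
      ⟨h0, h1, h2⟩ <;> rw [koszulScalar_fin_three, h0, h1, h2]
    · simp
    · rw [S.cubic_swap_right hV _ (hw 2) (hw 1)]
      simp
    · rw [S.cubic_swap_left hV (hw 1) (hw 0) (hw 2)]
      simp
    · rw [S.cubic_swap_right hV _ (hw 2) (hw 0), S.cubic_swap_left hV (hw 1) (hw 0) (hw 2)]
      simp [smul_smul, mul_comm]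
    · rw [S.cubic_swap_left hV (hw 2) (hw 0) (hw 1), S.cubic_swap_right hV _ (hw 2) (hw 1)]
      simp [smul_smul]
    · rw [S.cubic_swap_left hV (hw 2) (hw 1) (hw 0), S.cubic_swap_right hV _ (hw 2) (hw 0),
        S.cubic_swap_left hV (hw 1) (hw 0) (hw 2)]
      simp [smul_smul, mul_comm, mul_assoc]
  | n + 4, _ => simp [component_of_four_le]

theorem component_condition [CharZero K] (hV : V.IsDGLieAlgebra) (n : ℕ) (p : Fin (n + 2) → ℤ)
    (v : ∀ i, V.obj (p i)) :
    M.totalD (S.component (n + 2) fun i => V.inj (p i) (v i)) =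
      ((1 : ℤ) - (n + 2)).negOnePow • ∑ σ ∈ shuffles 1 (n + 2),
        koszulSign σ p • S.component (n + 2) (Fin.cons (V.totalD (V.inj _ (v (σ 0))))
          fun i : Fin (n + 1) => V.inj _ (v (σ i.succ))) +
      ((2 : ℤ) - (n + 2)).negOnePow • ∑ σ ∈ shuffles 2 (n + 2),
        koszulSign σ p • S.component (n + 1) (Fin.cons
          (V.totalBracket (V.inj _ (v (σ 0))) (V.inj _ (v (σ 1))))
          fun i : Fin n => V.inj _ (v (σ i.succ.succ))) := by
  simp only [units_smul (K := K)]
  obtain ⟨w, hw'⟩ : ∃ w : Fin (n + 2) → V.Total, w = fun i => V.inj (p i) (v i) := ⟨_, rfl⟩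
  have hw : ∀ i, w i ∈ V.homog (p i) := fun i => by rw [hw']; exact inj_mem _
  change M.totalD (S.component (n + 2) fun i => (fun i => V.inj (p i) (v i)) i) =
    ksign K _ • ∑ σ ∈ shuffles 1 (n + 2), koszulScalar K σ p • S.component (n + 2)
      (Fin.cons (V.totalD ((fun i => V.inj (p i) (v i)) (σ 0)))
        fun i : Fin (n + 1) => (fun i => V.inj (p i) (v i)) (σ i.succ)) +
    ksign K _ • ∑ σ ∈ shuffles 2 (n + 2), koszulScalar K σ p • S.component (n + 1)
      (Fin.cons (V.totalBracket ((fun i => V.inj (p i) (v i)) (σ 0))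
        ((fun i => V.inj (p i) (v i)) (σ 1)))
        fun i : Fin n => (fun i => V.inj (p i) (v i)) (σ i.succ.succ))
  rw [← hw']
  clear hw' v
  -- Here `n` is the arity minus two. The two sign factors are (-1, 1) in arity two and (1, -1) in
  -- arity three; in arity four the component is zero and only the bracket sum is left.
  match n with
  | 0 =>
    have h1 := sum_shuffles_one_two (K := K) p fun a b => S.quadratic (V.totalD (w a)) (w b)
    have h2 := sum_shuffles_two_two (K := K) p fun a b => S.g (V.totalBracket (w a) (w b))
    refine (S.d_quadratic hV (hw 0) (hw 1)).trans ?_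
    rw [← h1, ← h2, ksign_congr (q := 1) (by decide), ksign_congr (p := 2 - _) (q := 0) (by decide),
      ksign_one, ksign_zero, neg_one_smul, one_smul]
    rfl
  | 1 =>
    have h1 := sum_shuffles_one_three (K := K) p fun a b c =>
      S.cubic (V.totalD (w a)) (w b) (w c)
    have h2 := sum_shuffles_two_three (K := K) p fun a b c =>
      S.quadratic (V.totalBracket (w a) (w b)) (w c)
    refine (S.d_cubic hV (hw 0) (hw 1) (hw 2)).trans ?_
    rw [← h1, ← h2, ksign_congr (q := 0) (by decide), ksign_congr (p := 2 - _) (q := 1) (by decide),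
      ksign_one, ksign_zero, neg_one_smul, one_smul, ← sub_eq_add_neg]
    rfl
  | 2 =>
    have h2 := sum_shuffles_two_four (K := K) p fun a b c d =>
      S.cubic (V.totalBracket (w a) (w b)) (w c) (w d)
    rw [S.cubic_bracket hV (hw 0) (hw 1) (hw 2) (hw 3)] at h2
    rw [S.component_of_four_le (n := 2 + 2) (by norm_num)]
    simp only [_root_.zero_apply, smul_zero, Finset.sum_const_zero, map_zero, zero_add]
    refine Eq.trans (smul_zero _).symm (congrArg _ ?_)
    exact h2.symm
  | n + 3 =>
    rw [S.component_of_four_le (n := n + 3 + 2) (by omega),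
      S.component_of_four_le (n := n + 3 + 1) (by omega)]
    simp

/-- The `L∞` morphism with components `g`, `½ (N(x, y) ∓ N(y, x))` and `-½ C(x, [y, z])`. -/
def toLInftyMorphism [CharZero K] (hV : V.IsDGLieAlgebra) : LInftyMorphism V M where
  map := S.component
  map_mem := S.component_mem
  map_perm := S.component_perm hV
  condition_one := S.d_g
  condition := S.component_condition hV

end ChernSimonsData
end

/-! ### The totalisations as DG-Lie algebras -/

noncomputable section

theorem TWForms.degProj_of_mem_of_ne {K : Type u} [Field K] {n a b : ℕ} (hab : a ≠ b)
    {x : PolyForm K n} (hx : x ∈ degForm K n a) : degProj n b x = 0 := by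
  induction hx using Submodule.span_induction with
  | zero => simp
  | add x y _ _ hx hy => rw [map_add, hx, hy, add_zero]
  | smul c x _ hx => rw [map_smul, hx, smul_zero]
  | mem x h =>
    obtain ⟨f, w, hw, rfl⟩ := h
    rw [degProj_tmul, DirectSum.decompose_of_mem_ne (fun i : ℕ => ⋀[K]^i (Fin n → K)) hw hab,
      TensorProduct.tmul_zero]

namespace DGPresheaf

open TWForms

variable {K : Type u} [Field K] {X : Scheme.{u}} {ι : Type w} (𝒰 : ι → X.Opens)
  (F : DGPresheaf K X)

theorem cellProj_of_mem_of_ne {a c : ℕ} {m l : ℤ} (hml : m ≠ l) {x : F.Cell 𝒰 a c}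
    (hx : x ∈ F.cellHomog 𝒰 a c m) : F.cellProj 𝒰 a c l x = 0 := by
  induction hx using homog_induction with
  | zero => simp
  | add x y _ _ hx hy => rw [map_add, hx, hy, add_zero]
  | of q j η s hη hq =>
    rw [cellProj_of]
    split_ifs with h
    · rw [degProj_of_mem_of_ne _ hη, TensorProduct.zero_tmul, map_zero]
      omega
    · simp

/-- The sequence of cells underlying an element of the totalisation. -/
def totVal : (⨁ m, F.Tot 𝒰 m) →ₗ[K] ∀ n, F.Cell 𝒰 n n :=
  DirectSum.toModule K ℤ _ fun m => (F.Tot 𝒰 m).subtype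

theorem totVal_of (m : ℤ) (x : F.Tot 𝒰 m) :
    F.totVal 𝒰 (DirectSum.lof K ℤ (fun m => F.Tot 𝒰 m) m x) = x.1 := by
  rw [totVal, DirectSum.toModule_lof]
  rfl

/-- Elements of different total degrees are separated by the degree projections. Hence nothing is
lost in passing to sequences of cells, and equalities in the total space may be checked cell by cell
without tracking degrees. -/
theorem cellProj_totVal (n : ℕ) (x : ⨁ m, F.Tot 𝒰 m) (m : ℤ) :
    F.cellProj 𝒰 n n m (F.totVal 𝒰 x n) = (x m).1 n := by
  induction x using DirectSum.induction_on with
  | zero => simp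
  | add x y hx hy => rw [map_add, Pi.add_apply, map_add, hx, hy]; rfl
  | of k x =>
    have h := F.totVal_of 𝒰 k x
    rw [DirectSum.lof_eq_of] at h
    rw [h]
    by_cases hk : k = m
    · subst hk
      rw [cellProj_of_mem 𝒰 (x.2.1 n), DirectSum.of_eq_same]
    · rw [F.cellProj_of_mem_of_ne 𝒰 hk (x.2.1 n), DirectSum.of_eq_of_ne _ _ _ (Ne.symm hk)]
      rfl

theorem totVal_injective : Function.Injective (F.totVal 𝒰) := fun x y h =>
  DFinsupp.ext fun m => Subtype.ext <| funext fun n => by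
    rw [← F.cellProj_totVal 𝒰 n x m, ← F.cellProj_totVal 𝒰 n y m, h]

end DGPresheaf

open DGPresheaf DGLieData

section TotLie

variable {K : Type u} [Field K] {X : Scheme.{u}} [X.Over (Spec (.of K))]
  (𝒜 : DGLieAlgebroid K X) {ι : Type w} (𝒰 : ι → X.Opens)

/-- The sequence of cells underlying an element of `Tot(𝒰, L)`. -/
def DGLieAlgebroid.valL :
    (𝒜.totL 𝒰).Total →ₗ[K] ∀ n, (ofModules (K := K) 𝒜.L).Cell 𝒰 n n :=
  (ofModules (K := K) 𝒜.L).totVal 𝒰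

variable (K) in
/-- The sequence of cells underlying an element of `Tot(𝒰, Ω^{≤1}[2])`. -/
def valDeRham : (totDeRham K 𝒰).Total →ₗ[K] ∀ n, (truncDeRham (K := K) (X := X)).Cell 𝒰 n n :=
  (truncDeRham (K := K) (X := X)).totVal 𝒰

theorem valDeRham_inj {m : ℤ} (x : (totDeRham K 𝒰).obj m) :
    valDeRham K 𝒰 ((totDeRham K 𝒰).inj m x) =
      Subtype.val (p := (· ∈ (truncDeRham (K := K) (X := X)).Tot 𝒰 m)) x :=
  (truncDeRham (K := K) (X := X)).totVal_of 𝒰 m x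

theorem valDeRham_injective : Function.Injective (valDeRham K 𝒰) :=
  (truncDeRham (K := K) (X := X)).totVal_injective 𝒰

theorem valDeRham_totalD (x : (totDeRham K 𝒰).Total) (n : ℕ) :
    valDeRham K 𝒰 ((totDeRham K 𝒰).totalD x) n = truncDeRham.cellD 𝒰 n n (valDeRham K 𝒰 x n) := by
  induction x using DirectSum.induction_on with
  | zero => simp only [map_zero, Pi.zero_apply]
  | add x y hx hy => simp only [map_add, Pi.add_apply, hx, hy]
  | of m x =>
    change valDeRham K 𝒰 ((totDeRham K 𝒰).totalD ((totDeRham K 𝒰).inj m x)) n =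
      truncDeRham.cellD 𝒰 n n (valDeRham K 𝒰 ((totDeRham K 𝒰).inj m x) n)
    rw [totalD_inj, valDeRham_inj, valDeRham_inj]
    rfl

theorem totDeRham_isAbelian : (totDeRham K 𝒰).IsAbelian := fun _ _ => rfl

theorem totDeRham_isDGLieAlgebra : (totDeRham K 𝒰).IsDGLieAlgebra where
  d_d p x := Subtype.ext <| funext fun n => cellD_cellD 𝒰 n n (x.1 n)
  bracket_symm p q x y := by
    rw [totDeRham_isAbelian, totDeRham_isAbelian]
    simp
  d_bracket p q x y := by
    rw [totDeRham_isAbelian, totDeRham_isAbelian, totDeRham_isAbelian]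
    simp
  jacobi p q r x y z := by
    rw [totDeRham_isAbelian 𝒰 p (q + r), totDeRham_isAbelian 𝒰 (p + q) r,
      totDeRham_isAbelian 𝒰 q (p + r)]
    simp

namespace DGLieAlgebroid

theorem valL_inj {m : ℤ} (x : (𝒜.totL 𝒰).obj m) :
    𝒜.valL 𝒰 ((𝒜.totL 𝒰).inj m x) =
      Subtype.val (p := (· ∈ (ofModules (K := K) 𝒜.L).Tot 𝒰 m)) x :=
  (ofModules (K := K) 𝒜.L).totVal_of 𝒰 m x

theorem valL_injective : Function.Injective (𝒜.valL 𝒰) :=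
  (ofModules (K := K) 𝒜.L).totVal_injective 𝒰

theorem totL_isDGLieAlgebra : (𝒜.totL 𝒰).IsDGLieAlgebra where
  d_d p x := Subtype.ext <| funext fun n => cellD_cellD 𝒰 n n (x.1 n)
  bracket_symm p q x y := by
    apply 𝒜.valL_injective 𝒰
    rw [negOnePow_smul (K := K), ← neg_smul, ← neg_one_mul, map_smul, valL_inj, valL_inj]
    exact funext fun n => Pairing.cellPair_symm 𝒰 𝒜.lieBracket (-1) 𝒜.lieBracket_symm
      (x.2.1 n) (y.2.1 n)
  d_bracket p q x y := by
    apply 𝒜.valL_injective 𝒰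
    rw [negOnePow_smul (K := K), map_add, map_smul, valL_inj, valL_inj, valL_inj]
    exact funext fun n => Pairing.cellD_pair 𝒰 𝒜.lieBracket 𝒜.d_lieBracket (x.2.1 n) (y.1 n)
  jacobi p q r x y z := by
    apply 𝒜.valL_injective 𝒰
    rw [negOnePow_smul (K := K), map_add, map_smul, valL_inj, valL_inj, valL_inj]
    refine funext fun n => ?_
    refine (Pairing.cellPair_trilinear 𝒰 𝒜.lieBracket 𝒜.lieBracket 𝒜.lieBracket 𝒜.lieBracket (-1)
      𝒜.lieBracket_jacobi (x.1 n) (y.2.1 n) (z.2.1 n)).trans (congrArg _ ?_)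
    -- The transfer lemma yields [[x, z], y]; one more exchange gives [y, [x, z]], and the sign
    -- exponent qr + (p + r)q is congruent to pq modulo two.
    have h := Pairing.cellPair_symm 𝒰 𝒜.lieBracket (-1) 𝒜.lieBracket_symm
      (𝒜.lieBracket.cellPair_mem 𝒰 (x.2.1 n) (z.2.1 n)) (y.2.1 n)
    refine (congrArg _ h).trans ?_
    rw [smul_smul]
    refine congrArg₂ (· • ·) ?_ rfl
    rw [neg_one_mul, neg_one_mul, neg_mul_neg, ← ksign_add]
    exact ksign_congr ⟨q * r, by ring⟩

end DGLieAlgebroid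

end TotLie
end

/-- The ℤ-module structure is arbitrary and not assumed related to that over `K`: both actions of -1
yield an additive inverse of `x`, and such an inverse is unique. -/
theorem coe_negOnePow_smul {K : Type*} [Field K] {M : Type*} [AddCommMonoid M] [Module K M]
    [Module ℤ M] (p : ℤ) (x : M) : (p.negOnePow : ℤ) • x = ksign K p • x := by
  rcases Int.even_or_odd p with h | h
  · rw [Int.negOnePow_even p h, ksign_congr (q := 0) (by simpa using h), ksign_zero]
    simp
  · rw [Int.negOnePow_odd p h, ksign_congr (q := 1) (by
      obtain ⟨k, rfl⟩ := h
      exact ⟨k, by ring⟩), ksign_one]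
    have h1 : (-1 : ℤ) • x + x = 0 := by
      nth_rw 2 [← one_smul ℤ x]
      rw [← add_smul, neg_add_cancel, zero_smul]
    have h2 : x + (-1 : K) • x = 0 := by
      nth_rw 1 [← one_smul K x]
      rw [← add_smul, add_neg_cancel, zero_smul]
    calc _ = (-1 : ℤ) • x + (x + (-1 : K) • x) := by rw [h2]; simp
      _ = _ := by rw [← add_assoc, h1, zero_add]

/-! ### The forms g, N and C on the totalisation -/

noncomputable section

open DGPresheaf DGLieData

variable {K : Type u} [Field K] {X : Scheme.{u}} [X.Over (Spec (.of K))]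
  {𝒜 : DGLieAlgebroid K X} {ι : Type w} {𝒰 : ι → X.Opens}

namespace CyclicForm.IsTotClosed

variable {B : CyclicForm 𝒜} (hB : B.IsTotClosed 𝒰)
include hB

theorem cellD_pairing₀ {p q : ℤ} (z : (ofModules (K := K) 𝒜.L).Tot 𝒰 p)
    (w : (ofModules (K := K) 𝒜.L).Tot 𝒰 q) (n : ℕ) :
    structureSheaf.cellD 𝒰 n n (B.pairing₀.cellPair 𝒰 n n (z.1 n) (w.1 n)) =
      B.pairing₀.cellPair 𝒰 n n ((ofModules (K := K) 𝒜.L).cellD 𝒰 n n (z.1 n)) (w.1 n) +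
        ksign K p • B.pairing₀.cellPair 𝒰 n n (z.1 n)
          ((ofModules (K := K) 𝒜.L).cellD 𝒰 n n (w.1 n)) := by
  rw [← coe_negOnePow_smul (K := K)]
  exact (congrFun (hB.closed₀ p q z w) n).symm

theorem cellD_pairing₁ {p q : ℤ} (z : (omegaTensor (K := K) 𝒜.L).Tot 𝒰 p)
    (w : (ofModules (K := K) 𝒜.L).Tot 𝒰 q) (n : ℕ) :
    omegaOne.cellD 𝒰 n n (B.pairing₁.cellPair 𝒰 n n (z.1 n) (w.1 n)) =
      B.pairing₁.cellPair 𝒰 n n ((omegaTensor (K := K) 𝒜.L).cellD 𝒰 n n (z.1 n)) (w.1 n) +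
        ksign K p • B.pairing₁.cellPair 𝒰 n n (z.1 n)
          ((ofModules (K := K) 𝒜.L).cellD 𝒰 n n (w.1 n)) := by
  rw [← coe_negOnePow_smul (K := K)]
  exact (congrFun (hB.closed₁ p q z w) n).symm

end CyclicForm.IsTotClosed

namespace DGLieAlgebroid

theorem valL_totalD (x : (𝒜.totL 𝒰).Total) (n : ℕ) :
    𝒜.valL 𝒰 ((𝒜.totL 𝒰).totalD x) n =
      (ofModules (K := K) 𝒜.L).cellD 𝒰 n n (𝒜.valL 𝒰 x n) := by
  induction x using DirectSum.induction_on with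
  | zero => simp only [map_zero, Pi.zero_apply]
  | add x y hx hy => simp only [map_add, Pi.add_apply, hx, hy]
  | of m x =>
    change 𝒜.valL 𝒰 ((𝒜.totL 𝒰).totalD ((𝒜.totL 𝒰).inj m x)) n =
      (ofModules (K := K) 𝒜.L).cellD 𝒰 n n (𝒜.valL 𝒰 ((𝒜.totL 𝒰).inj m x) n)
    rw [totalD_inj, valL_inj, valL_inj]
    rfl

theorem valL_totalBracket_inj {p q : ℤ} (x : (𝒜.totL 𝒰).obj p) (y : (𝒜.totL 𝒰).obj q) (n : ℕ) :
    𝒜.valL 𝒰 ((𝒜.totL 𝒰).totalBracket ((𝒜.totL 𝒰).inj p x) ((𝒜.totL 𝒰).inj q y)) n =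
      𝒜.lieBracket.cellPair 𝒰 n n (𝒜.valL 𝒰 ((𝒜.totL 𝒰).inj p x) n)
        (𝒜.valL 𝒰 ((𝒜.totL 𝒰).inj q y) n) := by
  rw [totalBracket_inj, valL_inj, valL_inj, valL_inj]
  rfl

theorem valL_totalBracket {p q : ℤ} {x y : (𝒜.totL 𝒰).Total} (hx : x ∈ (𝒜.totL 𝒰).homog p)
    (hy : y ∈ (𝒜.totL 𝒰).homog q) (n : ℕ) :
    𝒜.valL 𝒰 ((𝒜.totL 𝒰).totalBracket x y) n =
      𝒜.lieBracket.cellPair 𝒰 n n (𝒜.valL 𝒰 x n) (𝒜.valL 𝒰 y n) := by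
  obtain ⟨x, rfl⟩ := hx
  obtain ⟨y, rfl⟩ := hy
  exact valL_totalBracket_inj x y n

theorem exists_valL {p : ℤ} {x : (𝒜.totL 𝒰).Total} (hx : x ∈ (𝒜.totL 𝒰).homog p) :
    ∃ z : (ofModules (K := K) 𝒜.L).Tot 𝒰 p, 𝒜.valL 𝒰 x = z.1 := by
  obtain ⟨x, rfl⟩ := hx
  exact ⟨x, valL_inj 𝒜 𝒰 x⟩

end DGLieAlgebroid

theorem ext_valDeRham {x y : (totDeRham K 𝒰).Total}
    (h : ∀ n, valDeRham K 𝒰 x n = valDeRham K 𝒰 y n) : x = y :=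
  valDeRham_injective 𝒰 (funext h)

theorem valDeRham_of_eq_inj {x : (totDeRham K 𝒰).Total} {m : ℤ} {z : (totDeRham K 𝒰).obj m}
    (h : x = (totDeRham K 𝒰).inj m z) (n : ℕ) : valDeRham K 𝒰 x n =
      Subtype.val (p := (· ∈ (truncDeRham (K := K) (X := X)).Tot 𝒰 m)) z n :=
  congrFun ((congrArg _ h).trans (valDeRham_inj 𝒰 z)) n

/-- The value of `⟨t, -⟩` for an element `t` of `Tot(𝒰, Ω¹[-1] ⊗ L)` on `Tot(𝒰, L)`. -/
def CyclicForm.totPairing₁ (B : CyclicForm 𝒜) {m : ℤ} (t : (omegaTensor (K := K) 𝒜.L).Tot 𝒰 m) :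
    (𝒜.totL 𝒰).Total →ₗ[K] (totDeRham K 𝒰).Total :=
  DirectSum.toModule K ℤ _ fun p => (totDeRham K 𝒰).inj (m + p + -2) ∘ₗ
    inclDeRham₁.totMap 𝒰 (m + p) ∘ₗ B.pairing₁.totPair 𝒰 m p t

theorem CyclicForm.totPairing₁_inj (B : CyclicForm 𝒜) {m p : ℤ}
    (t : (omegaTensor (K := K) 𝒜.L).Tot 𝒰 m) (x : (𝒜.totL 𝒰).obj p) :
    B.totPairing₁ t ((𝒜.totL 𝒰).inj p x) = (totDeRham K 𝒰).inj (m + p + -2)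
      (inclDeRham₁.totMap 𝒰 (m + p) (B.pairing₁.totPair 𝒰 m p t x)) := by
  rw [totPairing₁, inj, DirectSum.toModule_lof]
  rfl

theorem CyclicForm.valDeRham_totPairing₁ (B : CyclicForm 𝒜) {m : ℤ}
    (t : (omegaTensor (K := K) 𝒜.L).Tot 𝒰 m) (x : (𝒜.totL 𝒰).Total) (n : ℕ) :
    valDeRham K 𝒰 (B.totPairing₁ t x) n = inclDeRham₁.cellMap 𝒰 n n
      (B.pairing₁.cellPair 𝒰 n n (t.1 n) (𝒜.valL 𝒰 x n)) := by
  induction x using DirectSum.induction_on with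
  | zero => simp only [map_zero, Pi.zero_apply]
  | add x y hx hy => simp only [map_add, Pi.add_apply, hx, hy]
  | of p x =>
    change valDeRham K 𝒰 (B.totPairing₁ t ((𝒜.totL 𝒰).inj p x)) n = inclDeRham₁.cellMap 𝒰 n n
      (B.pairing₁.cellPair 𝒰 n n (t.1 n) (𝒜.valL 𝒰 ((𝒜.totL 𝒰).inj p x) n))
    rw [DGLieAlgebroid.valL_inj]
    exact valDeRham_of_eq_inj (B.totPairing₁_inj t x) n

/-- The form `⟨∇ -, -⟩` on `Tot(𝒰, L)`. -/
def CyclicForm.totConnection (B : CyclicForm 𝒜) (D : (omegaTensor (K := K) 𝒜.A).Tot 𝒰 1) :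
    (𝒜.totL 𝒰).Total →ₗ[K] (𝒜.totL 𝒰).Total →ₗ[K] (totDeRham K 𝒰).Total :=
  bilin fun p q => ((B.pairing₁.totPair 𝒰 (1 + p) q ∘ₗ 𝒜.connection 𝒰 D p).compr₂
    ((totDeRham K 𝒰).inj (1 + p + q + -2) ∘ₗ inclDeRham₁.totMap 𝒰 (1 + p + q)))

theorem CyclicForm.totConnection_inj (B : CyclicForm 𝒜) (D : (omegaTensor (K := K) 𝒜.A).Tot 𝒰 1)
    {p q : ℤ} (x : (𝒜.totL 𝒰).obj p) (y : (𝒜.totL 𝒰).obj q) :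
    B.totConnection D ((𝒜.totL 𝒰).inj p x) ((𝒜.totL 𝒰).inj q y) =
      (totDeRham K 𝒰).inj (1 + p + q + -2) (inclDeRham₁.totMap 𝒰 (1 + p + q)
        (B.pairing₁.totPair 𝒰 (1 + p) q (𝒜.connection 𝒰 D p x) y)) :=
  bilin_inj _ x y

theorem CyclicForm.valDeRham_totConnection (B : CyclicForm 𝒜)
    (D : (omegaTensor (K := K) 𝒜.A).Tot 𝒰 1) {p q : ℤ} {x y : (𝒜.totL 𝒰).Total}
    (hx : x ∈ (𝒜.totL 𝒰).homog p) (hy : y ∈ (𝒜.totL 𝒰).homog q) (n : ℕ) :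
    valDeRham K 𝒰 (B.totConnection D x y) n = inclDeRham₁.cellMap 𝒰 n n
      (B.pairing₁.cellPair 𝒰 n n (𝒜.omegaAct.cellPair 𝒰 n n (D.1 n) (𝒜.valL 𝒰 x n))
        (𝒜.valL 𝒰 y n)) := by
  obtain ⟨x, rfl⟩ := hx
  obtain ⟨y, rfl⟩ := hy
  rw [DGLieAlgebroid.valL_inj, DGLieAlgebroid.valL_inj]
  exact valDeRham_of_eq_inj (B.totConnection_inj D x y) n

/-- The form `⟨-, -⟩` on `Tot(𝒰, L)`. -/
def CyclicForm.totPairing₀ (B : CyclicForm 𝒜) (𝒰 : ι → X.Opens) :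
    (𝒜.totL 𝒰).Total →ₗ[K] (𝒜.totL 𝒰).Total →ₗ[K] (totDeRham K 𝒰).Total :=
  bilin fun p q => ((B.pairing₀.totPair 𝒰 p q).compr₂
    ((totDeRham K 𝒰).inj (p + q + -2) ∘ₗ inclDeRham₀.totMap 𝒰 (p + q)))

theorem CyclicForm.totPairing₀_inj (B : CyclicForm 𝒜)
    {p q : ℤ} (x : (𝒜.totL 𝒰).obj p) (y : (𝒜.totL 𝒰).obj q) :
    B.totPairing₀ 𝒰 ((𝒜.totL 𝒰).inj p x) ((𝒜.totL 𝒰).inj q y) =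
      (totDeRham K 𝒰).inj (p + q + -2) (inclDeRham₀.totMap 𝒰 (p + q)
        (B.pairing₀.totPair 𝒰 p q x y)) :=
  bilin_inj _ x y

theorem CyclicForm.valDeRham_totPairing₀ (B : CyclicForm 𝒜)
    {p q : ℤ} {x y : (𝒜.totL 𝒰).Total}
    (hx : x ∈ (𝒜.totL 𝒰).homog p) (hy : y ∈ (𝒜.totL 𝒰).homog q) (n : ℕ) :
    valDeRham K 𝒰 (B.totPairing₀ 𝒰 x y) n = inclDeRham₀.cellMap 𝒰 n n
      (B.pairing₀.cellPair 𝒰 n n (𝒜.valL 𝒰 x n) (𝒜.valL 𝒰 y n)) := by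
  obtain ⟨x, rfl⟩ := hx
  obtain ⟨y, rfl⟩ := hy
  rw [DGLieAlgebroid.valL_inj, DGLieAlgebroid.valL_inj]
  exact valDeRham_of_eq_inj (B.totPairing₀_inj x y) n

end

section

variable {K M N P : Type*} [Field K] [AddCommMonoid M] [AddCommMonoid N] [AddCommMonoid P]
  [Module K M] [Module K N] [Module K P]

theorem LinearMap.map_add_smul_left (f : M →ₗ[K] N →ₗ[K] P) (a b : M) (c : K) (z : N) :
    f (a + c • b) z = f a z + c • f b z := by
  rw [map_add, map_smul, add_apply, smul_apply]

theorem add_neg_smul_add_cancel (c : K) (a b : M) : a + (-1 * c) • b + c • b = a := by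
  module

theorem add_ksign_smul_cancel (p : ℤ) (a b c : M) :
    a + (-1 : K) • b + ksign K (1 + p) • c + b + ksign K p • c = a := by
  rw [ksign_add, ksign_one]
  module

theorem LinearMap.map_add_smul_assoc (f : M →ₗ[K] P) (g : N →ₗ[K] P) (a b : M) (x y : N)
    (c d : K) : f (a + c • b) + g (x + d • y) = f a + c • f b + g x + d • g y := by
  rw [map_add, map_smul, map_add, map_smul, add_assoc (_ + _)]

end

/-! ### Identities for the forms and the connection on cells -/

noncomputable section

open DGPresheaf DGLieData

variable {K : Type u} [Field K] {X : Scheme.{u}} [X.Over (Spec (.of K))]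
  {𝒜 : DGLieAlgebroid K X} {ι : Type w} {𝒰 : ι → X.Opens}

namespace CyclicForm

variable (B : CyclicForm 𝒜) {n : ℕ} {p q r : ℤ}

theorem cellPairing₁_lieBracket (t : (omegaTensor (K := K) 𝒜.L).Cell 𝒰 n n)
    {y z : (ofModules (K := K) 𝒜.L).Cell 𝒰 n n}
    (hy : y ∈ (ofModules (K := K) 𝒜.L).cellHomog 𝒰 n n p)
    (hz : z ∈ (ofModules (K := K) 𝒜.L).cellHomog 𝒰 n n q) :
    B.pairing₁.cellPair 𝒰 n n t (𝒜.lieBracket.cellPair 𝒰 n n y z) =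
      B.pairing₁.cellPair 𝒰 n n (𝒜.omegaActL.cellPair 𝒰 n n t y) z := by
  have h := Pairing.cellPair_trilinear 𝒰 B.pairing₁ 𝒜.lieBracket 𝒜.omegaActL B.pairing₁ 0
    B.pairing₁_assoc t hy hz
  rwa [zero_mul, zero_smul, add_zero] at h

theorem cellPairing₀_lieBracket (t : (ofModules (K := K) 𝒜.L).Cell 𝒰 n n)
    {y z : (ofModules (K := K) 𝒜.L).Cell 𝒰 n n}
    (hy : y ∈ (ofModules (K := K) 𝒜.L).cellHomog 𝒰 n n p)
    (hz : z ∈ (ofModules (K := K) 𝒜.L).cellHomog 𝒰 n n q) :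
    B.pairing₀.cellPair 𝒰 n n t (𝒜.lieBracket.cellPair 𝒰 n n y z) =
      B.pairing₀.cellPair 𝒰 n n (𝒜.lieBracket.cellPair 𝒰 n n t y) z := by
  have h := Pairing.cellPair_trilinear 𝒰 B.pairing₀ 𝒜.lieBracket 𝒜.lieBracket B.pairing₀ 0
    B.pairing₀_assoc t hy hz
  rwa [zero_mul, zero_smul, add_zero] at h

theorem cellPairing₀_symm {y z : (ofModules (K := K) 𝒜.L).Cell 𝒰 n n}
    (hy : y ∈ (ofModules (K := K) 𝒜.L).cellHomog 𝒰 n n p)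
    (hz : z ∈ (ofModules (K := K) 𝒜.L).cellHomog 𝒰 n n q) :
    B.pairing₀.cellPair 𝒰 n n y z = ksign K (p * q) • B.pairing₀.cellPair 𝒰 n n z y := by
  have h := Pairing.cellPair_symm 𝒰 B.pairing₀ 1 B.pairing₀_symm hy hz
  rwa [one_mul] at h

/-- The connection is a derivation by the Jacobi identity for D, x, y. Invariance then moves the
outer brackets to the second slot, and the terms in ∇y cancel. -/
theorem cellConnection_lieBracket (D : (omegaTensor (K := K) 𝒜.A).Cell 𝒰 n n)
    {x y z : (ofModules (K := K) 𝒜.L).Cell 𝒰 n n}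
    (hx : x ∈ (ofModules (K := K) 𝒜.L).cellHomog 𝒰 n n p)
    (hy : y ∈ (ofModules (K := K) 𝒜.L).cellHomog 𝒰 n n q)
    (hz : z ∈ (ofModules (K := K) 𝒜.L).cellHomog 𝒰 n n r) :
    B.pairing₁.cellPair 𝒰 n n (𝒜.omegaAct.cellPair 𝒰 n n D (𝒜.lieBracket.cellPair 𝒰 n n x y)) z +
        ksign K (p * q) • B.pairing₁.cellPair 𝒰 n n (𝒜.omegaAct.cellPair 𝒰 n n D y)
          (𝒜.lieBracket.cellPair 𝒰 n n x z) =
      B.pairing₁.cellPair 𝒰 n n (𝒜.omegaAct.cellPair 𝒰 n n D x)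
        (𝒜.lieBracket.cellPair 𝒰 n n y z) := by
  have h := Pairing.cellPair_trilinear 𝒰 𝒜.omegaAct 𝒜.lieBracket 𝒜.omegaAct 𝒜.omegaActL (-1)
    𝒜.omegaAct_jacobi D hx hy
  rw [h, B.cellPairing₁_lieBracket _ hx hz, B.cellPairing₁_lieBracket _ hy hz,
    LinearMap.map_add_smul_left]
  exact add_neg_smul_add_cancel _ _ _

/-- Leibniz rule for [D, x] with D of degree one, after replacing dD by u. -/
theorem cellD_connection {D : (omegaTensor (K := K) 𝒜.A).Cell 𝒰 n n}
    (hD : D ∈ (omegaTensor (K := K) 𝒜.A).cellHomog 𝒰 n n 1)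
    {u : (omegaTensor (K := K) 𝒜.L).Cell 𝒰 n n}
    (hu : 𝒜.inclTensor.cellMap 𝒰 n n u = (omegaTensor (K := K) 𝒜.A).cellD 𝒰 n n D)
    (x : (ofModules (K := K) 𝒜.L).Cell 𝒰 n n) :
    (omegaTensor (K := K) 𝒜.L).cellD 𝒰 n n (𝒜.omegaAct.cellPair 𝒰 n n D x) =
      𝒜.omegaActL.cellPair 𝒰 n n u x +
        (-1 : K) • 𝒜.omegaAct.cellPair 𝒰 n n D ((ofModules (K := K) 𝒜.L).cellD 𝒰 n n x) := by
  rw [Pairing.cellD_pair 𝒰 𝒜.omegaAct 𝒜.d_omegaAct hD, ← hu, DGLieAlgebroid.omegaAct_cellMap,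
    ksign_one]

variable {B}

/-- Closedness for ∇x, of degree 1 + p, and y. The term ⟨∇(dx), y⟩ cancels the one coming from
d(∇x), and invariance turns ⟨[u, x], y⟩ into ⟨u, [x, y]⟩. -/
theorem IsTotClosed.cellD_connection_pairing (hB : B.IsTotClosed 𝒰)
    (D : (omegaTensor (K := K) 𝒜.A).Tot 𝒰 1) {u : (omegaTensor (K := K) 𝒜.L).Cell 𝒰 n n}
    (hu : 𝒜.inclTensor.cellMap 𝒰 n n u = (omegaTensor (K := K) 𝒜.A).cellD 𝒰 n n (D.1 n))
    (x : (ofModules (K := K) 𝒜.L).Tot 𝒰 p) (y : (ofModules (K := K) 𝒜.L).Tot 𝒰 q) :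
    omegaOne.cellD 𝒰 n n (B.pairing₁.cellPair 𝒰 n n
        (𝒜.omegaAct.cellPair 𝒰 n n (D.1 n) (x.1 n)) (y.1 n)) +
      B.pairing₁.cellPair 𝒰 n n (𝒜.omegaAct.cellPair 𝒰 n n (D.1 n)
        ((ofModules (K := K) 𝒜.L).cellD 𝒰 n n (x.1 n))) (y.1 n) +
      ksign K p • B.pairing₁.cellPair 𝒰 n n (𝒜.omegaAct.cellPair 𝒰 n n (D.1 n) (x.1 n))
        ((ofModules (K := K) 𝒜.L).cellD 𝒰 n n (y.1 n)) =
    B.pairing₁.cellPair 𝒰 n n u (𝒜.lieBracket.cellPair 𝒰 n n (x.1 n) (y.1 n)) := by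
  have h := hB.cellD_pairing₁ (𝒜.connection 𝒰 D p x) y n
  change omegaOne.cellD 𝒰 n n (B.pairing₁.cellPair 𝒰 n n
        (𝒜.omegaAct.cellPair 𝒰 n n (D.1 n) (x.1 n)) (y.1 n)) =
      B.pairing₁.cellPair 𝒰 n n ((omegaTensor (K := K) 𝒜.L).cellD 𝒰 n n
        (𝒜.omegaAct.cellPair 𝒰 n n (D.1 n) (x.1 n))) (y.1 n) +
      ksign K (1 + p) • B.pairing₁.cellPair 𝒰 n n (𝒜.omegaAct.cellPair 𝒰 n n (D.1 n) (x.1 n))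
        ((ofModules (K := K) 𝒜.L).cellD 𝒰 n n (y.1 n)) at h
  rw [h, cellD_connection (D.2.1 n) hu, B.cellPairing₁_lieBracket _ (x.2.1 n) (y.2.1 n),
    LinearMap.map_add_smul_left]
  exact add_ksign_smul_cancel p _ _ _

/-- Closedness handles the part of the differential that stays in 𝒪. The de Rham part is the action
of D on ⟨x, y⟩, expanded by cyclicity. -/
theorem IsTotClosed.cellD_inclDeRham₀_pairing (hB : B.IsTotClosed 𝒰)
    {D : (omegaTensor (K := K) 𝒜.A).Cell 𝒰 n n}
    (hD : 𝒜.cellAnchor 𝒰 n D = 1 ⊗ₜ fun _ => LinearMap.id)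
    (x : (ofModules (K := K) 𝒜.L).Tot 𝒰 p) (y : (ofModules (K := K) 𝒜.L).Tot 𝒰 q) :
    truncDeRham.cellD 𝒰 n n (inclDeRham₀.cellMap 𝒰 n n
        (B.pairing₀.cellPair 𝒰 n n (x.1 n) (y.1 n))) =
      inclDeRham₀.cellMap 𝒰 n n (B.pairing₀.cellPair 𝒰 n n
          ((ofModules (K := K) 𝒜.L).cellD 𝒰 n n (x.1 n)) (y.1 n)) +
        ksign K p • inclDeRham₀.cellMap 𝒰 n n (B.pairing₀.cellPair 𝒰 n n (x.1 n)
          ((ofModules (K := K) 𝒜.L).cellD 𝒰 n n (y.1 n))) +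
        inclDeRham₁.cellMap 𝒰 n n (B.pairing₁.cellPair 𝒰 n n
          (𝒜.omegaAct.cellPair 𝒰 n n D (x.1 n)) (y.1 n)) +
        ksign K (p * q) • inclDeRham₁.cellMap 𝒰 n n (B.pairing₁.cellPair 𝒰 n n
          (𝒜.omegaAct.cellPair 𝒰 n n D (y.1 n)) (x.1 n)) := by
  have h := Pairing.cellPair_trilinear 𝒰 𝒜.omegaDer B.pairing₀ 𝒜.omegaAct B.pairing₁ 1
    (𝒜.omegaDer_pairing₀ B) D (x.2.1 n) (y.2.1 n)
  rw [𝒜.cellD_inclDeRham₀ 𝒰 hD, hB.cellD_pairing₀, h, one_mul]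
  exact LinearMap.map_add_smul_assoc _ _ _ _ _ _ _ _

end CyclicForm

end

theorem LinearMap.map_add_add_smul {K M N : Type*} [Field K] [AddCommMonoid M] [AddCommMonoid N]
    [Module K M] [Module K N] (f : M →ₗ[K] N) (a b d : M) (c : K) :
    f a + f b + c • f d = f (a + b + c • d) := by
  rw [map_add, map_add, map_smul]

/-! ### Existence of u and assembly of the Chern-Simons data -/

noncomputable section

open DGPresheaf DGLieData

variable {K : Type u} [Field K] {X : Scheme.{u}} [X.Over (Spec (.of K))]
  {𝒜 : DGLieAlgebroid K X} {ι : Type w} {𝒰 : ι → X.Opens}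

theorem DGLieData.inj_mem_of_eq {V : DGLieData.{u, v} K} {p q : ℤ} (h : p = q) (x : V.obj p) :
    V.inj p x ∈ V.homog q := by
  subst h
  exact inj_mem x

/-- The anchor sends D to 1 ⊗ Id, hence dD to d(1) ⊗ Id = 0, and elements killed by the anchor lift
to Ω¹ ⊗ L. -/
theorem DGLieAlgebroid.exists_d_lifting [Smooth (X ↘ Spec (.of K))]
    (hI : ∀ (c : ℕ) (I : Fin (c + 1) → ι), IsAffineOpen (inter 𝒰 I))
    {D : (omegaTensor (K := K) 𝒜.A).Tot 𝒰 1} (hD : 𝒜.IsSimplicialLifting 𝒰 D) :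
    ∃ u : (omegaTensor (K := K) 𝒜.L).Tot 𝒰 2, ∀ n, 𝒜.inclTensor.cellMap 𝒰 n n (u.1 n) =
      (omegaTensor (K := K) 𝒜.A).cellD 𝒰 n n (D.1 n) := by
  refine 𝒜.exists_tot_lift hI (m := 2) (totD 𝒰 _ 1 D).2 fun n => ?_
  refine (𝒜.cellAnchor_cellD 𝒰 n (D.1 n)).trans ?_
  rw [hD n, LinearMap.rTensor_tmul, TWForms.dForm_one, TensorProduct.zero_tmul]

/-- The image of du is d(dD) = 0, and the inclusion is injective. -/
theorem DGLieAlgebroid.cellD_eq_zero [Smooth (X ↘ Spec (.of K))]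
    (hI : ∀ (c : ℕ) (I : Fin (c + 1) → ι), IsAffineOpen (inter 𝒰 I)) {n : ℕ}
    {D : (omegaTensor (K := K) 𝒜.A).Cell 𝒰 n n} {u : (omegaTensor (K := K) 𝒜.L).Cell 𝒰 n n}
    (hu : 𝒜.inclTensor.cellMap 𝒰 n n u = (omegaTensor (K := K) 𝒜.A).cellD 𝒰 n n D) :
    (omegaTensor (K := K) 𝒜.L).cellD 𝒰 n n u = 0 := by
  apply 𝒜.cellMap_inclTensor_injective hI n n
  rw [← 𝒜.cellD_inclTensor, hu, cellD_cellD, map_zero]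

namespace CyclicForm.IsTotClosed

variable {B : CyclicForm 𝒜} (hB : B.IsTotClosed 𝒰) {p q r : ℤ} {x y z : (𝒜.totL 𝒰).Total}

section
include hB

theorem totalD_totPairing₁ {u : (omegaTensor (K := K) 𝒜.L).Tot 𝒰 2}
    (hu : ∀ n, (omegaTensor (K := K) 𝒜.L).cellD 𝒰 n n (u.1 n) = 0) (x : (𝒜.totL 𝒰).Total) :
    (totDeRham K 𝒰).totalD (B.totPairing₁ u x) = B.totPairing₁ u ((𝒜.totL 𝒰).totalD x) := by
  induction x using DirectSum.induction_on with
  | zero => simp only [map_zero]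
  | add x y hx hy => simp only [map_add, hx, hy]
  | of p x =>
    obtain ⟨w, hw⟩ := DGLieAlgebroid.exists_valL (inj_mem (V := 𝒜.totL 𝒰) x)
    change (totDeRham K 𝒰).totalD (B.totPairing₁ u ((𝒜.totL 𝒰).inj p x)) =
      B.totPairing₁ u ((𝒜.totL 𝒰).totalD ((𝒜.totL 𝒰).inj p x))
    refine ext_valDeRham fun n => ?_
    rw [valDeRham_totalD, B.valDeRham_totPairing₁, B.valDeRham_totPairing₁,
      DGLieAlgebroid.valL_totalD, hw, DGLieAlgebroid.cellD_inclDeRham₁, hB.cellD_pairing₁, hu n,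
      map_zero, LinearMap.zero_apply, zero_add, ksign_congr (p := 2) (q := 0) (by decide),
      ksign_zero, one_smul]

theorem totalD_totConnection {D : (omegaTensor (K := K) 𝒜.A).Tot 𝒰 1}
    {u : (omegaTensor (K := K) 𝒜.L).Tot 𝒰 2}
    (hu : ∀ n, 𝒜.inclTensor.cellMap 𝒰 n n (u.1 n) =
      (omegaTensor (K := K) 𝒜.A).cellD 𝒰 n n (D.1 n))
    (hx : x ∈ (𝒜.totL 𝒰).homog p) (hy : y ∈ (𝒜.totL 𝒰).homog q) :
    (totDeRham K 𝒰).totalD (B.totConnection D x y) +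
      B.totConnection D ((𝒜.totL 𝒰).totalD x) y +
      ksign K p • B.totConnection D x ((𝒜.totL 𝒰).totalD y) =
    B.totPairing₁ u ((𝒜.totL 𝒰).totalBracket x y) := by
  obtain ⟨x', hx'⟩ := DGLieAlgebroid.exists_valL hx
  obtain ⟨y', hy'⟩ := DGLieAlgebroid.exists_valL hy
  refine ext_valDeRham fun n => ?_
  rw [map_add, map_add, map_smul, Pi.add_apply, Pi.add_apply, Pi.smul_apply, valDeRham_totalD,
    B.valDeRham_totConnection D hx hy, B.valDeRham_totConnection D (totalD_mem hx) hy,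
    B.valDeRham_totConnection D hx (totalD_mem hy), B.valDeRham_totPairing₁,
    DGLieAlgebroid.valL_totalBracket hx hy, DGLieAlgebroid.valL_totalD,
    DGLieAlgebroid.valL_totalD, hx', hy', DGLieAlgebroid.cellD_inclDeRham₁]
  exact (LinearMap.map_add_add_smul _ _ _ _ _).trans
    (congrArg _ (hB.cellD_connection_pairing D (hu n) x' y'))

theorem totalD_totPairing₀ {D : (omegaTensor (K := K) 𝒜.A).Tot 𝒰 1}
    (hD : 𝒜.IsSimplicialLifting 𝒰 D)
    (hx : x ∈ (𝒜.totL 𝒰).homog p) (hy : y ∈ (𝒜.totL 𝒰).homog q) :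
    (totDeRham K 𝒰).totalD (B.totPairing₀ 𝒰 x y) =
      B.totPairing₀ 𝒰 ((𝒜.totL 𝒰).totalD x) y +
        ksign K p • B.totPairing₀ 𝒰 x ((𝒜.totL 𝒰).totalD y) +
        B.totConnection D x y + ksign K (p * q) • B.totConnection D y x := by
  obtain ⟨x', hx'⟩ := DGLieAlgebroid.exists_valL hx
  obtain ⟨y', hy'⟩ := DGLieAlgebroid.exists_valL hy
  refine ext_valDeRham fun n => ?_
  rw [map_add, map_add, map_add, map_smul, map_smul, Pi.add_apply, Pi.add_apply, Pi.add_apply,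
    Pi.smul_apply, Pi.smul_apply, valDeRham_totalD, B.valDeRham_totPairing₀ hx hy,
    B.valDeRham_totPairing₀ (totalD_mem hx) hy, B.valDeRham_totPairing₀ hx (totalD_mem hy),
    B.valDeRham_totConnection D hx hy, B.valDeRham_totConnection D hy hx,
    DGLieAlgebroid.valL_totalD, DGLieAlgebroid.valL_totalD, hx', hy']
  exact hB.cellD_inclDeRham₀_pairing (hD n) x' y'

end

end CyclicForm.IsTotClosed

namespace CyclicForm

variable (B : CyclicForm 𝒜) {p q r : ℤ} {x y z : (𝒜.totL 𝒰).Total}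

theorem _root_.DGLieAlgebroid.valL_mem (hx : x ∈ (𝒜.totL 𝒰).homog p) (n : ℕ) :
    𝒜.valL 𝒰 x n ∈ (ofModules (K := K) 𝒜.L).cellHomog 𝒰 n n p := by
  obtain ⟨x', hx'⟩ := DGLieAlgebroid.exists_valL hx
  rw [hx']
  exact x'.2.1 n

theorem totConnection_bracket (D : (omegaTensor (K := K) 𝒜.A).Tot 𝒰 1)
    (hx : x ∈ (𝒜.totL 𝒰).homog p) (hy : y ∈ (𝒜.totL 𝒰).homog q) (hz : z ∈ (𝒜.totL 𝒰).homog r) :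
    B.totConnection D ((𝒜.totL 𝒰).totalBracket x y) z +
        ksign K (p * q) • B.totConnection D y ((𝒜.totL 𝒰).totalBracket x z) =
      B.totConnection D x ((𝒜.totL 𝒰).totalBracket y z) := by
  refine ext_valDeRham fun n => ?_
  rw [map_add, map_smul, Pi.add_apply, Pi.smul_apply,
    B.valDeRham_totConnection D (totalBracket_mem hx hy) hz,
    B.valDeRham_totConnection D hy (totalBracket_mem hx hz),
    B.valDeRham_totConnection D hx (totalBracket_mem hy hz),
    DGLieAlgebroid.valL_totalBracket hx hy, DGLieAlgebroid.valL_totalBracket hx hz,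
    DGLieAlgebroid.valL_totalBracket hy hz,
    ← B.cellConnection_lieBracket _ (DGLieAlgebroid.valL_mem hx n) (DGLieAlgebroid.valL_mem hy n)
      (DGLieAlgebroid.valL_mem hz n), map_add, map_smul]

theorem totPairing₀_symm (hx : x ∈ (𝒜.totL 𝒰).homog p) (hy : y ∈ (𝒜.totL 𝒰).homog q) :
    B.totPairing₀ 𝒰 x y = ksign K (p * q) • B.totPairing₀ 𝒰 y x := by
  refine ext_valDeRham fun n => ?_
  rw [map_smul, Pi.smul_apply, B.valDeRham_totPairing₀ hx hy, B.valDeRham_totPairing₀ hy hx,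
    B.cellPairing₀_symm (DGLieAlgebroid.valL_mem hx n) (DGLieAlgebroid.valL_mem hy n), map_smul]

theorem totPairing₀_bracket (hx : x ∈ (𝒜.totL 𝒰).homog p) (hy : y ∈ (𝒜.totL 𝒰).homog q)
    (hz : z ∈ (𝒜.totL 𝒰).homog r) :
    B.totPairing₀ 𝒰 x ((𝒜.totL 𝒰).totalBracket y z) =
      B.totPairing₀ 𝒰 ((𝒜.totL 𝒰).totalBracket x y) z := by
  refine ext_valDeRham fun n => ?_
  rw [B.valDeRham_totPairing₀ hx (totalBracket_mem hy hz),
    B.valDeRham_totPairing₀ (totalBracket_mem hx hy) hz, DGLieAlgebroid.valL_totalBracket hy hz,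
    DGLieAlgebroid.valL_totalBracket hx hy,
    B.cellPairing₀_lieBracket _ (DGLieAlgebroid.valL_mem hy n) (DGLieAlgebroid.valL_mem hz n)]

/-- The forms `⟨u, -⟩`, `⟨∇ -, -⟩` and `⟨-, -⟩` on `Tot(𝒰, L)`. -/
def chernSimonsData (hB : B.IsTotClosed 𝒰) {D : (omegaTensor (K := K) 𝒜.A).Tot 𝒰 1}
    (hD : 𝒜.IsSimplicialLifting 𝒰 D) {u : (omegaTensor (K := K) 𝒜.L).Tot 𝒰 2}
    (hu : ∀ n, 𝒜.inclTensor.cellMap 𝒰 n n (u.1 n) =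
      (omegaTensor (K := K) 𝒜.A).cellD 𝒰 n n (D.1 n))
    (hdu : ∀ n, (omegaTensor (K := K) 𝒜.L).cellD 𝒰 n n (u.1 n) = 0) :
    ChernSimonsData (𝒜.totL 𝒰) (totDeRham K 𝒰) where
  g := B.totPairing₁ u
  N := B.totConnection D
  C := B.totPairing₀ 𝒰
  g_mem {p _} hx := by
    obtain ⟨x, rfl⟩ := hx
    rw [B.totPairing₁_inj]
    -- Here u has degree two, which cancels the shift by -2; for N below, D has degree one and the
    -- shift leaves -1.
    exact inj_mem_of_eq (by ring) _
  N_mem {p q _ _} hx hy := by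
    obtain ⟨x, rfl⟩ := hx
    obtain ⟨y, rfl⟩ := hy
    rw [B.totConnection_inj]
    exact inj_mem_of_eq (by ring) _
  C_mem {p q _ _} hx hy := by
    obtain ⟨x, rfl⟩ := hx
    obtain ⟨y, rfl⟩ := hy
    rw [B.totPairing₀_inj]
    exact inj_mem_of_eq (by ring) _
  d_g := hB.totalD_totPairing₁ hdu
  d_N hx hy := by rw [← hB.totalD_totConnection hu hx hy]; abel
  d_C := hB.totalD_totPairing₀ hD
  N_bracket hx hy hz := eq_sub_of_add_eq (B.totConnection_bracket D hx hy hz)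
  C_symm := B.totPairing₀_symm
  C_bracket := B.totPairing₀_bracket

end CyclicForm

end

/-! ### The theorem -/

theorem mainTheorem1 {K : Type u} [Field K] [CharZero K] (X : Scheme.{u})
    [X.Over (Spec (.of K))] [Smooth (X ↘ Spec (.of K))] [IsSeparated (X ↘ Spec (.of K))]
    [LocallyOfFiniteType (X ↘ Spec (.of K))] [QuasiCompact (X ↘ Spec (.of K))]
    (𝒜 : DGLieAlgebroid K X) (h𝒜 : 𝒜.IsTransitive) (hL : 𝒜.IsFiniteLocallyFreeKernel)
    {ι : Type w} (𝒰 : ι → X.Opens) (h𝒰 : ∀ i, IsAffineOpen (𝒰 i)) (hcov : ⨆ i, 𝒰 i = ⊤)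
    (B : CyclicForm 𝒜) (hB : B.IsTotClosed 𝒰)
    (D : (DGPresheaf.omegaTensor 𝒜.A).Tot 𝒰 1) (hD : 𝒜.IsSimplicialLifting 𝒰 D) :
    (𝒜.totL 𝒰).IsDGLieAlgebra ∧
    (totDeRham K 𝒰).IsDGLieAlgebra ∧ (totDeRham K 𝒰).IsAbelian ∧
    ∃ u : (DGPresheaf.omegaTensor 𝒜.L).Tot 𝒰 2,
      (𝒜.inclTensor.totMap 𝒰 2 u).1 = (DGPresheaf.totD 𝒰 _ 1 D).1 ∧
      ∃ f : LInftyMorphism (𝒜.totL 𝒰) (totDeRham K 𝒰),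
        (∀ (p : ℤ) (x : (𝒜.totL 𝒰).obj p),
          f.map 1 ![(𝒜.totL 𝒰).inj p x] =
            (totDeRham K 𝒰).inj _
              (DGPresheaf.inclDeRham₁.totMap 𝒰 _ (B.pairing₁.totPair 𝒰 2 p u x))) ∧
        (∀ (p q : ℤ) (x : (𝒜.totL 𝒰).obj p) (y : (𝒜.totL 𝒰).obj q),
          f.map 2 ![(𝒜.totL 𝒰).inj p x, (𝒜.totL 𝒰).inj q y] =
            (1 / 2 : K) •
              ((totDeRham K 𝒰).inj _
                  (DGPresheaf.inclDeRham₁.totMap 𝒰 _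
                    (B.pairing₁.totPair 𝒰 (1 + p) q (𝒜.connection 𝒰 D p x) y)) -
                (p * q).negOnePow •
                  (totDeRham K 𝒰).inj _
                    (DGPresheaf.inclDeRham₁.totMap 𝒰 _
                      (B.pairing₁.totPair 𝒰 (1 + q) p (𝒜.connection 𝒰 D q y) x)))) ∧
        (∀ (p q r : ℤ) (x : (𝒜.totL 𝒰).obj p) (y : (𝒜.totL 𝒰).obj q) (z : (𝒜.totL 𝒰).obj r),
          f.map 3 ![(𝒜.totL 𝒰).inj p x, (𝒜.totL 𝒰).inj q y, (𝒜.totL 𝒰).inj r z] =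
            -((1 / 2 : K) •
              (totDeRham K 𝒰).inj _
                (DGPresheaf.inclDeRham₀.totMap 𝒰 _
                  (B.pairing₀.totPair 𝒰 p (q + r) x ((𝒜.totL 𝒰).bracket q r y z))))) ∧
        ∀ n : ℕ, 4 ≤ n → f.map n = 0 := by
  have hI : ∀ (c : ℕ) (I : Fin (c + 1) → ι), IsAffineOpen (DGPresheaf.inter 𝒰 I) :=
    fun _ I => isAffineOpen_inter (K := K) h𝒰 I
  obtain ⟨u, hu⟩ := DGLieAlgebroid.exists_d_lifting hI hD
  have hV := 𝒜.totL_isDGLieAlgebra 𝒰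
  -- From here on only the formal identities matter; the prescribed formulas for the components hold
  -- by construction.
  let S := B.chernSimonsData hB hD hu fun n => DGLieAlgebroid.cellD_eq_zero hI (hu n)
  refine ⟨hV, totDeRham_isDGLieAlgebra 𝒰, totDeRham_isAbelian 𝒰, u, funext hu,
    S.toLInftyMorphism hV, fun p x => B.totPairing₁_inj u x, fun p q x y => ?_,
    fun p q r x y z => ?_, fun n hn => S.component_of_four_le hn⟩
  · refine (S.quadratic_apply (DGLieData.inj_mem x) (DGLieData.inj_mem y)).trans ?_
    rw [negOnePow_smul (K := K)]
    exact congrArg _ (congrArg₂ _ (B.totConnection_inj D x y)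
      (congrArg _ (B.totConnection_inj D y x)))
  · refine (S.cubic_apply _ _ _).trans (congrArg _ (congrArg _ ?_))
    exact (congrArg (B.totPairing₀ 𝒰 ((𝒜.totL 𝒰).inj p x)) (DGLieData.totalBracket_inj y z)).trans
      (B.totPairing₀_inj x _)
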